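/- Let $B$ be the quaternion algebra over $\mathbb{Q}$ ramified exactly at $\infty$ and $23$, $R \subset B$ a maximal order, and $B \hookrightarrow M_2(\mathbb{Q}_2)$ an embedding taking $R$ into $M_2(\mathbb{Z}_2)$. Let $\Gamma$ be the image of $R[1/2]^\times$ in $\mathrm{GL}_2(\mathbb{Q}_2)$, $\mathbf{X} = \Gamma\backslash \mathrm{GL}_2(\mathbb{Q}_2)$ and $\mathbf{Y} = \mathbf{X}/\mathrm{GL}_2(\mathbb{Z}_2)$, where $\mathbf{X}$ carries the quotient of the Haar measure giving $\mathrm{GL}_2(\mathbb{Z}_2)$ volume $2$. For odd $m$ let $T_m\varphi(x) = \sum_{\alpha\in M_m/\Gamma}\varphi(\alpha^{-1}x)$ with $M_m = \{\alpha \in R[1/2] : \mathrm{nr}(\alpha) \in m\,\mathbb{Z}[1/2]^\times\}$; let $T_{2^r}\varphi(x) = \sum_h \varphi(xh)$, the sum over cosets $h\,\mathrm{GL}_2(\mathbb{Z}_2)$ with $h \in M_2(\mathbb{Z}_2)$ and $\det h \in 2^r\mathbb{Z}_2^\times$; and let $T_{2^r m} = T_m T_{2^r}$. Let $\Psi_1,\Psi_2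 : \mathbf{Y} \to \mathbb{R}$ be orthonormal Hecke eigenfunctions of mean zero, $T_n \Psi_k = \sqrt{n}\,\lambda_{\Psi_k}(n)\Psi_k$ for $n \ge 1$, with $L^2(\mathbf{Y}) = \mathbb{C}\oplus\mathbb{C}\Psi_1\oplus\mathbb{C}\Psi_2$. Put $L_2(\Psi_k,s) = (1-\lambda_{\Psi_k}(2)2^{-s}+2^{-2s})^{-1}$ and $\zeta_p(s) = (1-p^{-s})^{-1}$. Let $\Xi_k$ be the normalized spherical matrix coefficient of $\Psi_k$, i.e. the function on $\mathrm{PGL}_2(\mathbb{Q}_2)$ induced by $$g \mapsto \langle \Psi_k(\cdot\, g),\Psi_k\rangle_{L^2(\mathbf{X})}/\langle\Psi_k,\Psi_k\rangle_{L^2(\mathbf{X})}.$$ Let $\kappa_0>0$ be defined by $\kappa_0^{-2}2^{-2} = \big((4\pi)^2\,\zeta^{(S)}(2)\,\zeta_2(1)\,\zeta_{23}(1)\big)^{-1}$, where $S=\{2,23\}$ and $\zeta^{(S)}(s) = \zeta(s)/\prod_{p\in S}\zeta_p(s)$. Define functions $\chi_1,\chi_2,\chi_3$ on the trace-zero subspace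 $M_2(\mathbb{Q}_2)^0$ of $M_2(\mathbb{Q}_2)$ by $$\chi_1,\chi_2,\chi_3 \begin{pmatrix} a & 2b\\ 2c& -a\end{pmatrix} = (-1)^{b+c},\ (-1)^{a+c},\ (-1)^{a+b}\qquad (a,b,c\in\mathbb{Z}_2)$$ and by zero elsewhere. Put $\phi''(\beta) = 2^{-3}\kappa_0\sum_{i=1}^3\chi_i(4\beta)$, and let $\phi = 1_{\mathbb{Z}_2^\times}\otimes\phi''$, i.e. $\phi(m+\beta) = 1_{\mathbb{Z}_2^\times}(m)\,\phi''(\beta)$ for $m\in\mathbb{Q}_2$, $\beta\in M_2(\mathbb{Q}_2)^0$; then $\phi \in \mathcal{S}(M_2(\mathbb{Q}_2))$ (locally constant, compactly supported). Let $\mathrm{Ad}(g)\phi(\alpha) = \phi(g^{-1}\alpha g)$, and define $\langle\,,\rangle$ on $L^2(M_2(\mathbb{Q}_2))$ by the Haar measure that is self-dual for the Fourier transform attached to an unramified character of $\mathbb{Q}_2$ and the pairing $\langle\alpha,\alpha'\rangle=\mathrm{tr}(\alpha\alpha'^{\iota})$, where $\iota$ is the main involution. Equip $\mathrm{PGL}_2(\mathbb{Q}_2)$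 with the Haar measure giving $\mathrm{PGL}_2(\mathbb{Z}_2)$ volume one. Then for $k=1,2$ the integral $\int_{\mathrm{PGL}_2(\mathbb{Q}_2)}\langle \mathrm{Ad}(g)\phi,\phi\rangle\,\Xi_k(g)\,dg$ converges absolutely and $$\int_{\mathrm{PGL}_2(\mathbb{Q}_2)}\langle \mathrm{Ad}(g)\phi,\phi\rangle\,\Xi_k(g)\,dg = 2^{-4}\kappa_0^2\left(2+\frac{L_2(\Psi_k,\tfrac12)}{\zeta_2(2)}\right).$$ -/

import Mathlib

open MeasureTheory
open scoped Quaternion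

noncomputable section

/-! ### The `2`-adic groups -/

/-- `M₂(ℚ₂)`, with its product topology. -/
abbrev M2 : Type := Matrix (Fin 2) (Fin 2) ℚ_[2]

/-- `GL₂(ℚ₂)`. -/
abbrev GL2 : Type := GL (Fin 2) ℚ_[2]

/-- `PGL₂(ℚ₂)`: the quotient of `GL₂(ℚ₂)` by its centre. -/
abbrev PGL2 : Type := GL2 ⧸ Subgroup.center GL2

instance instMeasurableSpaceM2 : MeasurableSpace M2 := borel M2

instance instBorelSpaceM2 : BorelSpace M2 := ⟨rfl⟩

/-- `M₂(ℤ₂)`, as a subset of `M₂(ℚ₂)`. -/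
def integralM2 : Set M2 := {β | ∀ i j, ‖β i j‖ ≤ 1}

/-- `K = GL₂(ℤ₂)`, as a subgroup of `GL₂(ℚ₂)`. -/
def K2 : Subgroup GL2 :=
  (Matrix.GeneralLinearGroup.map (n := Fin 2) (algebraMap ℤ_[2] ℚ_[2])).range

/-- `PGL₂(ℤ₂)`: the image of `GL₂(ℤ₂)` in `PGL₂(ℚ₂)`. -/
def PK2 : Subgroup PGL2 := K2.map (QuotientGroup.mk' (Subgroup.center GL2))

/-- `2`, as a unit of `ℚ₂`. -/
def twoUnit : ℚ_[2]ˣ := Units.mk0 2 two_ne_zero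

/-- An element of the centre of `GL₂(ℚ₂)` is a power of `2` times an element of `GL₂(ℤ₂)`. -/
theorem center_decomp (z : GL2) (hz : z ∈ Subgroup.center GL2) :
    ∃ (m : ℤ) (u : GL2), u ∈ K2 ∧
      z = (Matrix.GeneralLinearGroup.scalar (Fin 2) twoUnit) ^ m * u := by
  rw [Matrix.GeneralLinearGroup.center_eq_range_scalar] at hz
  obtain ⟨c, rfl⟩ := hz
  set m : ℤ := (c : ℚ_[2]).valuation with hm
  have hn : ‖((twoUnit ^ (-m) * c : ℚ_[2]ˣ) : ℚ_[2])‖ = 1 := by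
    have h2 : ‖(2 : ℚ_[2])‖ = 2⁻¹ := by
      have := Padic.norm_p (p := 2)
      simpa using this
    have hc := Padic.norm_eq_zpow_neg_valuation (p := 2) c.ne_zero
    rw [← hm] at hc
    simp only [twoUnit, Units.val_mul, Units.val_zpow_eq_zpow_val, Units.val_mk0, norm_mul,
      norm_zpow, h2, hc]
    push_cast
    rw [inv_zpow', neg_neg, ← zpow_add₀ (by norm_num)]
    simp
  let v : ℤ_[2]ˣ := PadicInt.mkUnits hn
  refine ⟨m, Matrix.GeneralLinearGroup.scalar (Fin 2) (twoUnit ^ (-m) * c),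
    ⟨Matrix.GeneralLinearGroup.scalar (Fin 2) v, ?_⟩, ?_⟩
  · ext i j
    change (((Matrix.scalar (Fin 2) ((v : ℤ_[2])) : Matrix (Fin 2) (Fin 2) ℤ_[2]) i j : ℤ_[2]) : ℚ_[2])
      = (Matrix.scalar (Fin 2) ((twoUnit ^ (-m) * c : ℚ_[2]ˣ) : ℚ_[2]) : M2) i j
    rw [Matrix.scalar_apply, Matrix.scalar_apply, Matrix.diagonal_apply, Matrix.diagonal_apply]
    split_ifs
    · rfl
    · rfl
  · rw [← map_zpow, ← map_mul]
    simp

/-- Conjugation of `M₂(ℚ₂)` by `GL₂(ℚ₂)`. -/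
def conjM2 : GL2 →* Function.End M2 where
  toFun g := fun β => (g : M2) * β * ((g⁻¹ : GL2) : M2)
  map_one' := by
    funext β
    change ((1 : GL2) : M2) * β * (((1 : GL2)⁻¹ : GL2) : M2) = β
    simp
  map_mul' g h := by
    funext β
    change ((g * h : GL2) : M2) * β * (((g * h)⁻¹ : GL2) : M2)
      = (g : M2) * ((h : M2) * β * ((h⁻¹ : GL2) : M2)) * ((g⁻¹ : GL2) : M2)
    rw [mul_inv_rev]
    simp only [Units.val_mul, mul_assoc]

theorem conjM2_center (z : GL2) (hz : z ∈ Subgroup.center GL2) : conjM2 z = 1 := by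
  rw [Matrix.GeneralLinearGroup.center_eq_range_scalar] at hz
  obtain ⟨c, rfl⟩ := hz
  funext β
  change ((Matrix.GeneralLinearGroup.scalar (Fin 2) c : GL2) : M2) * β *
    (((Matrix.GeneralLinearGroup.scalar (Fin 2) c)⁻¹ : GL2) : M2) = β
  have h : ((Matrix.GeneralLinearGroup.scalar (Fin 2) c : GL2) : M2) * β
      = β * ((Matrix.GeneralLinearGroup.scalar (Fin 2) c : GL2) : M2) :=
    (Matrix.scalar_commute (n := Fin 2) (c : ℚ_[2]) (fun r => Commute.all _ r) β).eq
  rw [h, mul_assoc, Units.mul_inv, mul_one]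

/-- The adjoint action of `PGL₂(ℚ₂)` on `M₂(ℚ₂)`: the class of `g` acts by `β ↦ g β g⁻¹`. -/
def Ad : PGL2 →* Function.End M2 :=
  QuotientGroup.lift (Subgroup.center GL2) conjM2 conjM2_center

/-- `(Ad(g) φ)(β) = φ(Ad(g)⁻¹ β)`. -/
def AdFun (g : PGL2) (φ : M2 → ℂ) : M2 → ℂ := fun β => φ (Ad g⁻¹ β)

/-! ### The Fourier transform and the inner product on `M₂(ℚ₂)` -/

/-- The trace pairing `⟨α, β⟩ = tr(α β^ι)`, where `β^ι` is the main involution. -/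
def tracePairing (α β : M2) : ℚ_[2] := (α * β.adjugate).trace

/-- `ψ` is an unramified character of `ℚ₂`: continuous, with
`{x | ψ is trivial on x ℤ₂} = ℤ₂`. -/
def IsUnramifiedChar (ψ : AddChar ℚ_[2] Circle) : Prop :=
  Continuous ψ ∧ ∀ x : ℚ_[2], (∀ y : ℚ_[2], ‖y‖ ≤ 1 → ψ (x * y) = 1) ↔ ‖x‖ ≤ 1

/-- The Fourier transform on `M₂(ℚ₂)` with respect to `ψ`, the trace pairing and `ν`. -/
def fourierM2 (ψ : AddChar ℚ_[2] Circle) (ν : Measure M2) (φ : M2 → ℂ) (α : M2) : ℂ :=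
  ∫ β, φ β * (ψ (tracePairing α β) : ℂ) ∂ν

/-- Schwartz--Bruhat functions on `M₂(ℚ₂)`. -/
def IsSchwartzBruhat (φ : M2 → ℂ) : Prop := IsLocallyConstant φ ∧ HasCompactSupport φ

/-- `ν` is self-dual for the Fourier transform: `𝓕 𝓕 φ (α) = φ (-α)` for all Schwartz--Bruhat
`φ`. -/
def IsSelfDual (ψ : AddChar ℚ_[2] Circle) (ν : Measure M2) : Prop :=
  ∀ φ : M2 → ℂ, IsSchwartzBruhat φ → ∀ α, fourierM2 ψ ν (fourierM2 ψ ν φ) α = φ (-α)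

/-- The inner product of `L²(M₂(ℚ₂), ν)`. -/
def innerM2 (ν : Measure M2) (φ₁ φ₂ : M2 → ℂ) : ℂ := ∫ α, φ₁ α * star (φ₂ α) ∂ν

/-! ### The constant `κ₀` -/

/-- `ζ_p(s) = (1 - p^{-s})⁻¹`. -/
def zetaLocal (p : ℕ) (s : ℝ) : ℝ := (1 - (p : ℝ) ^ (-s))⁻¹

/-- `κ₁ = 1 / ((4π)² ζ^{(S)}(2) ζ₂(1) ζ₂₃(1))`, where `S = {2, 23}` and `ζ^{(S)}` is the zeta
function without its Euler factors in `S`. -/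
def kappa1 : ℝ :=
  1 / ((4 * Real.pi) ^ 2 * ((riemannZeta 2).re / (zetaLocal 2 2 * zetaLocal 23 2)) *
    zetaLocal 2 1 * zetaLocal 23 1)

/-- The positive number `κ₀` with `κ₁ = κ₀⁻² 2⁻²`. -/
def kappa0 : ℝ := (2 * √kappa1)⁻¹

theorem kappa1_pos : 0 < kappa1 := by
  have h : (riemannZeta 2).re = Real.pi ^ 2 / 6 := by
    rw [riemannZeta_two]
    norm_cast
  have hp := Real.pi_pos
  unfold kappa1
  rw [h]
  norm_num [zetaLocal, Real.rpow_neg, Real.rpow_two]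
  positivity

theorem kappa0_spec : 0 < kappa0 ∧ kappa1 = kappa0 ^ (-2 : ℤ) * 2 ^ (-2 : ℤ) := by
  have h := kappa1_pos
  have h' := Real.sqrt_pos.2 h
  refine ⟨by unfold kappa0; positivity, ?_⟩
  have h2 := Real.sq_sqrt h.le
  unfold kappa0
  rw [inv_zpow, zpow_neg, inv_inv, zpow_neg]
  norm_cast
  rw [mul_pow, h2]
  norm_num
  ring

/-! ### The Schwartz--Bruhat function `φ` -/

/-- The quadratic character of `ℤ₂ / 2ℤ₂`, that is `x ↦ (-1)^x`. -/
def sgn2 (x : ℚ_[2]) : ℂ := if ‖x‖ < 1 then 1 else -1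

open Classical in
/-- For `β` in the trace-zero lattice `S⁰` of all `(a, 2b; 2c, -a)` with `a, b, c ∈ ℤ₂`,
`χ₁(β) = (-1)^{b+c}`, `χ₂(β) = (-1)^{a+c}`, `χ₃(β) = (-1)^{a+b}`; extended by zero. The index
`0, 1, 2` stands for `1, 2, 3`. -/
def chi (i : Fin 3) (β : M2) : ℂ :=
  let a := β 0 0
  let b := β 0 1 / 2
  let c := β 1 0 / 2
  if β.trace = 0 ∧ ‖a‖ ≤ 1 ∧ ‖b‖ ≤ 1 ∧ ‖c‖ ≤ 1 then
    ![sgn2 (b + c), sgn2 (a + c), sgn2 (a + b)] i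
  else 0

/-- `φ'' (β) = 2⁻³ κ₀ ∑ᵢ χᵢ(4β)` for trace-zero `β`. -/
def phi'' (β : M2) : ℂ := 2 ^ (-3 : ℤ) * (kappa0 : ℂ) * ∑ i : Fin 3, chi i ((4 : ℚ_[2]) • β)

/-- `φ'`, the characteristic function of `ℤ₂ˣ`. -/
def phi' (m : ℚ_[2]) : ℂ := if ‖m‖ = 1 then 1 else 0

/-- `φ(m + β) = φ'(m) φ''(β)` for scalar `m` and trace-zero `β`. -/
def phi (α : M2) : ℂ :=
  let m := α.trace / 2
  phi' m * phi'' (α - Matrix.scalar (Fin 2) m)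

/-! ### The quaternion algebra and the group `Γ` -/

/-- The quaternion algebra `(a, b / ℚ)` is ramified exactly at `∞` and `23`. -/
def IsRamifiedAtInftyAnd23 (a b : ℚ) : Prop :=
  (∀ x : ℍ[ℝ, (a : ℝ), (b : ℝ)], x ≠ 0 → IsUnit x) ∧
  ∀ (p : ℕ) [Fact p.Prime],
    (p = 23 → ∀ x : ℍ[ℚ_[p], (a : ℚ_[p]), (b : ℚ_[p])], x ≠ 0 → IsUnit x) ∧
    (p ≠ 23 → Nonempty (ℍ[ℚ_[p], (a : ℚ_[p]), (b : ℚ_[p])] ≃ₐ[ℚ_[p]]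
      Matrix (Fin 2) (Fin 2) ℚ_[p]))

section Quaternion

variable {a b : ℚ}

/-- `R` is an order: a subring, finitely generated over `ℤ`, that spans the algebra over `ℚ`. -/
def IsOrder (R : Subring ℍ[ℚ, a, b]) : Prop :=
  R.toAddSubgroup.FG ∧ Submodule.span ℚ (R : Set ℍ[ℚ, a, b]) = ⊤

/-- `R[1/2]`. -/
def invertTwo (R : Subring ℍ[ℚ, a, b]) : Subring ℍ[ℚ, a, b] where
  carrier := {x | ∃ n : ℕ, (2 : ℚ) ^ n • x ∈ R}
  zero_mem' := ⟨0, by simp⟩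
  one_mem' := ⟨0, by simp⟩
  mul_mem' := by
    rintro x y ⟨m, hm⟩ ⟨n, hn⟩
    refine ⟨m + n, ?_⟩
    have h := R.mul_mem hm hn
    rwa [smul_mul_smul_comm, ← pow_add] at h
  add_mem' := by
    rintro x y ⟨m, hm⟩ ⟨n, hn⟩
    refine ⟨m + n, ?_⟩
    have key : ∀ (k : ℕ) (z : ℍ[ℚ, a, b]), z ∈ R → (2 : ℚ) ^ k • z ∈ R := by
      intro k z hz
      have h := R.nsmul_mem hz (2 ^ k)
      rwa [← Nat.cast_smul_eq_nsmul ℚ, Nat.cast_pow, Nat.cast_ofNat] at h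
    rw [smul_add]
    refine R.add_mem ?_ ?_
    · rw [pow_add, mul_comm, mul_smul]
      exact key n _ hm
    · rw [pow_add, mul_smul]
      exact key m _ hn
  neg_mem' := by
    rintro x ⟨n, hn⟩
    exact ⟨n, by rw [smul_neg]; exact R.neg_mem hn⟩

/-- The reduced norm. -/
def reducedNorm (x : ℍ[ℚ, a, b]) : ℚ := (x * star x).re

/-- `Γ`: the image of `R[1/2]ˣ` in `GL₂(ℚ₂)`. -/
def Gam (R : Subring ℍ[ℚ, a, b]) (ι : ℍ[ℚ, a, b] →ₐ[ℚ] M2) : Subgroup GL2 :=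
  (Units.map ((ι : ℍ[ℚ, a, b] →* M2).comp ((invertTwo R).subtype : invertTwo R →* ℍ[ℚ, a, b]))).range

theorem scalar_two_mem_Gam (R : Subring ℍ[ℚ, a, b]) (ι : ℍ[ℚ, a, b] →ₐ[ℚ] M2) :
    Matrix.GeneralLinearGroup.scalar (Fin 2) twoUnit ∈ Gam R ι := by
  have h2 : (2 : ℍ[ℚ, a, b]) ∈ invertTwo R :=
    ⟨0, by rw [pow_zero, one_smul, ← one_add_one_eq_two]; exact R.add_mem R.one_mem R.one_mem⟩
  have e : (2 : ℚ) • algebraMap ℚ ℍ[ℚ, a, b] (1 / 2) = 1 := by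
    rw [Algebra.smul_def, ← map_mul]
    norm_num
  have hh : algebraMap ℚ ℍ[ℚ, a, b] (1 / 2) ∈ invertTwo R :=
    ⟨1, by rw [pow_one, e]; exact R.one_mem⟩
  have e1 : (2 : ℍ[ℚ, a, b]) * algebraMap ℚ ℍ[ℚ, a, b] (1 / 2) = 1 := by
    rw [← map_ofNat (algebraMap ℚ ℍ[ℚ, a, b]) 2, ← map_mul]
    norm_num
  have e2 : algebraMap ℚ ℍ[ℚ, a, b] (1 / 2) * 2 = 1 := by
    rw [← map_ofNat (algebraMap ℚ ℍ[ℚ, a, b]) 2, ← map_mul]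
    norm_num
  refine ⟨⟨⟨2, h2⟩, ⟨_, hh⟩, Subtype.ext e1, Subtype.ext e2⟩, ?_⟩
  ext1
  change ι 2 = Matrix.scalar (Fin 2) (2 : ℚ_[2])
  rw [map_ofNat, map_ofNat]

/-- A real-valued function on `𝐘 = Γ \ GL₂(ℚ₂) / GL₂(ℤ₂)`. -/
structure FunY (R : Subring ℍ[ℚ, a, b]) (ι : ℍ[ℚ, a, b] →ₐ[ℚ] M2) where
  toFun : GL2 → ℝ
  left_inv : ∀ γ ∈ Gam R ι, ∀ x, toFun (γ * x) = toFun x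
  right_inv : ∀ k ∈ K2, ∀ x, toFun (x * k) = toFun x

/-! ### Hecke operators -/

/-- `M_m = {α ∈ R[1/2] : nr(α) ∈ m ℤ[1/2]ˣ}`, as a subset of `GL₂(ℚ₂)`. -/
def heckeSet (R : Subring ℍ[ℚ, a, b]) (ι : ℍ[ℚ, a, b] →ₐ[ℚ] M2) (m : ℕ) : Set GL2 :=
  {g | ∃ α ∈ invertTwo R, ι α = (g : M2) ∧
    ∃ k : ℤ, reducedNorm α = m * 2 ^ k ∨ reducedNorm α = -(m * 2 ^ k)}

/-- For odd `m`, `T_m φ (x) = ∑_{α ∈ M_m / Γ} φ(α⁻¹ x)`, for left `Γ`-invariant `φ`. -/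
def heckeOdd (R : Subring ℍ[ℚ, a, b]) (ι : ℍ[ℚ, a, b] →ₐ[ℚ] M2) (m : ℕ) (φ : GL2 → ℝ) :
    GL2 → ℝ := fun x =>
  ∑ᶠ (c : GL2 ⧸ Gam R ι) (_ : c ∈ (QuotientGroup.mk '' heckeSet R ι m : Set (GL2 ⧸ Gam R ι))),
    φ (c.out⁻¹ * x)

/-- `T_{2^r} φ (x) = ∑ φ(x h)`, for right `K`-invariant `φ`; the sum is over the cosets `h K` of
integral matrices `h` whose determinant has valuation `r`. -/
def heckeTwoPow (r : ℕ) (φ : GL2 → ℝ) : GL2 → ℝ := fun x =>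
  ∑ᶠ (c : GL2 ⧸ K2) (_ : c ∈ (QuotientGroup.mk ''
      {h : GL2 | (h : M2) ∈ integralM2 ∧ ‖(h : M2).det‖ = 2 ^ (-(r : ℤ))} : Set (GL2 ⧸ K2))),
    φ (x * c.out)

/-- The Hecke operator `T_n` on functions on `𝐘`: `T_{2^r m} = T_m T_{2^r}` for odd `m`. -/
def hecke (R : Subring ℍ[ℚ, a, b]) (ι : ℍ[ℚ, a, b] →ₐ[ℚ] M2) (n : ℕ) (φ : GL2 → ℝ) :
    GL2 → ℝ :=
  heckeOdd R ι (n / 2 ^ n.factorization 2) (heckeTwoPow (n.factorization 2) φ)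

/-! ### The eigenfunctions and their spherical matrix coefficients -/

/-- `⟨f₁, f₂⟩` in `L²(Γ \ GL₂(ℚ₂))`, for real-valued left `Γ`-invariant functions, where the
quotient measure is computed on a fundamental domain `D` for `Γ`. -/
def innerX (μ : Measure GL2) (D : Set GL2) (f₁ f₂ : GL2 → ℝ) : ℝ := ∫ x in D, f₁ x * f₂ x ∂μ

/-- `Ψ₁, Ψ₂` are real-valued Hecke eigenfunctions on `𝐘`, with `T_n Ψ_k = √n λ_k(n) Ψ_k`, which are
orthonormal and of mean zero, and `L²(𝐘)` is the span of `1, Ψ₁, Ψ₂`. The index `0, 1` stands for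
`1, 2`. -/
structure IsHeckeBasis {R : Subring ℍ[ℚ, a, b]} {ι : ℍ[ℚ, a, b] →ₐ[ℚ] M2}
    (μ : Measure GL2) (D : Set GL2) (Ψ : Fin 2 → FunY R ι) (lam : Fin 2 → ℕ → ℝ) : Prop where
  eigen : ∀ k, ∀ n : ℕ, 1 ≤ n → ∀ x,
    hecke R ι n (Ψ k).toFun x = √n * lam k n * (Ψ k).toFun x
  mean_zero : ∀ k, innerX μ D (Ψ k).toFun (fun _ => 1) = 0
  orthonormal : ∀ k l, innerX μ D (Ψ k).toFun (Ψ l).toFun = if k = l then 1 else 0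
  span : ∀ f : FunY R ι, ∃ c₀ c₁ c₂ : ℝ, ∀ x,
    f.toFun x = c₀ + c₁ * (Ψ 0).toFun x + c₂ * (Ψ 1).toFun x

variable {R : Subring ℍ[ℚ, a, b]} {ι : ℍ[ℚ, a, b] →ₐ[ℚ] M2}

/-- The normalized matrix coefficient `⟨π(g) Ψ, Ψ⟩ / ⟨Ψ, Ψ⟩`, where `GL₂(ℚ₂)` acts on
`L²(Γ \ GL₂(ℚ₂))` by right translation. -/
def matCoeff (μ : Measure GL2) (D : Set GL2) (Ψ : FunY R ι) (g : GL2) : ℝ :=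
  innerX μ D (fun x => Ψ.toFun (x * g)) Ψ.toFun / innerX μ D Ψ.toFun Ψ.toFun

theorem FunY.mul_center (Ψ : FunY R ι) (z : GL2) (hz : z ∈ Subgroup.center GL2) (x : GL2) :
    Ψ.toFun (x * z) = Ψ.toFun x := by
  obtain ⟨m, u, hu, rfl⟩ := center_decomp z hz
  have hc : (Matrix.GeneralLinearGroup.scalar (Fin 2) twoUnit) ^ m ∈ Subgroup.center GL2 := by
    rw [Matrix.GeneralLinearGroup.center_eq_range_scalar]
    exact Subgroup.zpow_mem _ (MonoidHom.mem_range.2 ⟨_, rfl⟩) m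
  rw [← mul_assoc, Ψ.right_inv u hu, Subgroup.mem_center_iff.1 hc x]
  exact Ψ.left_inv _ (Subgroup.zpow_mem _ (scalar_two_mem_Gam R ι) m) x

/-- `Ξ`: the normalized spherical matrix coefficient of `Ψ`, as a function on `PGL₂(ℚ₂)`. -/
def Xi (μ : Measure GL2) (D : Set GL2) (Ψ : FunY R ι) : PGL2 → ℝ :=
  Quotient.lift (matCoeff μ D Ψ) (by
    intro g h hgh
    have hz : g⁻¹ * h ∈ Subgroup.center GL2 := QuotientGroup.leftRel_apply.1 hgh
    have e : h = g * (g⁻¹ * h) := by group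
    have hf : (fun x => Ψ.toFun (x * h)) = fun x => Ψ.toFun (x * g) := by
      funext x
      rw [e, ← mul_assoc, Ψ.mul_center _ hz]
    unfold matCoeff
    rw [hf])

end Quaternion

/-- The Euler factor at `2` of `L(Ψ, s) = ∑ λ(n) n^{-s}`, in terms of `λ(2)`:
`L₂(Ψ, s) = (1 - λ(2) 2^{-s} + 2^{-2s})⁻¹`. -/
def eulerFactorTwo (lam : ℕ → ℝ) (s : ℝ) : ℝ :=
  (1 - lam 2 * 2 ^ (-s) + 2 ^ (-(2 * s)))⁻¹

end

/-!
The integrand is bi-invariant under `K = GL₂(ℤ₂)`, so the integral is a sum over the spheres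
`K diag(1, 2ⁿ) K` of `PGL₂(ℚ₂)`, of volume `1` for `n = 0` and `3 · 2ⁿ⁻¹` for `n ≥ 1`.

In coordinates `φ` depends only on residues modulo `2`, so `⟨Ad(g) φ, φ⟩` is a finite sum. It equals
`2⁻⁴ κ₀²` times `3` on the sphere of radius `0` and times `2⁻ⁿ` on the sphere of radius `n ≥ 1`, so
that every sphere of positive radius carries the same weight.

The value `ξₙ` of `Ξₖ` on the sphere of radius `n` satisfies `ξ₀ = 1`, `3 ξ₁ = √2 λ(2)` and the
Hecke recurrence `2 ξₙ₊₂ = √2 λ(2) ξₙ₊₁ - ξₙ`. Once `|√2 λ(2)| < 3` the roots of its characteristic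
polynomial are smaller than `1`, so that `∑ ξₙ` converges absolutely, and its value is read off from
the recurrence.

The bound holds because `√2 λ(2)` is an eigenvalue of the adjacency operator of the quotient by `Γ`
of the `3`-regular tree of `PGL₂(ℚ₂)`. By the maximum principle `3` occurs only for constants, while
`-3` would make the quotient graph, which has three vertices, bipartite. Then one part is a single
vertex, and counting edges weighted by the orders of stabilizers produces a vertex whose stabilizer
has order divisible by `12`. It contains `i` and `ω` with `i² = -1` and `ω² + ω + 1 = 0`, which a
definite algebra ramified at `23` cannot accommodate in an order.
-/

noncomputable section

section MatrixNorm

open scoped Matrix.Norms.Elementwise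

variable {m n p 𝕜 : Type*} [Fintype m] [Fintype n] [Fintype p]

theorem norm_matrix_mul_le [NormedRing 𝕜] [IsUltrametricDist 𝕜] (A : Matrix m n 𝕜)
    (B : Matrix n p 𝕜) : ‖A * B‖ ≤ ‖A‖ * ‖B‖ := by
  have h := mul_nonneg (norm_nonneg A) (norm_nonneg B)
  refine (Matrix.norm_le_iff h).2 fun i j => ?_
  refine IsUltrametricDist.norm_sum_le_of_forall_le_of_nonneg h fun l _ => ?_
  exact (norm_mul_le _ _).trans (mul_le_mul (Matrix.norm_entry_le_entrywise_sup_norm A)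
    (Matrix.norm_entry_le_entrywise_sup_norm B) (norm_nonneg _) (norm_nonneg _))

theorem norm_det_le_norm_pow [DecidableEq n] [NormedField 𝕜] [IsUltrametricDist 𝕜]
    (A : Matrix n n 𝕜) : ‖A.det‖ ≤ ‖A‖ ^ Fintype.card n := by
  rw [Matrix.det_apply']
  refine IsUltrametricDist.norm_sum_le_of_forall_le_of_nonneg (by positivity) fun σ _ => ?_
  have hσ : ‖((Equiv.Perm.sign σ : ℤ) : 𝕜)‖ = 1 := by
    rcases Int.units_eq_one_or (Equiv.Perm.sign σ) with h | h <;> simp [h]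
  rw [norm_mul, hσ, one_mul, norm_prod]
  exact (Finset.prod_le_prod (fun _ _ => norm_nonneg _)
    fun i _ => Matrix.norm_entry_le_entrywise_sup_norm A).trans_eq (by simp)

theorem norm_of_fin_two [NormedRing 𝕜] (a b c d : 𝕜) :
    ‖!![a, b; c, d]‖ = max (max ‖a‖ ‖b‖) (max ‖c‖ ‖d‖) := by
  refine le_antisymm ?_ ?_
  · exact (Matrix.norm_le_iff (by positivity)).2 (by simp [Fin.forall_fin_two])
  · simpa [Fin.forall_fin_two, and_assoc] using (Matrix.norm_le_iff (norm_nonneg _)).1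
      (le_refl ‖!![a, b; c, d]‖)

theorem exists_norm_entry_eq_norm [Nonempty m] [Nonempty n] [NormedRing 𝕜] (A : Matrix m n 𝕜) :
    ∃ i j, ‖A i j‖ = ‖A‖ := by
  obtain ⟨⟨i, j⟩, hij⟩ := Finite.exists_max fun p : m × n => ‖A p.1 p.2‖
  exact ⟨i, j, (Matrix.norm_entry_le_entrywise_sup_norm A).antisymm
    ((Matrix.norm_le_iff (norm_nonneg _)).2 fun i' j' => hij (i', j'))⟩

end MatrixNorm

theorem eq_scalar_mul_lower_mul_diag_mul_upper {F : Type*} [Field F]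
    (A : Matrix (Fin 2) (Fin 2) F) (h : A 0 0 ≠ 0) :
    A = Matrix.scalar (Fin 2) (A 0 0) * !![1, 0; A 1 0 / A 0 0, 1] *
      !![1, 0; 0, A.det / A 0 0 ^ 2] * !![1, A 0 1 / A 0 0; 0, 1] := by
  have h11 : A 1 1 = A 1 0 * (A 0 1 / A 0 0) + A 0 0 * (A.det / A 0 0 ^ 2) := by
    rw [Matrix.det_fin_two]
    field_simp
    ring
  ext i j
  fin_cases i <;> fin_cases j <;>
    simp [Matrix.mul_apply, Fin.sum_univ_two, h, mul_div_cancel₀, h11]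

section GeneralLinearGroup

variable {n 𝕜 : Type*} [Fintype n] [DecidableEq n]

open scoped Matrix.Norms.Operator in
theorem isOpenEmbedding_generalLinearGroup_val [NormedField 𝕜] [CompleteSpace 𝕜] :
    Topology.IsOpenEmbedding (Units.val : GL n 𝕜 → Matrix n n 𝕜) :=
  have : CompleteSpace (Matrix n n 𝕜) := inferInstance
  have : HasSummableGeomSeries (Matrix n n 𝕜) := @instHasSummableGeomSeriesOfCompleteSpace _ _ this
  Units.isOpenEmbedding_val

instance isClosed_center {G : Type*} [Group G] [TopologicalSpace G] [ContinuousMul G]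
    [T2Space G] : IsClosed (Subgroup.center G : Set G) := by
  rw [show (Subgroup.center G : Set G) = ⋂ g : G, {z | g * z = z * g} by
    ext z; simp [Subgroup.mem_center_iff]]
  exact isClosed_iInter fun g => isClosed_eq (by fun_prop) (by fun_prop)

instance polishSpace_M2 : PolishSpace M2 :=
  inferInstanceAs (PolishSpace (Fin 2 → Fin 2 → ℚ_[2]))

instance locallyCompactSpace_M2 : LocallyCompactSpace M2 :=
  inferInstanceAs (LocallyCompactSpace (Fin 2 → Fin 2 → ℚ_[2]))

instance polishSpace_GL2 : PolishSpace GL2 :=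
  have :=
    (isOpenEmbedding_generalLinearGroup_val (n := Fin 2) (𝕜 := ℚ_[2])).isOpen_range.polishSpace
  isOpenEmbedding_generalLinearGroup_val.isEmbedding.toHomeomorph.isClosedEmbedding.polishSpace

instance borelSpace_GL2 : BorelSpace GL2 where
  measurable_eq := by
    rw [isOpenEmbedding_generalLinearGroup_val.eq_induced, borel_comap]
    rfl

end GeneralLinearGroup

open scoped Matrix.Norms.Elementwise

theorem norm_two_padic : ‖(2 : ℚ_[2])‖ = 2⁻¹ := by
  simpa using Padic.norm_p (p := 2)

theorem norm_two_pow_padic_le_one (n : ℕ) : ‖(2 : ℚ_[2]) ^ n‖ ≤ 1 := by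
  rw [norm_pow, norm_two_padic]
  exact pow_le_one₀ (by norm_num) (by norm_num)

theorem norm_lt_one_iff_le_half {x : ℚ_[2]} : ‖x‖ < 1 ↔ ‖x‖ ≤ 2⁻¹ := by
  simpa using (Padic.norm_le_pow_iff_norm_lt_pow_add_one x (-1)).symm

theorem norm_lt_one_iff_toZMod_eq_zero (x : ℤ_[2]) : ‖(x : ℚ_[2])‖ < 1 ↔ PadicInt.toZMod x = 0 := by
  rw [← RingHom.mem_ker, PadicInt.ker_toZMod, IsLocalRing.mem_maximalIdeal, PadicInt.mem_nonunits]
  rfl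

theorem exists_norm_eq_inv_two_pow {x : ℚ_[2]} (hx : x ≠ 0) (hx' : ‖x‖ ≤ 1) :
    ∃ n : ℕ, ‖x‖ = 2⁻¹ ^ n := by
  obtain ⟨n, hn⟩ := Int.eq_ofNat_of_zero_le ((Padic.norm_le_one_iff_val_nonneg x).1 hx')
  exact ⟨n, by rw [Padic.norm_eq_zpow_neg_valuation hx, hn]; simp⟩

/-! ### `GL₂(ℤ₂)` and the Cartan decomposition -/

theorem mem_integralM2_iff {β : M2} : β ∈ integralM2 ↔ ‖β‖ ≤ 1 :=
  (Matrix.norm_le_iff zero_le_one).symm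

theorem integralM2_eq_pi :
    integralM2 = Set.univ.pi fun _ : Fin 2 => Set.univ.pi fun _ : Fin 2 =>
      Metric.closedBall (0 : ℚ_[2]) 1 := by
  simp only [integralM2, Set.pi, Set.mem_univ, forall_const, Set.mem_ofPred_eq,
    mem_closedBall_zero_iff]
  rfl

theorem isOpen_integralM2 : IsOpen integralM2 := by
  rw [integralM2_eq_pi]
  exact isOpen_set_pi Set.finite_univ fun _ _ => isOpen_set_pi Set.finite_univ fun _ _ =>
    IsUltrametricDist.isOpen_closedBall 0 one_ne_zero

theorem isCompact_integralM2 : IsCompact integralM2 := by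
  rw [integralM2_eq_pi]
  exact isCompact_univ_pi fun _ => isCompact_univ_pi fun _ => isCompact_closedBall _ _

theorem mem_K2_iff {k : GL2} : k ∈ K2 ↔ (k : M2) ∈ integralM2 ∧ ‖(k : M2).det‖ = 1 := by
  constructor
  · rintro ⟨u, rfl⟩
    refine ⟨fun i j => PadicInt.norm_le_one _, ?_⟩
    have hu : IsUnit (u : Matrix (Fin 2) (Fin 2) ℤ_[2]).det :=
      (Matrix.isUnit_iff_isUnit_det _).1 u.isUnit
    exact (congrArg norm (RingHom.map_det _ _)).symm.trans (PadicInt.isUnit_iff.1 hu)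
  · rintro ⟨h1, h2⟩
    let A : Matrix (Fin 2) (Fin 2) ℤ_[2] := fun i j => ⟨(k : M2) i j, h1 i j⟩
    have hA : algebraMap ℤ_[2] ℚ_[2] A.det = (k : M2).det := RingHom.map_det _ _
    have hu : IsUnit A := by
      rw [Matrix.isUnit_iff_isUnit_det, PadicInt.isUnit_iff]
      exact (congrArg norm hA).trans h2
    refine ⟨hu.unit, ?_⟩
    ext i j
    rfl

theorem norm_det_of_mem_K2 {k : GL2} (hk : k ∈ K2) : ‖(k : M2).det‖ = 1 := (mem_K2_iff.1 hk).2

theorem coe_K2_eq_preimage :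
    (K2 : Set GL2) = Units.val ⁻¹' (integralM2 ∩ Matrix.det ⁻¹' Metric.sphere 0 1) := by
  ext k
  simp [mem_K2_iff]

theorem isOpen_K2 : IsOpen (K2 : Set GL2) := by
  rw [coe_K2_eq_preimage]
  refine (isOpen_integralM2.inter ?_).preimage Units.continuous_val
  exact (IsUltrametricDist.isOpen_sphere 0 one_ne_zero).preimage (by fun_prop)

theorem isCompact_K2 : IsCompact (K2 : Set GL2) := by
  rw [coe_K2_eq_preimage, isOpenEmbedding_generalLinearGroup_val.isInducing.isCompact_preimage_iff]
  · refine isCompact_integralM2.inter_right (Metric.isClosed_sphere.preimage ?_)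
    fun_prop
  · rintro A ⟨-, hA⟩
    have hdet : ‖A.det‖ = 1 := mem_sphere_zero_iff_norm.1 hA
    exact ⟨Matrix.GeneralLinearGroup.mkOfDetNeZero A (norm_ne_zero_iff.1 (by simp [hdet])), rfl⟩

theorem norm_K2_mul {k : GL2} (hk : k ∈ K2) (β : M2) : ‖(k : M2) * β‖ = ‖β‖ := by
  have key : ∀ k' ∈ K2, ∀ γ : M2, ‖((k' : GL2) : M2) * γ‖ ≤ ‖γ‖ := fun k' hk' γ =>
    (norm_matrix_mul_le _ _).trans (mul_le_of_le_one_left (norm_nonneg _)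
      (mem_integralM2_iff.1 (mem_K2_iff.1 hk').1))
  refine le_antisymm (key k hk β) ?_
  simpa [← mul_assoc, ← Units.val_mul] using key k⁻¹ (K2.inv_mem hk) ((k : M2) * β)

theorem norm_mul_K2 {k : GL2} (hk : k ∈ K2) (β : M2) : ‖β * (k : M2)‖ = ‖β‖ := by
  have key : ∀ k' ∈ K2, ∀ γ : M2, ‖γ * ((k' : GL2) : M2)‖ ≤ ‖γ‖ := fun k' hk' γ =>
    (norm_matrix_mul_le _ _).trans (mul_le_of_le_one_right (norm_nonneg _)
      (mem_integralM2_iff.1 (mem_K2_iff.1 hk').1))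
  refine le_antisymm (key k hk β) ?_
  simpa [mul_assoc, ← Units.val_mul] using key k⁻¹ (K2.inv_mem hk) (β * (k : M2))

/-- `‖g‖² / ‖det g‖`: `2` to the power of the distance, on the tree of `PGL₂(ℚ₂)`, from the vertex
fixed by `GL₂(ℤ₂)` to its image under `g`. -/
def cartanSize (g : GL2) : ℝ := ‖(g : M2)‖ ^ 2 / ‖(g : M2).det‖

theorem cartanSize_mul_K2 (g : GL2) {k : GL2} (hk : k ∈ K2) :
    cartanSize (g * k) = cartanSize g := by
  rw [cartanSize, cartanSize, Units.val_mul, norm_mul_K2 hk, Matrix.det_mul, norm_mul,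
    norm_det_of_mem_K2 hk, mul_one]

theorem cartanSize_K2_mul (g : GL2) {k : GL2} (hk : k ∈ K2) :
    cartanSize (k * g) = cartanSize g := by
  rw [cartanSize, cartanSize, Units.val_mul, norm_K2_mul hk, Matrix.det_mul, norm_mul,
    norm_det_of_mem_K2 hk, one_mul]

theorem cartanSize_center_mul (g : GL2) {z : GL2} (hz : z ∈ Subgroup.center GL2) :
    cartanSize (z * g) = cartanSize g := by
  rw [Matrix.GeneralLinearGroup.center_eq_range_scalar] at hz
  obtain ⟨c, rfl⟩ := hz
  have h : ((Matrix.GeneralLinearGroup.scalar (Fin 2) c * g : GL2) : M2)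
      = (c : ℚ_[2]) • (g : M2) := (Matrix.smul_eq_diagonal_mul _ _).symm
  rw [cartanSize, cartanSize, h, norm_smul, Matrix.det_smul, norm_mul, norm_pow, Fintype.card_fin,
    mul_pow, mul_div_mul_left]
  exact pow_ne_zero _ (norm_ne_zero_iff.2 c.ne_zero)

/-- The matrices `diag(1, 2ⁿ)`. -/
def diagTwoPow (n : ℕ) : GL2 :=
  Matrix.GeneralLinearGroup.mkOfDetNeZero !![1, 0; 0, 2 ^ n] (by simp)

theorem coe_diagTwoPow (n : ℕ) : (diagTwoPow n : M2) = !![1, 0; 0, 2 ^ n] := rfl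

theorem diagTwoPow_zero : diagTwoPow 0 = 1 := by
  ext1
  simp [coe_diagTwoPow, Matrix.one_fin_two]

theorem norm_diagTwoPow (n : ℕ) : ‖(diagTwoPow n : M2)‖ = 1 := by
  have hn : max 1 ‖(2 : ℚ_[2]) ^ n‖ = 1 := max_eq_left (norm_two_pow_padic_le_one n)
  simp [coe_diagTwoPow, norm_of_fin_two, hn, -norm_pow]

theorem cartanSize_diagTwoPow (n : ℕ) : cartanSize (diagTwoPow n) = 2 ^ n := by
  rw [cartanSize, norm_diagTwoPow, coe_diagTwoPow]
  simp [norm_two_padic]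

theorem exists_K2_mul_mul_eq_norm (g : GL2) : ∃ k₁ ∈ K2, ∃ k₂ ∈ K2,
    ‖((k₁ * g * k₂ : GL2) : M2) 0 0‖ = ‖((k₁ * g * k₂ : GL2) : M2)‖ := by
  let w : GL2 := Matrix.GeneralLinearGroup.mkOfDetNeZero !![0, 1; 1, 0] (by simp)
  have hval : (w : M2) = !![0, 1; 1, 0] := rfl
  have hw : w ∈ K2 := mem_K2_iff.2
    ⟨mem_integralM2_iff.2 (by simp [hval, norm_of_fin_two]), by simp [hval]⟩
  obtain ⟨i, j, hij⟩ := exists_norm_entry_eq_norm (g : M2)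
  have hmem : ∀ i : Fin 2, (if i = 0 then 1 else w) ∈ K2 := fun i => by
    split_ifs
    exacts [K2.one_mem, hw]
  refine ⟨_, hmem i, _, hmem j, ?_⟩
  rw [Units.val_mul, norm_mul_K2 (hmem j), Units.val_mul, norm_K2_mul (hmem i), ← hij]
  fin_cases i <;> fin_cases j <;>
    simp [hval, Matrix.mul_apply, Matrix.vecMul, dotProduct, Fin.sum_univ_two]

theorem exists_eq_diagTwoPow_of_norm_eq {g : GL2} (hg : ‖(g : M2) 0 0‖ = ‖(g : M2)‖) :
    ∃ n, ∃ z ∈ Subgroup.center GL2, ∃ k₁ ∈ K2, ∃ k₂ ∈ K2, g = z * k₁ * diagTwoPow n * k₂ := by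
  have hdet := Matrix.GeneralLinearGroup.det_ne_zero g
  have hc : (g : M2) 0 0 ≠ 0 := norm_ne_zero_iff.1 (hg ▸ norm_ne_zero_iff.2 g.ne_zero)
  have hle : ∀ i j, ‖(g : M2) i j / (g : M2) 0 0‖ ≤ 1 := fun i j => by
    rw [norm_div, hg]
    exact div_le_one_of_le₀ (Matrix.norm_entry_le_entrywise_sup_norm _) (norm_nonneg _)
  obtain ⟨n, hn⟩ := exists_norm_eq_inv_two_pow (div_ne_zero hdet (pow_ne_zero 2 hc)) (by
    rw [norm_div, norm_pow, hg]
    exact div_le_one_of_le₀ (norm_det_le_norm_pow _) (by positivity))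
  have hfac := eq_scalar_mul_lower_mul_diag_mul_upper _ hc
  set q := (g : M2) 0 1 / (g : M2) 0 0
  set r := (g : M2) 1 0 / (g : M2) 0 0
  set d := (g : M2).det / (g : M2) 0 0 ^ 2
  have hu : ‖d / 2 ^ n‖ = 1 := by
    rw [norm_div, norm_pow, norm_two_padic, hn, div_self (by positivity)]
  refine ⟨n, Matrix.GeneralLinearGroup.scalar (Fin 2) (Units.mk0 _ hc), ?_,
    Matrix.GeneralLinearGroup.mkOfDetNeZero !![1, 0; r, d / 2 ^ n]
      (norm_ne_zero_iff.1 (by simp [Matrix.det_fin_two_of, hu, -norm_div])), ?_,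
    Matrix.GeneralLinearGroup.mkOfDetNeZero !![1, q; 0, 1] (by simp), ?_, ?_⟩
  · rw [Matrix.GeneralLinearGroup.center_eq_range_scalar]
    exact ⟨_, rfl⟩
  · refine mem_K2_iff.2 ⟨mem_integralM2_iff.2 ?_, ?_⟩
    · simpa [norm_of_fin_two, hu, -norm_div] using hle 1 0
    · simpa [Matrix.GeneralLinearGroup.mkOfDetNeZero] using hu
  · refine mem_K2_iff.2 ⟨mem_integralM2_iff.2 ?_, ?_⟩
    · simpa [norm_of_fin_two, -norm_div] using hle 0 1
    · simp [Matrix.GeneralLinearGroup.mkOfDetNeZero]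
  · ext1
    have e : !![1, 0; r, d / 2 ^ n] * !![1, 0; 0, 2 ^ n] = !![1, 0; r, 1] * !![1, 0; 0, d] := by
      simp
    refine hfac.trans ?_
    rw [mul_assoc _ !![1, 0; r, 1], ← e, ← mul_assoc]
    rfl

theorem exists_eq_mul_diagTwoPow_mul (g : GL2) :
    ∃ n, ∃ z ∈ Subgroup.center GL2, ∃ k₁ ∈ K2, ∃ k₂ ∈ K2, g = z * k₁ * diagTwoPow n * k₂ := by
  obtain ⟨k₁, hk₁, k₂, hk₂, h⟩ := exists_K2_mul_mul_eq_norm g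
  obtain ⟨n, z, hz, l₁, hl₁, l₂, hl₂, e⟩ := exists_eq_diagTwoPow_of_norm_eq h
  refine ⟨n, z, hz, k₁⁻¹ * l₁, K2.mul_mem (K2.inv_mem hk₁) hl₁, l₂ * k₂⁻¹,
    K2.mul_mem hl₂ (K2.inv_mem hk₂), ?_⟩
  rw [← mul_assoc z, ← Subgroup.mem_center_iff.1 hz]
  calc g = k₁⁻¹ * (k₁ * g * k₂) * k₂⁻¹ := by group
    _ = _ := by rw [e]; group

theorem cartanSize_mul_diagTwoPow_mul {z k₁ k₂ : GL2} (hz : z ∈ Subgroup.center GL2)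
    (hk₁ : k₁ ∈ K2) (hk₂ : k₂ ∈ K2) (n : ℕ) :
    cartanSize (z * k₁ * diagTwoPow n * k₂) = 2 ^ n := by
  rw [cartanSize_mul_K2 _ hk₂, mul_assoc, cartanSize_center_mul _ hz, cartanSize_K2_mul _ hk₁,
    cartanSize_diagTwoPow]

theorem exists_cartanSize_eq (g : GL2) : ∃ n : ℕ, cartanSize g = 2 ^ n := by
  obtain ⟨n, z, hz, k₁, hk₁, k₂, hk₂, rfl⟩ := exists_eq_mul_diagTwoPow_mul g
  exact ⟨n, cartanSize_mul_diagTwoPow_mul hz hk₁ hk₂ n⟩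

theorem exists_eq_of_cartanSize_eq {g : GL2} {n : ℕ} (hg : cartanSize g = 2 ^ n) :
    ∃ z ∈ Subgroup.center GL2, ∃ k₁ ∈ K2, ∃ k₂ ∈ K2, g = z * k₁ * diagTwoPow n * k₂ := by
  obtain ⟨m, z, hz, k₁, hk₁, k₂, hk₂, rfl⟩ := exists_eq_mul_diagTwoPow_mul g
  rw [cartanSize_mul_diagTwoPow_mul hz hk₁ hk₂] at hg
  obtain rfl : m = n := pow_right_injective₀ two_pos (by norm_num) hg
  exact ⟨z, hz, k₁, hk₁, k₂, hk₂, rfl⟩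

/-- Representatives of the three cosets `h GL₂(ℤ₂)` of integral matrices `h` whose determinant has
valuation `1`: the neighbours of the base vertex in the tree of `PGL₂(ℚ₂)`. -/
def heckeRep (i : Fin 3) : GL2 :=
  Matrix.GeneralLinearGroup.mkOfDetNeZero (![!![2, 0; 0, 1], !![2, 1; 0, 1], !![1, 0; 0, 2]] i)
    (by fin_cases i <;> simp)

theorem coe_heckeRep (i : Fin 3) :
    (heckeRep i : M2) = ![!![2, 0; 0, 1], !![2, 1; 0, 1], !![1, 0; 0, 2]] i := rfl

theorem det_heckeRep (i : Fin 3) : (heckeRep i : M2).det = 2 := by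
  fin_cases i <;> simp [coe_heckeRep]

theorem norm_heckeRep (i : Fin 3) : ‖(heckeRep i : M2)‖ = 1 := by
  have h : (2⁻¹ : ℝ) ≤ 1 := by norm_num
  fin_cases i <;> simp [coe_heckeRep, norm_of_fin_two, norm_two_padic, h]

theorem inv_heckeRep_mul_mem_K2_iff {h : GL2} (hdet : ‖(h : M2).det‖ = 2⁻¹) (i : Fin 3) :
    (heckeRep i)⁻¹ * h ∈ K2 ↔ ‖(heckeRep i : M2).adjugate * (h : M2)‖ ≤ 2⁻¹ := by
  have hval : (((heckeRep i)⁻¹ * h : GL2) : M2)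
      = (2⁻¹ : ℚ_[2]) • ((heckeRep i : M2).adjugate * (h : M2)) := by
    rw [Units.val_mul, Matrix.coe_units_inv, Matrix.inv_def, det_heckeRep, Ring.inverse_eq_inv,
      Matrix.smul_mul]
  have hdet' : ‖(((heckeRep i)⁻¹ * h : GL2) : M2).det‖ = 1 := by
    rw [Units.val_mul, Matrix.det_mul, norm_mul, hdet, Matrix.coe_units_inv,
      Matrix.det_nonsing_inv, det_heckeRep, Ring.inverse_eq_inv, norm_inv, norm_two_padic]
    norm_num
  rw [mem_K2_iff, and_iff_left hdet', mem_integralM2_iff, hval, norm_smul, norm_inv,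
    norm_two_padic, inv_inv, ← le_div_iff₀' two_pos, one_div]

/-- Over the field with two elements the rows of a singular matrix are proportional. -/
theorem exists_row_congruence {A : M2} (hA : ‖A‖ ≤ 1) (hdet : ‖A.det‖ < 1) :
    (∀ j, ‖A 0 j‖ < 1) ∨ (∀ j, ‖A 0 j - A 1 j‖ < 1) ∨ ∀ j, ‖A 1 j‖ < 1 := by
  let B : Matrix (Fin 2) (Fin 2) ℤ_[2] := fun i j => ⟨A i j, mem_integralM2_iff.2 hA i j⟩
  have hdet' : PadicInt.toZMod (B 0 0) * PadicInt.toZMod (B 1 1)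
      - PadicInt.toZMod (B 0 1) * PadicInt.toZMod (B 1 0) = 0 := by
    rw [← map_mul, ← map_mul, ← map_sub, ← norm_lt_one_iff_toZMod_eq_zero]
    rwa [Matrix.det_fin_two] at hdet
  have hmod : ∀ a b c d : ZMod 2, a * d - b * c = 0 →
      (a = 0 ∧ b = 0) ∨ (a - c = 0 ∧ b - d = 0) ∨ (c = 0 ∧ d = 0) := by decide
  have hrows := hmod _ _ _ _ hdet'
  simp only [← map_sub, ← norm_lt_one_iff_toZMod_eq_zero] at hrows
  simp only [Fin.forall_fin_two]
  exact hrows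

theorem exists_eq_heckeRep_mul {h : GL2} (h1 : ‖(h : M2)‖ ≤ 1) (hdet : ‖(h : M2).det‖ = 2⁻¹) :
    ∃ i, ∃ k ∈ K2, h = heckeRep i * k := by
  suffices H : ∃ i, ‖(heckeRep i : M2).adjugate * (h : M2)‖ ≤ 2⁻¹ by
    obtain ⟨i, hi⟩ := H
    exact ⟨i, _, (inv_heckeRep_mul_mem_K2_iff hdet i).2 hi, (mul_inv_cancel_left _ _).symm⟩
  have htwo : ∀ i j, ‖2 * (h : M2) i j‖ ≤ 2⁻¹ := fun i j => by
    rw [norm_mul, norm_two_padic]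
    exact mul_le_of_le_one_right (by norm_num) (mem_integralM2_iff.2 h1 i j)
  have hrows := exists_row_congruence h1 (by rw [hdet]; norm_num)
  simp only [norm_lt_one_iff_le_half] at hrows
  simp_rw [Matrix.norm_le_iff (inv_nonneg.2 zero_le_two), Fin.forall_fin_two (p := fun i => ∀ j, _)]
  rcases hrows with hr | hr | hr
  · refine ⟨0, fun j => ?_, fun j => ?_⟩
    · simpa [coe_heckeRep, Matrix.mul_apply] using hr j
    · simpa [coe_heckeRep, Matrix.mul_apply] using htwo 1 j
  · refine ⟨1, fun j => ?_, fun j => ?_⟩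
    · simpa [coe_heckeRep, Matrix.mul_apply, ← sub_eq_add_neg] using hr j
    · simpa [coe_heckeRep, Matrix.mul_apply] using htwo 1 j
  · refine ⟨2, fun j => ?_, fun j => ?_⟩
    · simpa [coe_heckeRep, Matrix.mul_apply] using htwo 0 j
    · simpa [coe_heckeRep, Matrix.mul_apply] using hr j

theorem eq_of_inv_heckeRep_mul_mem_K2 {i j : Fin 3} (h : (heckeRep i)⁻¹ * heckeRep j ∈ K2) :
    i = j := by
  rw [inv_heckeRep_mul_mem_K2_iff (by rw [det_heckeRep, norm_two_padic])] at h
  contrapose! h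
  have h2 : (2⁻¹ : ℝ) < 1 := by norm_num
  fin_cases i <;> fin_cases j <;>
    first
    | exact absurd rfl h
    | simp [coe_heckeRep, norm_of_fin_two, h2]

theorem sum_mul_heckeRep_of_mem_K2 {M : Type*} [AddCommMonoid M] {u : GL2 → M}
    (hu : ∀ x, ∀ k ∈ K2, u (x * k) = u x) (x : GL2) {k : GL2} (hk : k ∈ K2) :
    ∑ i, u (x * k * heckeRep i) = ∑ i, u (x * heckeRep i) := by
  have h : ∀ i, ∃ j, ∃ k' ∈ K2, k * heckeRep i = heckeRep j * k' := fun i =>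
    exists_eq_heckeRep_mul (by rw [Units.val_mul, norm_K2_mul hk, norm_heckeRep])
      (by rw [Units.val_mul, Matrix.det_mul, norm_mul, norm_det_of_mem_K2 hk, one_mul,
        det_heckeRep, norm_two_padic])
  choose σ k' hk' hσ using h
  have hinj : Function.Injective σ := fun i j hij => by
    refine eq_of_inv_heckeRep_mul_mem_K2 ?_
    have e : (heckeRep i)⁻¹ * heckeRep j = (k' i)⁻¹ * k' j := by
      calc (heckeRep i)⁻¹ * heckeRep j = (k * heckeRep i)⁻¹ * (k * heckeRep j) := by group
        _ = _ := by rw [hσ, hσ, hij]; group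
    exact e ▸ K2.mul_mem (K2.inv_mem (hk' i)) (hk' j)
  calc ∑ i, u (x * k * heckeRep i) = ∑ i, u (x * heckeRep (σ i)) :=
        Finset.sum_congr rfl fun i _ => by rw [mul_assoc, hσ, ← mul_assoc, hu _ _ (hk' i)]
    _ = ∑ i, u (x * heckeRep i) :=
        (Finite.injective_iff_bijective.1 hinj).sum_comp fun i => u (x * heckeRep i)

theorem cartanSize_diagTwoPow_succ_mul_heckeRep_zero (n : ℕ) :
    cartanSize (diagTwoPow (n + 1) * heckeRep 0) = 2 ^ n := by
  have h : diagTwoPow (n + 1) * heckeRep 0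
      = Matrix.GeneralLinearGroup.scalar (Fin 2) twoUnit * diagTwoPow n := by
    ext1
    simp [coe_diagTwoPow, coe_heckeRep, twoUnit, pow_succ', ← Matrix.smul_eq_diagonal_mul]
  have hz : Matrix.GeneralLinearGroup.scalar (Fin 2) twoUnit ∈ Subgroup.center GL2 := by
    rw [Matrix.GeneralLinearGroup.center_eq_range_scalar]
    exact ⟨_, rfl⟩
  rw [h, cartanSize_center_mul _ hz, cartanSize_diagTwoPow]

theorem cartanSize_diagTwoPow_mul_heckeRep_one (n : ℕ) :
    cartanSize (diagTwoPow n * heckeRep 1) = 2 ^ (n + 1) := by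
  have h : ((2 : ℝ) ^ n)⁻¹ ≤ 1 := inv_le_one_of_one_le₀ (one_le_pow₀ one_le_two)
  have h2 : (2⁻¹ : ℝ) ≤ 1 := by norm_num
  simp [cartanSize, coe_diagTwoPow, coe_heckeRep, norm_of_fin_two, norm_two_padic, h, h2, pow_succ]

theorem cartanSize_diagTwoPow_mul_heckeRep_two (n : ℕ) :
    cartanSize (diagTwoPow n * heckeRep 2) = 2 ^ (n + 1) := by
  rw [← cartanSize_diagTwoPow]
  congr 1
  ext1
  simp [coe_diagTwoPow, coe_heckeRep, pow_succ]

theorem cartanSize_heckeRep (i : Fin 3) : cartanSize (heckeRep i) = 2 := by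
  rw [cartanSize, norm_heckeRep, det_heckeRep, norm_two_padic]
  norm_num

section Radial

variable {M : Type*} [AddCommMonoid M] {u : GL2 → M} {v : ℕ → M}

theorem sum_mul_heckeRep_of_cartanSize_eq_one (hu : ∀ n g, cartanSize g = 2 ^ n → u g = v n)
    {g : GL2} (hg : cartanSize g = 1) : ∑ i, u (g * heckeRep i) = 3 • v 1 := by
  obtain ⟨z, hz, k₁, hk₁, k₂, hk₂, rfl⟩ := exists_eq_of_cartanSize_eq (n := 0) (by simpa using hg)
  have h : ∀ i, u (z * k₁ * diagTwoPow 0 * k₂ * heckeRep i) = v 1 := fun i => hu 1 _ <| by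
    rw [diagTwoPow_zero, mul_one, mul_assoc, mul_assoc, cartanSize_center_mul _ hz,
      cartanSize_K2_mul _ hk₁, cartanSize_K2_mul _ hk₂, cartanSize_heckeRep, pow_one]
  simp [h]

theorem sum_mul_heckeRep_of_cartanSize_eq (hu : ∀ n g, cartanSize g = 2 ^ n → u g = v n)
    {n : ℕ} {g : GL2} (hg : cartanSize g = 2 ^ (n + 1)) :
    ∑ i, u (g * heckeRep i) = v n + 2 • v (n + 2) := by
  obtain ⟨z, hz, k₁, hk₁, k₂, hk₂, rfl⟩ := exists_eq_of_cartanSize_eq hg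
  have hK : ∀ x, ∀ k ∈ K2, u (x * k) = u x := fun x k hk => by
    obtain ⟨m, hm⟩ := exists_cartanSize_eq x
    rw [hu m x hm, hu m _ (by rw [cartanSize_mul_K2 _ hk, hm])]
  have hl : ∀ m x, cartanSize x = 2 ^ m → u (z * k₁ * x) = v m := fun m x hx => hu m _ <| by
    rw [mul_assoc, cartanSize_center_mul _ hz, cartanSize_K2_mul _ hk₁, hx]
  rw [sum_mul_heckeRep_of_mem_K2 hK _ hk₂, Fin.sum_univ_three]
  simp only [mul_assoc (z * k₁)]
  rw [hl _ _ (cartanSize_diagTwoPow_succ_mul_heckeRep_zero n),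
    hl _ _ (cartanSize_diagTwoPow_mul_heckeRep_one _),
    hl _ _ (cartanSize_diagTwoPow_mul_heckeRep_two _), two_nsmul, add_assoc]

end Radial

/-! ### Arithmetic of quaternion algebras -/

open scoped IsMulCommutative in
theorem isIntegral_add_of_commute {R A : Type*} [CommRing R] [Ring A] [Algebra R A] {x y : A}
    (hx : IsIntegral R x) (hy : IsIntegral R y) (hxy : Commute x y) : IsIntegral R (x + y) := by
  have hcomm : ∀ u ∈ ({x, y} : Set A), ∀ v ∈ ({x, y} : Set A), u * v = v * u := by
    rintro u (rfl | rfl) v (rfl | rfl)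
    exacts [rfl, hxy, hxy.symm, rfl]
  have := Algebra.isMulCommutative_adjoin R hcomm
  have hval : Function.Injective (Algebra.adjoin R {x, y}).val := Subtype.val_injective
  have hx' : IsIntegral R (⟨x, Algebra.subset_adjoin (by simp)⟩ : Algebra.adjoin R {x, y}) :=
    (isIntegral_algHom_iff _ hval).1 hx
  have hy' : IsIntegral R (⟨y, Algebra.subset_adjoin (by simp)⟩ : Algebra.adjoin R {x, y}) :=
    (isIntegral_algHom_iff _ hval).1 hy
  exact (isIntegral_algHom_iff _ hval).2 (hx'.add hy')

theorem isIntegral_star {A : Type*} [Ring A] [StarRing A] {x : A} (hx : IsIntegral ℤ x) :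
    IsIntegral ℤ (star x) := by
  obtain ⟨q, hq, hqx⟩ := hx
  refine ⟨q, hq, ?_⟩
  rw [← Polynomial.aeval_def, Polynomial.aeval_eq_sum_range] at hqx ⊢
  simpa only [star_sum, star_zsmul, star_pow, star_zero] using congrArg star hqx

section CommRing

variable {F : Type*} [CommRing F] {c₁ c₂ : F}

theorem quaternion_star_eq (x : ℍ[F,c₁,c₂]) : star x = ((2 * x.re : F) : ℍ[F,c₁,c₂]) - x := by
  rw [QuaternionAlgebra.star_eq_two_re_sub, zero_mul, add_zero]

theorem quaternion_add_star (x : ℍ[F,c₁,c₂]) : x + star x = ((2 * x.re : F) : ℍ[F,c₁,c₂]) := by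
  rw [quaternion_star_eq, add_sub_cancel]

theorem re_mul_star (x : ℍ[F,c₁,c₂]) :
    (x * star x).re = x.re ^ 2 - c₁ * x.imI ^ 2 - c₂ * x.imJ ^ 2 + c₁ * c₂ * x.imK ^ 2 := by
  simp
  ring

/-- The base change of a quaternion algebra along a ring homomorphism. -/
def quaternionMap {E : Type*} [CommRing E] (f : F →+* E) :
    ℍ[F,c₁,c₂] →+* ℍ[E,(f c₁),(f c₂)] where
  toFun x := ⟨f x.re, f x.imI, f x.imJ, f x.imK⟩
  map_one' := by ext <;> simp
  map_mul' x y := by ext <;> simp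
  map_zero' := by ext <;> simp
  map_add' x y := by ext <;> simp

theorem quaternionMap_coe {E : Type*} [CommRing E] (f : F →+* E) (r : F) :
    quaternionMap f (r : ℍ[F,c₁,c₂]) = (f r : ℍ[E,(f c₁),(f c₂)]) := by
  ext <;> simp [quaternionMap]

end CommRing

theorem eq_or_eq_neg_of_mul_self_eq {F : Type*} [Field F] {c₁ c₂ : F}
    (hB : ∀ x : ℍ[F,c₁,c₂], x ≠ 0 → IsUnit x) {v : ℍ[F,c₁,c₂]} {r : F}
    (hv : v * v = ((r * r : F) : ℍ[F,c₁,c₂])) :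
    v = (r : ℍ[F,c₁,c₂]) ∨ v = -(r : ℍ[F,c₁,c₂]) := by
  have h0 : (v - r) * (v + r) = 0 := by
    rw [QuaternionAlgebra.coe_mul] at hv
    rw [← ((QuaternionAlgebra.coe_commute r v).symm).mul_self_sub_mul_self_eq', hv, sub_self]
  rw [or_iff_not_imp_left]
  intro hne
  exact eq_neg_of_add_eq_zero_left ((hB _ (sub_ne_zero.2 hne)).mul_right_eq_zero.1 h0)

theorem neg_of_forall_isUnit {c₁ c₂ : ℝ} (hB : ∀ x : ℍ[ℝ,c₁,c₂], x ≠ 0 → IsUnit x) :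
    c₁ < 0 ∧ c₂ < 0 := by
  constructor <;> by_contra! h
  · rcases eq_or_eq_neg_of_mul_self_eq hB (v := ⟨0, 1, 0, 0⟩) (r := √c₁) (by
      rw [Real.mul_self_sqrt h]; ext <;> simp) with h | h <;>
      simpa using congrArg QuaternionAlgebra.imI h
  · rcases eq_or_eq_neg_of_mul_self_eq hB (v := ⟨0, 0, 1, 0⟩) (r := √c₂) (by
      rw [Real.mul_self_sqrt h]; ext <;> simp) with h | h <;>
      simpa using congrArg QuaternionAlgebra.imJ h

section Definite

variable {F : Type*} [Field F] [LinearOrder F] [IsStrictOrderedRing F] {c₁ c₂ : F}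

theorem re_mul_star_nonneg (h₁ : c₁ < 0) (h₂ : c₂ < 0) (x : ℍ[F,c₁,c₂]) :
    0 ≤ (x * star x).re := by
  rw [re_mul_star]
  nlinarith [sq_nonneg x.re, mul_nonneg (neg_pos.2 h₁).le (sq_nonneg x.imI),
    mul_nonneg (neg_pos.2 h₂).le (sq_nonneg x.imJ),
    mul_nonneg (mul_pos_of_neg_of_neg h₁ h₂).le (sq_nonneg x.imK)]

theorem re_mul_star_ne_zero (h₁ : c₁ < 0) (h₂ : c₂ < 0) {x : ℍ[F,c₁,c₂]} (hx : x ≠ 0) :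
    (x * star x).re ≠ 0 := by
  have h₁₂ := mul_pos_of_neg_of_neg h₁ h₂
  have p₁ := mul_nonneg (neg_pos.2 h₁).le (sq_nonneg x.imI)
  have p₂ := mul_nonneg (neg_pos.2 h₂).le (sq_nonneg x.imJ)
  have p₃ := mul_nonneg h₁₂.le (sq_nonneg x.imK)
  contrapose! hx
  rw [re_mul_star] at hx
  have q₀ : x.re ^ 2 = 0 := by linarith [sq_nonneg x.re]
  have q₁ : -c₁ * x.imI ^ 2 = 0 := by linarith [sq_nonneg x.re]
  have q₂ : -c₂ * x.imJ ^ 2 = 0 := by linarith [sq_nonneg x.re]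
  have q₃ : c₁ * c₂ * x.imK ^ 2 = 0 := by linarith [sq_nonneg x.re]
  ext
  · simpa using q₀
  · simpa [h₁.ne] using q₁
  · simpa [h₂.ne] using q₂
  · simpa [h₁.ne, h₂.ne] using q₃

theorem isUnit_of_ne_zero_of_neg (h₁ : c₁ < 0) (h₂ : c₂ < 0) {x : ℍ[F,c₁,c₂]} (hx : x ≠ 0) :
    IsUnit x := by
  have hN := re_mul_star_ne_zero h₁ h₂ hx
  have h : x * ((x * star x).re⁻¹ • star x) = 1 := by
    rw [mul_smul_comm, QuaternionAlgebra.mul_star_eq_coe, QuaternionAlgebra.re_coe,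
      QuaternionAlgebra.smul_coe, inv_mul_cancel₀ hN, QuaternionAlgebra.coe_one]
  exact ⟨⟨x, _, h, by rw [smul_mul_assoc, star_comm_self', ← mul_smul_comm, h]⟩, rfl⟩

theorem re_eq_zero_of_mul_self_eq_coe {c : F} (hc : c < 0) {v : ℍ[F,c₁,c₂]}
    (hv : v * v = (c : ℍ[F,c₁,c₂])) : v.re = 0 := by
  by_contra hne
  have h : v * v = (2 * v.re) • v - ((v * star v).re : ℍ[F,c₁,c₂]) := by
    rw [← QuaternionAlgebra.mul_star_eq_coe, quaternion_star_eq, mul_sub,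
      ← QuaternionAlgebra.coe_commutes, QuaternionAlgebra.coe_mul_eq_smul, sub_sub_cancel]
  have hcoe : v = ((c + (v * star v).re) / (2 * v.re) : F) := by
    rw [div_eq_inv_mul, ← QuaternionAlgebra.smul_coe, eq_inv_smul_iff₀ (by simpa using hne),
      QuaternionAlgebra.coe_add, ← hv, h, sub_add_cancel]
  rw [hcoe, ← QuaternionAlgebra.coe_mul] at hv
  exact absurd (QuaternionAlgebra.coe_injective hv) (hc.trans_le (mul_self_nonneg _)).ne'

end Definite

theorem exists_int_eq_two_mul_re {a b : ℚ} {x : ℍ[ℚ,a,b]} (hx : IsIntegral ℤ x) :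
    ∃ n : ℤ, 2 * x.re = n := by
  have h := isIntegral_add_of_commute hx (isIntegral_star hx) (star_comm_self' x).symm
  rw [quaternion_add_star] at h
  have h' : IsIntegral ℤ (2 * x.re) := (isIntegral_algebraMap_iff
    (B := ℍ[ℚ,a,b]) QuaternionAlgebra.algebraMap_injective).1 h
  obtain ⟨n, hn⟩ := IsIntegrallyClosed.isIntegral_iff.1 h'
  exact ⟨n, hn.symm⟩

open Polynomial in
theorem exists_padic_sq_eq {p : ℕ} [Fact p.Prime] {n c : ℤ} (h : (p : ℤ) ∣ c ^ 2 - n)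
    (hc : ¬ (p : ℤ) ∣ 2 * c) : ∃ x : ℚ_[p], x ^ 2 = n := by
  let F : ℤ_[p][X] := X ^ 2 - C (n : ℤ_[p])
  have hF : aeval (c : ℤ_[p]) F = ((c ^ 2 - n : ℤ) : ℤ_[p]) := by simp [F]
  have hF' : aeval (c : ℤ_[p]) (derivative F) = ((2 * c : ℤ) : ℤ_[p]) := by
    simp [F, one_add_one_eq_two]
  have hnorm : ‖((2 * c : ℤ) : ℤ_[p])‖ = 1 :=
    (PadicInt.norm_le_one _).antisymm (not_lt.1 fun hlt =>
      hc ((PadicInt.norm_int_lt_one_iff_dvd _).1 hlt))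
  obtain ⟨z, hz, -⟩ := hensels_lemma (F := F) (a := (c : ℤ_[p])) (by
    rw [hF, hF', hnorm, one_pow]
    exact PadicInt.norm_int_lt_one_iff_dvd _ |>.2 h)
  have hz2 : z ^ 2 = n := by simpa [F, sub_eq_zero] using hz
  exact ⟨z, by rw [← PadicInt.coe_pow, hz2, PadicInt.coe_intCast]⟩

instance fact_prime_twentyThree : Fact (Nat.Prime 23) := ⟨by norm_num⟩

theorem exists_padic_sq_add_sq_eq {t : ℤ} (ht : t ^ 2 ≤ 3) :
    ∃ x y : ℚ_[23], x ≠ 0 ∧ x ^ 2 + y ^ 2 = t ^ 2 - 3 := by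
  obtain ⟨x, hx⟩ := exists_padic_sq_eq (p := 23) (n := -19) (c := 2) (by norm_num) (by norm_num)
  obtain ⟨x', hx'⟩ := exists_padic_sq_eq (p := 23) (n := -11) (c := 9) (by norm_num) (by norm_num)
  have hx0 : x ≠ 0 := by rintro rfl; norm_num at hx
  have hx0' : x' ≠ 0 := by rintro rfl; norm_num at hx'
  have h₁ : -1 ≤ t := by nlinarith
  have h₂ : t ≤ 1 := by nlinarith
  push_cast at hx hx'
  interval_cases t
  · exact ⟨x', 3, hx0', by push_cast; linear_combination hx'⟩
  · exact ⟨x, 4, hx0, by push_cast; linear_combination hx⟩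
  · exact ⟨x', 3, hx0', by push_cast; linear_combination hx'⟩

section RatQuaternion

variable {a b : ℚ}

theorem exists_int_anticommute_sq_eq (ha : a < 0) (hb : b < 0) {i ω : ℍ[ℚ,a,b]}
    (hi : i * i = -1) (hω : ω * ω + ω + 1 = 0) (hint : IsIntegral ℤ (i * ω)) :
    ∃ (t : ℤ) (u : ℍ[ℚ,a,b]), t ^ 2 ≤ 3 ∧ i.re = 0 ∧ u.re = 0 ∧ i * u + u * i = 0 ∧
      u * u = ((t ^ 2 - 3 : ℚ) : ℍ[ℚ,a,b]) := by
  obtain ⟨t, ht⟩ := exists_int_eq_two_mul_re hint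
  -- `q = √-3`; subtracting its component along `i` makes it anticommute with `i`.
  set q : ℍ[ℚ,a,b] := 2 * ω + 1 with hq
  have hqq : q * q = ((-3 : ℚ) : ℍ[ℚ,a,b]) := by
    have e : q * q = 4 * (ω * ω + ω + 1) - (1 + 1 + 1) := by rw [hq]; noncomm_ring
    rw [e, hω]
    ext <;> norm_num
  have hi0 : i.re = 0 := re_eq_zero_of_mul_self_eq_coe (c := -1) neg_one_lt_zero (by
    rw [hi, QuaternionAlgebra.coe_neg, QuaternionAlgebra.coe_one])
  have hq0 : q.re = 0 := re_eq_zero_of_mul_self_eq_coe (by norm_num) hqq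
  have star_pure : ∀ v : ℍ[ℚ,a,b], v.re = 0 → star v = -v := fun v hv => by
    rw [quaternion_star_eq, hv, mul_zero, QuaternionAlgebra.coe_zero, zero_sub]
  have hiq : i * q + q * i = ((2 * t : ℚ) : ℍ[ℚ,a,b]) := by
    have hre : (i * q).re = t := by
      rw [← ht, hq, show i * (2 * ω + 1) = i * ω + i * ω + i by noncomm_ring,
        QuaternionAlgebra.re_add, QuaternionAlgebra.re_add, hi0, add_zero, two_mul]
    have h := quaternion_add_star (i * q)
    rwa [star_mul, star_pure q hq0, star_pure i hi0, neg_mul_neg, hre] at h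
  set u : ℍ[ℚ,a,b] := q + (t : ℚ) • i with hu
  have hu0 : u.re = 0 := by simp [hu, hq0, hi0]
  have hii : i * i = ((-1 : ℚ) : ℍ[ℚ,a,b]) := by simpa using hi
  have huu : u * u = ((t ^ 2 - 3 : ℚ) : ℍ[ℚ,a,b]) := by
    have e : u * u = q * q + (t : ℚ) • (i * q + q * i) + (t ^ 2 : ℚ) • (i * i) := by
      simp only [hu, add_mul, mul_add, smul_mul_assoc, mul_smul_comm, smul_smul, smul_add, sq]
      abel
    rw [e, hqq, hiq, hii]
    simp only [QuaternionAlgebra.smul_coe, ← QuaternionAlgebra.coe_add]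
    congr 1
    ring
  refine ⟨t, u, ?_, hi0, hu0, ?_, huu⟩
  · have h := re_mul_star_nonneg ha hb u
    rw [star_pure u hu0, mul_neg, huu, ← QuaternionAlgebra.coe_neg, QuaternionAlgebra.re_coe] at h
    exact_mod_cast (by linarith : (t : ℚ) ^ 2 ≤ 3)
  · have e : i * u + u * i = (i * q + q * i) + (2 * t : ℚ) • (i * i) := by
      simp only [hu, add_mul, mul_add, smul_mul_assoc, mul_smul_comm, mul_smul, two_smul]
      abel
    rw [e, hiq, hii, QuaternionAlgebra.smul_coe, ← QuaternionAlgebra.coe_add]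
    simp

/-- Such a pair would make the algebra split at `23`: the field `ℚ(i)` and the form `t ^ 2 - 3`
represented by its orthogonal complement give a zero divisor over `ℚ₂₃`. -/
theorem not_exists_order_three_four (ha : a < 0) (hb : b < 0)
    (h23 : ∀ x : ℍ[ℚ_[23],(a : ℚ_[23]),(b : ℚ_[23])], x ≠ 0 → IsUnit x) {i ω : ℍ[ℚ,a,b]}
    (hi : i * i = -1) (hω : ω * ω + ω + 1 = 0) (hint : IsIntegral ℤ (i * ω)) : False := by
  obtain ⟨t, u, ht, hi0, hu0, hiu, huu⟩ := exists_int_anticommute_sq_eq ha hb hi hω hint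
  obtain ⟨x, y, hx0, hxy⟩ := exists_padic_sq_add_sq_eq ht
  let f : ℍ[ℚ,a,b] →+* ℍ[ℚ_[23],(a : ℚ_[23]),(b : ℚ_[23])] :=
    quaternionMap (Rat.castHom ℚ_[23])
  have hfu : f u * f u = ((t ^ 2 - 3 : ℚ_[23]) : ℍ[ℚ_[23],(a : ℚ_[23]),(b : ℚ_[23])]) := by
    rw [← map_mul, huu]
    exact (quaternionMap_coe (Rat.castHom ℚ_[23]) _).trans (congrArg _ (by simp))
  have hw : (y • f i + f u) * (y • f i + f u)
      = ((x * x : ℚ_[23]) : ℍ[ℚ_[23],(a : ℚ_[23]),(b : ℚ_[23])]) := by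
    have e : (y • f i + f u) * (y • f i + f u)
        = (y * y) • f (i * i) + y • f (i * u + u * i) + f u * f u := by
      simp only [map_mul, map_add, add_mul, mul_add, smul_mul_assoc, mul_smul_comm, smul_smul,
        smul_add]
      abel
    rw [e, hi, hiu, map_zero, smul_zero, add_zero, hfu, map_neg, map_one,
      ← QuaternionAlgebra.coe_one, ← QuaternionAlgebra.coe_neg, QuaternionAlgebra.smul_coe,
      ← QuaternionAlgebra.coe_add]
    congr 1
    linear_combination -hxy
  have hfre (v : ℍ[ℚ,a,b]) : (f v).re = v.re := rfl
  have hre : (y • f i + f u).re = 0 := by simp [hfre, hi0, hu0]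
  rcases eq_or_eq_neg_of_mul_self_eq h23 hw with h | h <;> rw [h] at hre <;> simp [hx0] at hre

end RatQuaternion

/-! ### The Hecke operator at `2` -/

section HeckeTwo

variable {a b : ℚ} {R : Subring ℍ[ℚ,a,b]} {ι : ℍ[ℚ,a,b] →ₐ[ℚ] M2}

theorem isIntegral_of_mem_of_isOrder (hR : IsOrder R) {x : ℍ[ℚ,a,b]} (hx : x ∈ R) :
    IsIntegral ℤ x :=
  .of_mem_of_fg (subalgebraOfSubring R) ((Submodule.fg_iff_addSubgroup_fg _).2 hR.1) x hx

theorem star_mem_invertTwo (hR : IsOrder R) {x : ℍ[ℚ,a,b]} (hx : x ∈ invertTwo R) :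
    star x ∈ invertTwo R := by
  obtain ⟨n, hn⟩ := hx
  obtain ⟨t, ht⟩ := exists_int_eq_two_mul_re (isIntegral_of_mem_of_isOrder hR hn)
  refine ⟨n, ?_⟩
  rw [← QuaternionAlgebra.star_smul', quaternion_star_eq, ht, QuaternionAlgebra.coe_intCast]
  exact R.sub_mem (intCast_mem R t) hn

theorem two_zpow_smul_mem_invertTwo {x : ℍ[ℚ,a,b]} (hx : x ∈ invertTwo R) (k : ℤ) :
    (2 : ℚ) ^ k • x ∈ invertTwo R := by
  obtain ⟨n, hn⟩ := hx
  obtain ⟨j, hj⟩ := Int.eq_ofNat_of_zero_le (by omega : 0 ≤ (k.natAbs : ℤ) + k)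
  have e : (2 : ℚ) ^ (n + k.natAbs) • (2 : ℚ) ^ k • x = (2 ^ j : ℕ) • ((2 : ℚ) ^ n • x) := by
    rw [← Nat.cast_smul_eq_nsmul ℚ, smul_smul, smul_smul, Nat.cast_pow, Nat.cast_ofNat, pow_add,
      mul_assoc, mul_comm, ← zpow_natCast (2 : ℚ) k.natAbs, ← zpow_add₀ two_ne_zero, hj,
      zpow_natCast]
  exact ⟨n + k.natAbs, e ▸ R.nsmul_mem hn _⟩

theorem mem_Gam_iff {g : GL2} :
    g ∈ Gam R ι ↔ ∃ u : (invertTwo R)ˣ, ι (u : invertTwo R) = (g : M2) :=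
  ⟨fun ⟨u, hu⟩ => ⟨u, congrArg Units.val hu⟩, fun ⟨u, hu⟩ => ⟨u, Units.ext hu⟩⟩

theorem exists_mem_invertTwo_mul_eq_one (hR : IsOrder R) {α : ℍ[ℚ,a,b]} (hα : α ∈ invertTwo R)
    {k : ℤ} (hk : reducedNorm α = 2 ^ k ∨ reducedNorm α = -2 ^ k) :
    ∃ β ∈ invertTwo R, α * β = 1 ∧ β * α = 1 := by
  have hβ : (reducedNorm α)⁻¹ • star α ∈ invertTwo R := by
    have h := two_zpow_smul_mem_invertTwo (star_mem_invertTwo hR hα) (-k)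
    rw [zpow_neg] at h
    rcases hk with hk | hk <;> rw [hk]
    · exact h
    · rw [inv_neg, neg_smul]
      exact neg_mem h
  have hN : reducedNorm α ≠ 0 := by
    have h2 : (2 : ℚ) ^ k ≠ 0 := zpow_ne_zero k two_ne_zero
    rcases hk with hk | hk <;> simpa only [hk, ne_eq, neg_eq_zero]
  have h : α * ((reducedNorm α)⁻¹ • star α) = 1 := by
    rw [mul_smul_comm, QuaternionAlgebra.mul_star_eq_coe, QuaternionAlgebra.smul_coe,
      ← reducedNorm, inv_mul_cancel₀ hN, QuaternionAlgebra.coe_one]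
  exact ⟨_, hβ, h, by rw [smul_mul_assoc, star_comm_self', ← mul_smul_comm, h]⟩

theorem heckeSet_one_subset (hR : IsOrder R) : heckeSet R ι 1 ⊆ Gam R ι := by
  rintro g ⟨α, hα, hg, k, hk⟩
  rw [Nat.cast_one, one_mul] at hk
  obtain ⟨β, hβ, h₁, h₂⟩ := exists_mem_invertTwo_mul_eq_one hR hα hk
  exact mem_Gam_iff.2 ⟨⟨⟨α, hα⟩, ⟨β, hβ⟩, Subtype.ext h₁, Subtype.ext h₂⟩, hg⟩

theorem one_mem_heckeSet_one : (1 : GL2) ∈ heckeSet R ι 1 :=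
  ⟨1, one_mem _, map_one ι, 0, .inl (by simp [reducedNorm])⟩

theorem heckeOdd_one (hR : IsOrder R) {φ : GL2 → ℝ} (hφ : ∀ γ ∈ Gam R ι, ∀ x, φ (γ * x) = φ x) :
    heckeOdd R ι 1 φ = φ := by
  have h : (QuotientGroup.mk '' heckeSet R ι 1 : Set (GL2 ⧸ Gam R ι)) =
      {((1 : GL2) : GL2 ⧸ Gam R ι)} := by
    refine Set.eq_singleton_iff_unique_mem.2 ⟨⟨1, one_mem_heckeSet_one, rfl⟩, ?_⟩
    rintro _ ⟨g, hg, rfl⟩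
    rw [QuotientGroup.eq, mul_one]
    exact inv_mem (heckeSet_one_subset hR hg)
  obtain ⟨γ, hγ⟩ := QuotientGroup.mk_out_eq_mul (Gam R ι) (1 : GL2)
  funext x
  rw [heckeOdd, h, finsum_mem_singleton, hγ, one_mul, hφ _ (inv_mem γ.2)]

theorem heckeTwoPow_one {φ : GL2 → ℝ} (hφ : ∀ k ∈ K2, ∀ x, φ (x * k) = φ x) (x : GL2) :
    heckeTwoPow 1 φ x = ∑ i, φ (x * heckeRep i) := by
  have hinj : Function.Injective fun i => (heckeRep i : GL2 ⧸ K2) := fun i j hij =>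
    eq_of_inv_heckeRep_mul_mem_K2 (QuotientGroup.eq.1 hij)
  have h : (QuotientGroup.mk '' {h : GL2 | (h : M2) ∈ integralM2 ∧
      ‖(h : M2).det‖ = 2 ^ (-((1 : ℕ) : ℤ))} : Set (GL2 ⧸ K2))
      = Set.range fun i => (heckeRep i : GL2 ⧸ K2) := by
    have h2 : (2 : ℝ) ^ (-((1 : ℕ) : ℤ)) = 2⁻¹ := by norm_num
    ext c
    constructor
    · rintro ⟨h, ⟨h₁, h₂⟩, rfl⟩
      obtain ⟨i, k, hk, rfl⟩ := exists_eq_heckeRep_mul (mem_integralM2_iff.1 h₁) (h₂.trans h2)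
      exact ⟨i, (QuotientGroup.mk_mul_of_mem _ hk).symm⟩
    · rintro ⟨i, rfl⟩
      refine ⟨heckeRep i, ⟨mem_integralM2_iff.2 (norm_heckeRep i).le, ?_⟩, rfl⟩
      rw [det_heckeRep, norm_two_padic, h2]
  rw [heckeTwoPow, h, finsum_mem_range hinj, finsum_eq_sum_of_fintype]
  refine Finset.sum_congr rfl fun i _ => ?_
  obtain ⟨k, hk⟩ := QuotientGroup.mk_out_eq_mul K2 (heckeRep i)
  rw [hk, ← mul_assoc, hφ _ k.2]

theorem hecke_two (hR : IsOrder R) (φ : FunY R ι) (x : GL2) :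
    hecke R ι 2 φ.toFun x = ∑ i, φ.toFun (x * heckeRep i) := by
  have h2 : heckeTwoPow 1 φ.toFun = fun x => ∑ i, φ.toFun (x * heckeRep i) :=
    funext fun x => heckeTwoPow_one φ.right_inv x
  have hf : Nat.factorization 2 2 = 1 := Nat.Prime.factorization_self Nat.prime_two
  rw [hecke, hf, pow_one, Nat.div_self two_pos, h2, heckeOdd_one hR]
  intro γ hγ x
  simp only [mul_assoc, φ.left_inv γ hγ]

end HeckeTwo

/-! ### Integration on `Γ \ G` -/

section FundamentalDomain

variable {G : Type*} [Group G] [MeasurableSpace G] {Γ K : Subgroup G} {μ : Measure G} {D : Set G}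

open scoped Pointwise in
theorem measure_inter_mk_preimage_le [MeasurableMul G] [μ.IsMulLeftInvariant] [Countable Γ]
    (hD : IsFundamentalDomain Γ D μ) (x : G) :
    μ (D ∩ DoubleCoset.mk Γ K ⁻¹' {DoubleCoset.mk Γ K x}) ≤ μ K := by
  have hx : μ ((x * ·) '' (K : Set G)) = μ K := by rw [Set.image_mul_left, measure_preimage_mul]
  rw [← hx, hD.measure_eq_tsum ((x * ·) '' (K : Set G))]
  refine (measure_mono (μ := μ) ?_).trans (measure_iUnion_le
    fun γ : Γ => γ • ((x * ·) '' (K : Set G)) ∩ D)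
  rintro y ⟨hy, hy'⟩
  obtain ⟨γ, hγ, k, hk, rfl⟩ := (DoubleCoset.eq _ _ _ _).1 (Eq.symm hy')
  exact Set.mem_iUnion.2 ⟨⟨γ, hγ⟩, ⟨x * k, ⟨k, hk, rfl⟩, (mul_assoc _ _ _).symm⟩, hy⟩

theorem measure_fundamentalDomain_lt_top [MeasurableMul G] [μ.IsMulLeftInvariant] [Countable Γ]
    [Finite (DoubleCoset.Quotient (Γ : Set G) (K : Set G))] (hK : μ K ≠ ⊤)
    (hD : IsFundamentalDomain Γ D μ) : μ D < ⊤ := by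
  have h : D = ⋃ y, D ∩ DoubleCoset.mk Γ K ⁻¹' {y} := by
    rw [← Set.inter_iUnion, ← Set.preimage_iUnion, Set.iUnion_of_singleton, Set.preimage_univ,
      Set.inter_univ]
  have := Fintype.ofFinite (DoubleCoset.Quotient (Γ : Set G) (K : Set G))
  rw [h]
  refine (measure_iUnion_fintype_le _ _).trans_lt (ENNReal.sum_lt_top.2 fun y _ => ?_)
  obtain ⟨x, rfl⟩ := Quotient.exists_rep y
  exact (measure_inter_mk_preimage_le hD x).trans_lt hK.lt_top

variable [TopologicalSpace G] [IsTopologicalGroup G] [LocallyCompactSpace G]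
  [SecondCountableTopology G] [BorelSpace G] [μ.IsHaarMeasure]

theorem map_mul_right_eq_of_mem (hK : IsOpen (K : Set G)) (hK' : IsCompact (K : Set G)) {k : G}
    (hk : k ∈ K) : μ.map (· * k) = μ := by
  have h := Measure.isMulLeftInvariant_eq_smul (μ.map (· * k)) μ
  set c := (μ.map (· * k)).haarScalarFactor μ
  have hμK : (μ.map (· * k)) (K : Set G) = μ K := by
    rw [Measure.map_apply (measurable_mul_const k) hK.measurableSet]
    congr 1
    ext x
    exact K.mul_mem_cancel_right hk
  have hc : (c : ENNReal) = 1 := by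
    rw [h, Measure.smul_apply, ENNReal.smul_def, smul_eq_mul] at hμK
    exact (ENNReal.mul_eq_right (hK.measure_pos μ ⟨1, K.one_mem⟩).ne' hK'.measure_ne_top).1 hμK
  rw [h, ENNReal.coe_eq_one.1 hc, one_smul]

theorem setIntegral_mul_right_of_mem {E : Type*} [NormedAddCommGroup E] [NormedSpace ℝ E]
    [Countable Γ] (hK : IsOpen (K : Set G)) (hK' : IsCompact (K : Set G))
    (hD : IsFundamentalDomain Γ D μ) {f : G → E} (hf : ∀ γ ∈ Γ, ∀ x, f (γ * x) = f x) {k : G}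
    (hk : k ∈ K) : ∫ x in D, f (x * k) ∂μ = ∫ x in D, f x ∂μ := by
  have hmp : ∀ k ∈ K, MeasurePreserving (· * k) μ μ := fun k hk =>
    ⟨measurable_mul_const k, map_mul_right_eq_of_mem hK hK' hk⟩
  have hD' : IsFundamentalDomain Γ ((· * k⁻¹) ⁻¹' D) μ :=
    hD.preimage_of_equiv (hmp _ (inv_mem hk)).quasiMeasurePreserving (e := id)
      Function.bijective_id fun γ x => mul_assoc _ _ _
  have h := (hmp k hk).setIntegral_preimage_emb (Homeomorph.mulRight k).measurableEmbedding f
    ((· * k⁻¹) ⁻¹' D)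
  have hcomp : (· * k⁻¹) ∘ (· * k) = (id : G → G) := funext fun x => mul_inv_cancel_right x k
  rw [← Set.preimage_comp, hcomp, Set.preimage_id] at h
  exact h.trans (hD'.setIntegral_eq hD fun γ x => hf γ γ.2 x)

end FundamentalDomain

/-! ### The finite set `Γ \ GL₂(ℚ₂) / GL₂(ℤ₂)` -/

section SetY

variable {a b : ℚ} {R : Subring ℍ[ℚ,a,b]} {ι : ℍ[ℚ,a,b] →ₐ[ℚ] M2}

instance countable_Gam : Countable (Gam R ι) := by
  have : Countable ℍ[ℚ,a,b] := (QuaternionAlgebra.equivTuple a 0 b).injective.countable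
  have : Countable (invertTwo R)ˣ := Units.val_injective.countable
  rw [Gam, MonoidHom.range_eq_map]
  exact Set.countable_coe_iff.2 ((Set.countable_univ (α := (invertTwo R)ˣ)).image _)

/-- The set `𝐘 = Γ \ GL₂(ℚ₂) / GL₂(ℤ₂)`. -/
abbrev SetY (R : Subring ℍ[ℚ,a,b]) (ι : ℍ[ℚ,a,b] →ₐ[ℚ] M2) : Type :=
  DoubleCoset.Quotient (Gam R ι : Set GL2) (K2 : Set GL2)

theorem FunY.eq_of_mk_eq (φ : FunY R ι) {x y : GL2}
    (h : DoubleCoset.mk (Gam R ι) K2 x = DoubleCoset.mk (Gam R ι) K2 y) :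
    φ.toFun x = φ.toFun y := by
  obtain ⟨γ, hγ, k, hk, rfl⟩ := (DoubleCoset.eq _ _ _ _).1 h
  rw [φ.right_inv k hk, φ.left_inv γ hγ]

theorem mk_mul_mem_K2 (x : GL2) {k : GL2} (hk : k ∈ K2) :
    DoubleCoset.mk (Gam R ι) K2 (x * k) = DoubleCoset.mk (Gam R ι) K2 x :=
  ((DoubleCoset.eq _ _ _ _).2 ⟨1, one_mem _, k, hk, by rw [one_mul]⟩).symm

theorem mk_mem_Gam_mul (x : GL2) {γ : GL2} (hγ : γ ∈ Gam R ι) :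
    DoubleCoset.mk (Gam R ι) K2 (γ * x) = DoubleCoset.mk (Gam R ι) K2 x :=
  ((DoubleCoset.eq _ _ _ _).2 ⟨γ, hγ, 1, one_mem _, by rw [mul_one]⟩).symm

/-- A function on `𝐘`, as a function on `GL₂(ℚ₂)`. -/
def FunY.ofFun (f : SetY R ι → ℝ) : FunY R ι where
  toFun x := f (DoubleCoset.mk _ _ x)
  left_inv γ hγ x := by rw [mk_mem_Gam_mul x hγ]
  right_inv k hk x := by rw [mk_mul_mem_K2 x hk]

/-- An invariant function on `GL₂(ℚ₂)`, as a function on `𝐘`. -/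
def FunY.descend (φ : FunY R ι) (y : SetY R ι) : ℝ := φ.toFun (Quotient.out y)

theorem FunY.descend_mk (φ : FunY R ι) (x : GL2) :
    φ.descend (DoubleCoset.mk (Gam R ι) K2 x) = φ.toFun x :=
  φ.eq_of_mk_eq (DoubleCoset.out_eq' _ _ _)

theorem FunY.continuous (φ : FunY R ι) : Continuous φ.toFun := by
  refine IsLocallyConstant.continuous ((IsLocallyConstant.iff_exists_open _).2 fun x => ?_)
  refine ⟨(x⁻¹ * ·) ⁻¹' K2, isOpen_K2.preimage (by fun_prop), ?_, fun y hy => ?_⟩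
  · rw [Set.mem_preimage, inv_mul_cancel]
    exact one_mem K2
  · simpa only [mul_inv_cancel_left] using φ.right_inv _ hy x

theorem FunY.exists_norm_le [Finite (SetY R ι)] (φ : FunY R ι) : ∃ C, ∀ x, ‖φ.toFun x‖ ≤ C := by
  obtain ⟨C, hC⟩ := (Set.finite_range φ.descend).isBounded.exists_norm_le
  exact ⟨C, fun x => φ.descend_mk x ▸ hC _ ⟨_, rfl⟩⟩

variable {μ : Measure GL2} {D : Set GL2}

/-- The functions `1, Ψ₁, Ψ₂` on `𝐘`, which form a basis. -/
def heckeFamily (Ψ : Fin 2 → FunY R ι) : Fin 3 → SetY R ι → ℝ :=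
  ![fun _ => 1, (Ψ 0).descend, (Ψ 1).descend]

variable {Ψ : Fin 2 → FunY R ι} {lam : Fin 2 → ℕ → ℝ}

theorem span_heckeFamily (hΨ : IsHeckeBasis μ D Ψ lam) :
    Submodule.span ℝ (Set.range (heckeFamily Ψ)) = ⊤ := by
  refine eq_top_iff.2 fun f _ => (Submodule.mem_span_range_iff_exists_fun ℝ).2 ?_
  obtain ⟨c₀, c₁, c₂, h⟩ := hΨ.span (FunY.ofFun f)
  refine ⟨![c₀, c₁, c₂], funext fun y => ?_⟩
  have hy := h (Quotient.out y)
  simp only [FunY.ofFun, DoubleCoset.out_eq'] at hy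
  simp [Fin.sum_univ_three, heckeFamily, FunY.descend, hy]

theorem finite_SetY (hΨ : IsHeckeBasis μ D Ψ lam) : Finite (SetY R ι) := by
  by_contra hinf
  rw [not_finite_iff_infinite] at hinf
  let e : Fin 4 ↪ SetY R ι := Fin.valEmbedding.trans (Infinite.natEmbedding _)
  have hr := congrArg (Submodule.map (LinearMap.funLeft ℝ ℝ e)) (span_heckeFamily hΨ)
  rw [Submodule.map_span, ← Set.range_comp, Submodule.map_top, LinearMap.range_eq_top.2
    (LinearMap.funLeft_surjective_of_injective ℝ ℝ e e.injective)] at hr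
  have hle := finrank_range_le_card (R := ℝ) (LinearMap.funLeft ℝ ℝ e ∘ heckeFamily Ψ)
  rw [Set.finrank, hr, finrank_top] at hle
  simp at hle

variable [μ.IsHaarMeasure]

theorem FunY.integrableOn_mul [Finite (SetY R ι)] (hD : IsFundamentalDomain (Gam R ι) D μ)
    (φ₁ φ₂ : FunY R ι) (g : GL2) :
    IntegrableOn (fun x => φ₁.toFun (x * g) * φ₂.toFun x) D μ := by
  have : IsFiniteMeasure (μ.restrict D) := isFiniteMeasure_restrict.2
    (measure_fundamentalDomain_lt_top isCompact_K2.measure_ne_top hD).ne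
  obtain ⟨C₁, h₁⟩ := φ₁.exists_norm_le
  obtain ⟨C₂, h₂⟩ := φ₂.exists_norm_le
  refine Integrable.of_bound (C := C₁ * C₂) ?_ (Filter.Eventually.of_forall fun x => ?_)
  · exact ((φ₁.continuous.comp (continuous_mul_const g)).mul φ₂.continuous).aestronglyMeasurable
  · rw [norm_mul]
    exact mul_le_mul (h₁ _) (h₂ _) (norm_nonneg _) ((norm_nonneg _).trans (h₁ x))

theorem linearIndependent_heckeFamily (hΨ : IsHeckeBasis μ D Ψ lam)
    (hD : IsFundamentalDomain (Gam R ι) D μ) : LinearIndependent ℝ (heckeFamily Ψ) := by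
  have := finite_SetY hΨ
  refine Fintype.linearIndependent_iff.2 fun c hc => ?_
  have h (x : GL2) : c 0 + c 1 * (Ψ 0).toFun x + c 2 * (Ψ 1).toFun x = 0 := by
    simpa [Fin.sum_univ_three, heckeFamily, FunY.descend_mk] using
      congrFun hc (DoubleCoset.mk _ _ x)
  have hinner (k : Fin 2) : c 0 * innerX μ D (Ψ k).toFun (fun _ => 1)
      + c 1 * innerX μ D (Ψ 0).toFun (Ψ k).toFun
      + c 2 * innerX μ D (Ψ 1).toFun (Ψ k).toFun = 0 := by
    have hmul (l : Fin 2) : IntegrableOn (fun x => (Ψ l).toFun x * (Ψ k).toFun x) D μ := by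
      simpa only [mul_one] using FunY.integrableOn_mul hD (Ψ l) (Ψ k) 1
    have hone : IntegrableOn (fun x => (Ψ k).toFun x * 1) D μ := by
      simpa [FunY.ofFun] using FunY.integrableOn_mul hD (Ψ k) (.ofFun fun _ => 1) 1
    have hadd : IntegrableOn
        (fun x => c 0 * ((Ψ k).toFun x * 1) + c 1 * ((Ψ 0).toFun x * (Ψ k).toFun x)) D μ :=
      (hone.const_mul _).add ((hmul 0).const_mul _)
    simp only [innerX, ← integral_const_mul]
    rw [← integral_add (hone.const_mul _) ((hmul 0).const_mul _),
      ← integral_add hadd ((hmul 1).const_mul _)]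
    refine integral_eq_zero_of_ae (.of_forall fun x => ?_)
    simp only [Pi.zero_apply]
    linear_combination (Ψ k).toFun x * h x
  have h1 : c 1 = 0 := by simpa [hΨ.mean_zero, hΨ.orthonormal] using hinner 0
  have h2 : c 2 = 0 := by simpa [hΨ.mean_zero, hΨ.orthonormal] using hinner 1
  have h0 : c 0 = 0 := by simpa [h1, h2] using h 1
  exact Fin.forall_fin_succ.2 ⟨h0, Fin.forall_fin_two.2 ⟨h1, h2⟩⟩

theorem card_SetY (hΨ : IsHeckeBasis μ D Ψ lam) (hD : IsFundamentalDomain (Gam R ι) D μ) :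
    Nat.card (SetY R ι) = 3 := by
  have := finite_SetY hΨ
  have := Fintype.ofFinite (SetY R ι)
  have h := Module.finrank_eq_card_basis
    (Module.Basis.mk (linearIndependent_heckeFamily hΨ hD) (span_heckeFamily hΨ).ge)
  rwa [Module.finrank_fintype_fun_eq_card, ← Nat.card_eq_fintype_card, Fintype.card_fin] at h

end SetY

/-! ### The spherical matrix coefficients -/

section MatCoeff

variable {a b : ℚ} {R : Subring ℍ[ℚ,a,b]} {ι : ℍ[ℚ,a,b] →ₐ[ℚ] M2} {μ : Measure GL2} {D : Set GL2}

theorem matCoeff_mul_K2 (φ : FunY R ι) (g : GL2) {k : GL2} (hk : k ∈ K2) :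
    matCoeff μ D φ (g * k) = matCoeff μ D φ g := by
  simp only [matCoeff, ← mul_assoc, φ.right_inv k hk]

theorem matCoeff_center_mul (φ : FunY R ι) (g : GL2) {z : GL2} (hz : z ∈ Subgroup.center GL2) :
    matCoeff μ D φ (z * g) = matCoeff μ D φ g := by
  simp only [matCoeff, ← Subgroup.mem_center_iff.1 hz g, ← mul_assoc, φ.mul_center z hz]

section

variable [μ.IsHaarMeasure] (hD : IsFundamentalDomain (Gam R ι) D μ)
include hD

theorem matCoeff_K2_mul (φ : FunY R ι) (g : GL2) {k : GL2} (hk : k ∈ K2) :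
    matCoeff μ D φ (k * g) = matCoeff μ D φ g := by
  have h := setIntegral_mul_right_of_mem isOpen_K2 isCompact_K2 hD
    (f := fun x => φ.toFun (x * g) * φ.toFun x)
    (fun γ hγ x => by simp only [mul_assoc, φ.left_inv γ hγ]) hk
  simp only [φ.right_inv k hk] at h
  simp only [matCoeff, innerX, ← mul_assoc, h]

theorem matCoeff_eq_of_cartanSize_eq (φ : FunY R ι) (n : ℕ) (g : GL2)
    (hg : cartanSize g = 2 ^ n) : matCoeff μ D φ g = matCoeff μ D φ (diagTwoPow n) := by
  obtain ⟨z, hz, k₁, hk₁, k₂, hk₂, rfl⟩ := exists_eq_of_cartanSize_eq hg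
  rw [matCoeff_mul_K2 _ _ hk₂, mul_assoc, matCoeff_center_mul _ _ hz, matCoeff_K2_mul hD _ _ hk₁]

end

variable {Ψ : Fin 2 → FunY R ι} {lam : Fin 2 → ℕ → ℝ} (hΨ : IsHeckeBasis μ D Ψ lam)
include hΨ

theorem matCoeff_eq_integral (k : Fin 2) (g : GL2) :
    matCoeff μ D (Ψ k) g = ∫ x in D, (Ψ k).toFun (x * g) * (Ψ k).toFun x ∂μ := by
  rw [matCoeff, hΨ.orthonormal, if_pos rfl, div_one]
  rfl

theorem matCoeff_diagTwoPow_zero (k : Fin 2) : matCoeff μ D (Ψ k) (diagTwoPow 0) = 1 := by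
  have h := hΨ.orthonormal k k
  rw [if_pos rfl] at h
  simp only [diagTwoPow_zero, matCoeff, mul_one, h, div_one]

theorem sum_mul_heckeRep_eigen (hR : IsOrder R) (k : Fin 2) (x : GL2) :
    ∑ i, (Ψ k).toFun (x * heckeRep i) = √2 * lam k 2 * (Ψ k).toFun x := by
  rw [← hecke_two hR, hΨ.eigen k 2 one_le_two, Nat.cast_ofNat]

variable [μ.IsHaarMeasure] (hR : IsOrder R) (hD : IsFundamentalDomain (Gam R ι) D μ)
include hR hD

theorem sum_matCoeff_mul_heckeRep (k : Fin 2) (g : GL2) :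
    ∑ i, matCoeff μ D (Ψ k) (g * heckeRep i) = √2 * lam k 2 * matCoeff μ D (Ψ k) g := by
  have := finite_SetY hΨ
  simp only [matCoeff_eq_integral hΨ]
  rw [← integral_finsetSum _ fun i _ => FunY.integrableOn_mul hD (Ψ k) (Ψ k) (g * heckeRep i),
    ← integral_const_mul]
  refine integral_congr_ae (Filter.Eventually.of_forall fun x => ?_)
  simp only [← mul_assoc, ← Finset.sum_mul, sum_mul_heckeRep_eigen hΨ hR]

theorem three_mul_matCoeff_diagTwoPow_one (k : Fin 2) :
    3 * matCoeff μ D (Ψ k) (diagTwoPow 1) = √2 * lam k 2 := by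
  have h := sum_mul_heckeRep_of_cartanSize_eq_one (matCoeff_eq_of_cartanSize_eq hD (Ψ k))
    (cartanSize_diagTwoPow 0)
  rw [sum_matCoeff_mul_heckeRep hΨ hR hD, matCoeff_diagTwoPow_zero hΨ, mul_one, nsmul_eq_mul] at h
  exact h.symm

theorem matCoeff_diagTwoPow_add_two (k : Fin 2) (n : ℕ) :
    matCoeff μ D (Ψ k) (diagTwoPow n) + 2 * matCoeff μ D (Ψ k) (diagTwoPow (n + 2))
      = √2 * lam k 2 * matCoeff μ D (Ψ k) (diagTwoPow (n + 1)) := by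
  have h := sum_mul_heckeRep_of_cartanSize_eq (matCoeff_eq_of_cartanSize_eq hD (Ψ k))
    (cartanSize_diagTwoPow (n + 1))
  rw [sum_matCoeff_mul_heckeRep hΨ hR hD, nsmul_eq_mul] at h
  exact h.symm

end MatCoeff

/-! ### Stabilizers of vertices of the tree -/

section Stabilizer

theorem nonempty_setOf_smul_eq_equiv_stabilizer {G α : Type*} [Group G] [MulAction G α] {x y : α}
    (h : ∃ g : G, g • x = y) : Nonempty ({g : G // g • x = y} ≃ MulAction.stabilizer G x) := by
  obtain ⟨g, rfl⟩ := h
  refine ⟨(Equiv.mulLeft g⁻¹).subtypeEquiv fun g' => ?_⟩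
  rw [Equiv.coe_mulLeft, MulAction.mem_stabilizer_iff, mul_smul, inv_smul_eq_iff]

variable {G : Type*} [Group G] {Γ K : Subgroup G}

theorem doubleCosetMk_eq_iff_exists_smul {x y : G} :
    DoubleCoset.mk Γ K x = DoubleCoset.mk Γ K y ↔ ∃ γ : Γ, γ • (x : G ⧸ K) = (y : G ⧸ K) := by
  rw [DoubleCoset.eq]
  constructor
  · rintro ⟨γ, hγ, k, hk, rfl⟩
    refine ⟨⟨γ, hγ⟩, QuotientGroup.eq.2 ?_⟩
    simpa [mul_assoc] using hk
  · rintro ⟨γ, h⟩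
    exact ⟨γ, γ.2, (γ * x)⁻¹ * y, QuotientGroup.eq.1 h, by group⟩

open scoped Pointwise in
theorem finite_stabilizer_quotient [TopologicalSpace G] [IsTopologicalGroup G] [MeasurableSpace G]
    [BorelSpace G] [Countable Γ] {μ : Measure G} [μ.IsHaarMeasure] {D : Set G}
    (hK : IsOpen (K : Set G)) (hK' : IsCompact (K : Set G)) (hD : IsFundamentalDomain Γ D μ)
    (y : G ⧸ K) : Finite (MulAction.stabilizer Γ y) := by
  let t : Set G := {g | (g : G ⧸ K) = y}
  have hμt : μ t = μ K := by
    obtain ⟨x, rfl⟩ := QuotientGroup.mk_surjective y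
    rw [← measure_preimage_mul μ x⁻¹ K]
    congr 1
    ext g
    exact eq_comm.trans QuotientGroup.eq
  have hsum := hD.measure_eq_tsum t
  obtain ⟨γ₀, hγ₀⟩ : ∃ γ : Γ, μ (γ • t ∩ D) ≠ 0 := by
    by_contra! h
    rw [hμt, ENNReal.tsum_eq_zero.2 h] at hsum
    exact (hK.measure_pos μ ⟨1, K.one_mem⟩).ne' hsum
  have hfin := ENNReal.finite_const_le_of_tsum_ne_top
    (by rw [← hsum, hμt]; exact hK'.measure_ne_top) hγ₀
  have hinv (δ : MulAction.stabilizer Γ y) : (δ : Γ) • t = t := by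
    ext g
    rw [Set.mem_smul_set_iff_inv_smul_mem]
    exact (inv_smul_eq_iff (a := (g : G ⧸ K))).trans
      (by rw [MulAction.mem_stabilizer_iff.1 δ.2])
  have := hfin.to_subtype
  refine Finite.of_injective (fun δ : MulAction.stabilizer Γ y =>
    (⟨γ₀ * δ, ?_⟩ : {γ : Γ | μ (γ₀ • t ∩ D) ≤ μ (γ • t ∩ D)})) fun δ δ' h => ?_
  · rw [Set.mem_ofPred_eq, mul_smul, hinv]
  · exact Subtype.ext (mul_left_cancel (congrArg Subtype.val h))

end Stabilizer

section StabilizerOrder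

theorem mul_self_add_self_add_one_eq_zero {A : Type*} [Ring A] [NoZeroDivisors A] {x : A}
    (h3 : x ^ 3 = 1) (h1 : x ≠ 1) : x * x + x + 1 = 0 := by
  have h : (x - 1) * (x * x + x + 1) = x ^ 3 - 1 := by noncomm_ring
  rw [h3, sub_self] at h
  exact (mul_eq_zero.1 h).resolve_left (sub_ne_zero.2 h1)

theorem mul_self_eq_neg_one {A : Type*} [Ring A] [NoZeroDivisors A] {x : A} (h4 : x ^ 4 = 1)
    (h1 : x ≠ 1) (h1' : x ≠ -1) : x * x = -1 := by
  have h : (x - 1) * ((x + 1) * (x * x + 1)) = x ^ 4 - 1 := by noncomm_ring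
  rw [h4, sub_self] at h
  have h' := (mul_eq_zero.1 h).resolve_left (sub_ne_zero.2 h1)
  exact eq_neg_of_add_eq_zero_left
    ((mul_eq_zero.1 h').resolve_left fun h0 => h1' (eq_neg_of_add_eq_zero_left h0))

theorem exists_pow_four_eq_one {S A : Type*} [Group S] [Finite S] [Ring A] {f : S →* A}
    (hf : Function.Injective f) (h4 : 4 ∣ Nat.card S) :
    ∃ s : S, f s ^ 4 = 1 ∧ f s ≠ 1 ∧ f s ≠ -1 := by
  obtain ⟨P, hP⟩ := Sylow.exists_subgroup_card_pow_prime (G := S) 2 (n := 2) h4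
  obtain ⟨s, hs, hs1⟩ : ∃ s ∈ P, f s ∉ ({1, -1} : Set A) := by
    by_contra! h
    have hle : (f '' P).ncard ≤ 2 :=
      (Set.ncard_le_ncard (Set.image_subset_iff.2 h) (Set.toFinite {1, -1})).trans
        ((Set.ncard_insert_le _ _).trans_eq (by rw [Set.ncard_singleton]))
    rw [Set.ncard_image_of_injective _ hf, ← Nat.card_coe_set_eq] at hle
    exact absurd (hP.symm.trans_le hle) (by norm_num)
  rw [Set.mem_insert_iff, Set.mem_singleton_iff, not_or] at hs1
  refine ⟨s, ?_, hs1⟩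
  have h : (⟨s, hs⟩ : P) ^ Nat.card P = 1 := pow_card_eq_one'
  rw [hP] at h
  rw [← map_pow, ← map_one f]
  exact congrArg (fun p : P => f p) h

variable {a b : ℚ}

theorem not_twelve_dvd_card (ha : a < 0) (hb : b < 0)
    (h23 : ∀ x : ℍ[ℚ_[23],(a : ℚ_[23]),(b : ℚ_[23])], x ≠ 0 → IsUnit x) {S : Type*} [Group S]
    [Finite S] {f : S →* ℍ[ℚ,a,b]} (hf : Function.Injective f) : ¬ 12 ∣ Nat.card S := by
  intro h12
  have : NoZeroDivisors ℍ[ℚ,a,b] := ⟨fun {x y} hxy => or_iff_not_imp_left.2 fun hx =>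
    (isUnit_of_ne_zero_of_neg ha hb hx).mul_right_eq_zero.1 hxy⟩
  have := Fact.mk Nat.prime_three
  obtain ⟨w, hw⟩ := exists_prime_orderOf_dvd_card' (G := S) 3 (dvd_trans (by norm_num) h12)
  obtain ⟨v, hv4, hv1, hv1'⟩ := exists_pow_four_eq_one hf (dvd_trans (by norm_num) h12)
  have hw3 : f w ^ 3 = 1 := by rw [← map_pow, ← hw, pow_orderOf_eq_one, map_one]
  have hw1 : f w ≠ 1 := fun h => by
    rw [hf (h.trans (map_one f).symm), orderOf_one] at hw
    norm_num at hw
  have hint : IsIntegral ℤ (f v * f w) := by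
    refine IsIntegral.of_pow (Nat.card_pos (α := S)) ?_
    rw [← map_mul, ← map_pow, pow_card_eq_one', map_one]
    exact isIntegral_one
  exact not_exists_order_three_four ha hb h23 (mul_self_eq_neg_one hv4 hv1 hv1')
    (mul_self_add_self_add_one_eq_zero hw3 hw1) hint

variable {R : Subring ℍ[ℚ,a,b]} {ι : ℍ[ℚ,a,b] →ₐ[ℚ] M2}

theorem exists_injective_Gam_quaternion (ha : a < 0) (hb : b < 0) :
    ∃ f : Gam R ι →* ℍ[ℚ,a,b], Function.Injective f := by
  have hι : Function.Injective ι := (injective_iff_map_eq_zero ι).2 fun x hx => by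
    by_contra hne
    exact not_isUnit_zero (hx ▸ (isUnit_of_ne_zero_of_neg ha hb hne).map ι)
  have hinj : Function.Injective (Units.map
      ((ι : ℍ[ℚ,a,b] →* M2).comp ((invertTwo R).subtype : invertTwo R →* ℍ[ℚ,a,b]))) :=
    Units.map_injective (hι.comp Subtype.val_injective)
  let e := MonoidHom.ofInjective hinj
  exact ⟨(((invertTwo R).subtype : invertTwo R →* ℍ[ℚ,a,b]).comp (Units.coeHom _)).comp
    e.symm.toMonoidHom,
    (Subtype.val_injective.comp Units.val_injective).comp e.symm.injective⟩

theorem not_twelve_dvd_card_stabilizer (ha : a < 0) (hb : b < 0)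
    (h23 : ∀ x : ℍ[ℚ_[23],(a : ℚ_[23]),(b : ℚ_[23])], x ≠ 0 → IsUnit x) (y : GL2 ⧸ K2)
    [Finite (MulAction.stabilizer (Gam R ι) y)] :
    ¬ 12 ∣ Nat.card (MulAction.stabilizer (Gam R ι) y) := by
  obtain ⟨f, hf⟩ := exists_injective_Gam_quaternion (R := R) (ι := ι) ha hb
  exact not_twelve_dvd_card ha hb h23 (f := f.comp (MulAction.stabilizer (Gam R ι) y).subtype)
    (hf.comp Subtype.val_injective)

theorem two_dvd_card_stabilizer (y : GL2 ⧸ K2) :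
    2 ∣ Nat.card (MulAction.stabilizer (Gam R ι) y) := by
  obtain ⟨x, rfl⟩ := QuotientGroup.mk_surjective y
  have hΓ : (-1 : GL2) ∈ Gam R ι := mem_Gam_iff.2 ⟨-1, by simp⟩
  have hK : (-1 : GL2) ∈ K2 := mem_K2_iff.2
    ⟨fun i j => by simpa using (mem_K2_iff.1 K2.one_mem).1 i j, by simp [Matrix.det_neg]⟩
  have hx : (⟨-1, hΓ⟩ : Gam R ι) ∈ MulAction.stabilizer (Gam R ι) (x : GL2 ⧸ K2) :=
    QuotientGroup.eq.2 (by simpa using hK)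
  have h1 : (-1 : GL2) ≠ 1 := fun h => by
    have h00 := congrArg (fun g : GL2 => (g : M2) 0 0) h
    norm_num at h00
  have hord : orderOf (⟨⟨-1, hΓ⟩, hx⟩ : MulAction.stabilizer (Gam R ι) (x : GL2 ⧸ K2)) = 2 :=
    orderOf_eq_prime (Subtype.ext (Subtype.ext (by simp))) fun h =>
      h1 (congrArg (fun z : MulAction.stabilizer (Gam R ι) (x : GL2 ⧸ K2) =>
        ((z : Gam R ι) : GL2)) h)
  exact (dvd_of_eq hord.symm).trans (orderOf_dvd_natCard _)

end StabilizerOrder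

/-! ### The quotient graph is not bipartite -/

section Neighbours

/-- The double coset `K diag(1, 2) K`, that is, the integral matrices whose determinant has
valuation one. The vertices `y` with `x⁻¹ * y` in this set are the neighbours of `x` in the tree
of `PGL₂(ℚ₂)`, with their scaling. -/
def heckeDoubleCoset : Set GL2 := {h | ‖(h : M2)‖ ≤ 1 ∧ ‖(h : M2).det‖ = 2⁻¹}

theorem mem_heckeDoubleCoset_iff {h : GL2} :
    h ∈ heckeDoubleCoset ↔ ∃ i, (h : GL2 ⧸ K2) = heckeRep i := by
  constructor
  · rintro ⟨h1, hdet⟩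
    obtain ⟨i, k, hk, rfl⟩ := exists_eq_heckeRep_mul h1 hdet
    exact ⟨i, QuotientGroup.mk_mul_of_mem _ hk⟩
  · rintro ⟨i, hi⟩
    have hk := QuotientGroup.eq.1 hi.symm
    rw [← mul_inv_cancel_left (heckeRep i) h]
    refine ⟨?_, ?_⟩
    · rw [Units.val_mul, norm_mul_K2 hk, norm_heckeRep]
    · rw [Units.val_mul, Matrix.det_mul, norm_mul, norm_det_of_mem_K2 hk, det_heckeRep,
        norm_two_padic, mul_one]

theorem scalar_two_mul_inv_mem_heckeDoubleCoset {h : GL2} (hh : h ∈ heckeDoubleCoset) :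
    Matrix.GeneralLinearGroup.scalar (Fin 2) twoUnit * h⁻¹ ∈ heckeDoubleCoset := by
  obtain ⟨h1, hdet⟩ := hh
  have e : ((Matrix.GeneralLinearGroup.scalar (Fin 2) twoUnit * h⁻¹ : GL2) : M2)
      = (2 * (h : M2).det⁻¹) • (h : M2).adjugate := by
    rw [Units.val_mul, Matrix.coe_units_inv, Matrix.inv_def, Ring.inverse_eq_inv, mul_smul]
    exact (Matrix.smul_eq_diagonal_mul _ _).symm
  have hc : ‖2 * (h : M2).det⁻¹‖ = 1 := by
    rw [norm_mul, norm_inv, hdet, norm_two_padic]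
    norm_num
  refine ⟨?_, ?_⟩
  · rw [e, norm_smul, hc, one_mul, ← mem_integralM2_iff, Matrix.adjugate_fin_two]
    have h2 := mem_integralM2_iff.2 h1
    intro i j
    fin_cases i <;> fin_cases j <;> simp [h2 0 0, h2 0 1, h2 1 0, h2 1 1]
  · rw [e, Matrix.det_smul, Matrix.det_adjugate, norm_mul, norm_pow, hc, one_pow, one_mul]
    simpa using hdet

end Neighbours

section EdgeCount

variable {a b : ℚ} (R : Subring ℍ[ℚ,a,b]) (ι : ℍ[ℚ,a,b] →ₐ[ℚ] M2)

/-- The number of neighbours of `x` lying in the class `z` of `𝐘`. -/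
def edgeCount (x : GL2) (z : SetY R ι) : ℕ :=
  Nat.card {i : Fin 3 // DoubleCoset.mk (Gam R ι) K2 (x * heckeRep i) = z}

/-- The elements of `Γ` moving `y` to a neighbour of `x`. -/
abbrev transporter (x y : GL2) : Type := {γ : Gam R ι // x⁻¹ * γ * y ∈ heckeDoubleCoset}

variable {R ι}

theorem exists_of_edgeCount_ne_zero {x : GL2} {z : SetY R ι} (h : edgeCount R ι x z ≠ 0) :
    ∃ i, DoubleCoset.mk (Gam R ι) K2 (x * heckeRep i) = z :=
  let ⟨i⟩ := (Nat.card_ne_zero.1 h).1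
  ⟨i, i.2⟩

theorem sum_edgeCount [Fintype (SetY R ι)] (x : GL2) : ∑ z, edgeCount R ι x z = 3 := by
  simp only [edgeCount]
  rw [← Nat.card_sigma, Nat.card_congr (Equiv.sigmaFiberEquiv _), Nat.card_fin]

theorem card_transporter (x y : GL2) :
    Nat.card (transporter R ι x y) = edgeCount R ι x (DoubleCoset.mk (Gam R ι) K2 y)
      * Nat.card (MulAction.stabilizer (Gam R ι) (y : GL2 ⧸ K2)) := by
  let I : Type := {i : Fin 3 // DoubleCoset.mk (Gam R ι) K2 (x * heckeRep i) = DoubleCoset.mk _ _ y}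
  let F (i : I) : Type :=
    {γ : Gam R ι // γ • (y : GL2 ⧸ K2) = ((x * heckeRep i : GL2) : GL2 ⧸ K2)}
  have hmem (γ : Gam R ι) (i : Fin 3) : γ • (y : GL2 ⧸ K2) = ((x * heckeRep i : GL2) : GL2 ⧸ K2) ↔
      ((x⁻¹ * γ * y : GL2) : GL2 ⧸ K2) = heckeRep i := by
    rw [QuotientGroup.eq]
    refine (QuotientGroup.eq (s := K2)).trans ?_
    simp only [smul_eq_mul, mul_inv_rev, inv_inv, mul_assoc, Subgroup.coe_subtype]
  have e (i : I) : F i ≃ MulAction.stabilizer (Gam R ι) (y : GL2 ⧸ K2) :=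
    (nonempty_setOf_smul_eq_equiv_stabilizer
      (doubleCosetMk_eq_iff_exists_smul.1 i.2.symm)).some
  let p (q : Σ i, F i) : transporter R ι x y :=
    ⟨q.2.1, mem_heckeDoubleCoset_iff.2 ⟨q.1, (hmem _ _).1 q.2.2⟩⟩
  have hp : p.Bijective := by
    constructor
    · rintro ⟨⟨i, hi⟩, ⟨γ, hγ⟩⟩ ⟨⟨j, hj⟩, ⟨δ, hδ⟩⟩ h
      obtain rfl : γ = δ := congrArg Subtype.val h
      obtain rfl : i = j := eq_of_inv_heckeRep_mul_mem_K2
        (QuotientGroup.eq.1 (((hmem _ _).1 hγ).symm.trans ((hmem _ _).1 hδ)))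
      rfl
    · rintro ⟨γ, hγ⟩
      obtain ⟨i, hi⟩ := mem_heckeDoubleCoset_iff.1 hγ
      have hi' := (hmem γ i).2 hi
      exact ⟨⟨⟨i, (doubleCosetMk_eq_iff_exists_smul.2 ⟨γ, hi'⟩).symm⟩, ⟨γ, hi'⟩⟩, rfl⟩
  rw [← Nat.card_congr (Equiv.ofBijective p hp), Nat.card_congr (Equiv.sigmaEquivProdOfEquiv e),
    Nat.card_prod]
  rfl

theorem card_transporter_symm (x y : GL2) :
    Nat.card (transporter R ι x y) = Nat.card (transporter R ι y x) := by
  let s : Gam R ι := ⟨_, scalar_two_mem_Gam R ι⟩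
  have hs (g : GL2) : (s : GL2) * g = g * s := by
    have h : (s : GL2) ∈ Subgroup.center GL2 :=
      Matrix.GeneralLinearGroup.center_eq_range_scalar.ge ⟨twoUnit, rfl⟩
    exact (Subgroup.mem_center_iff.1 h g).symm
  have hmem {x y : GL2} (γ : Gam R ι) (hγ : x⁻¹ * γ * y ∈ heckeDoubleCoset) :
      y⁻¹ * (s * γ⁻¹ : Gam R ι) * x ∈ heckeDoubleCoset := by
    convert scalar_two_mul_inv_mem_heckeDoubleCoset hγ using 1
    change y⁻¹ * (s * (γ : GL2)⁻¹) * x = s * _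
    rw [← mul_assoc y⁻¹, ← hs]
    group
  have hinv (γ : Gam R ι) : s * (s * γ⁻¹)⁻¹ = γ := by
    rw [mul_inv_rev, inv_inv]
    exact Subtype.ext ((hs _).trans (inv_mul_cancel_right _ _))
  exact Nat.card_congr ⟨fun γ => ⟨s * γ.1⁻¹, hmem _ γ.2⟩, fun γ => ⟨s * γ.1⁻¹, hmem _ γ.2⟩,
    fun γ => Subtype.ext (hinv γ), fun γ => Subtype.ext (hinv γ)⟩

theorem edgeCount_mul_card_stabilizer (x y : GL2) :
    edgeCount R ι x (DoubleCoset.mk (Gam R ι) K2 y)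
        * Nat.card (MulAction.stabilizer (Gam R ι) (y : GL2 ⧸ K2))
      = edgeCount R ι y (DoubleCoset.mk (Gam R ι) K2 x)
        * Nat.card (MulAction.stabilizer (Gam R ι) (x : GL2 ⧸ K2)) := by
  rw [← card_transporter, ← card_transporter, card_transporter_symm]

end EdgeCount

section Bipartite

theorem not_weights_of_star {p q w₀ w₁ w₂ : ℕ} (h₀ : 0 < w₀) (hpq : p + q = 3)
    (hp : p * w₁ = 3 * w₀) (hq : q * w₂ = 3 * w₀) (h2₁ : 2 ∣ w₁) (h2₂ : 2 ∣ w₂)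
    (h12₁ : ¬ 12 ∣ w₁) (h12₂ : ¬ 12 ∣ w₂) : False := by
  obtain rfl : q = 3 - p := by omega
  have hp3 : p ≤ 3 := by omega
  interval_cases p <;> omega

theorem exists_univ_eq_of_card_eq_three {V : Type*} [Fintype V]
    (hV : Fintype.card V = 3) (σ : V → Bool) :
    ∃ i j k, σ j = σ k ∧ ∀ f : V → ℕ, ∑ l, f l = f i + (f j + f k) := by
  classical
  obtain ⟨j, k, hjk, hσ⟩ :=
    Fintype.exists_ne_map_eq_of_card_lt σ (by rw [hV, Fintype.card_bool]; omega)
  obtain ⟨i, hi⟩ := Finset.card_eq_one.1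
    (by rw [Finset.card_compl, Finset.card_pair hjk, hV] : ({j, k} : Finset V)ᶜ.card = 1)
  refine ⟨i, j, k, hσ, fun f => ?_⟩
  rw [← Finset.sum_compl_add_sum {j, k} f, hi, Finset.sum_singleton, Finset.sum_pair hjk]

theorem exists_edge_same_color {V : Type*} [Fintype V]
    (hV : Fintype.card V = 3) {N : V → V → ℕ} {w : V → ℕ} (hN : ∀ i, ∑ j, N i j = 3)
    (hNw : ∀ i j, N i j * w j = N j i * w i) (hw : ∀ i, 0 < w i) (h2 : ∀ i, 2 ∣ w i)
    (h12 : ∀ i, ¬ 12 ∣ w i) (σ : V → Bool) : ∃ i j, N i j ≠ 0 ∧ σ i = σ j := by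
  by_contra! h
  have h0 {i j} (hij : σ i = σ j) : N i j = 0 := by_contra fun hne => h i j hne hij
  obtain ⟨i, j, k, hjk, hsum⟩ := exists_univ_eq_of_card_eq_three hV σ
  have hi := hN i
  have hj := hN j
  have hk := hN k
  rw [hsum, h0 rfl, zero_add] at hi
  rw [hsum, h0 rfl, h0 hjk, add_zero, add_zero] at hj
  rw [hsum, h0 rfl, h0 hjk.symm, add_zero, add_zero] at hk
  exact not_weights_of_star (hw i) hi ((hNw i j).trans (by rw [hj])) ((hNw i k).trans (by rw [hk]))
    (h2 j) (h2 k) (h12 j) (h12 k)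

variable {a b : ℚ} {R : Subring ℍ[ℚ,a,b]} {ι : ℍ[ℚ,a,b] →ₐ[ℚ] M2} {μ : Measure GL2}
  [μ.IsHaarMeasure] {D : Set GL2}

theorem FunY.exists_mul_heckeRep_ne_neg (hD : IsFundamentalDomain (Gam R ι) D μ) (ha : a < 0)
    (hb : b < 0) (h23 : ∀ x : ℍ[ℚ_[23],(a : ℚ_[23]),(b : ℚ_[23])], x ≠ 0 → IsUnit x)
    (hcard : Nat.card (SetY R ι) = 3) {φ : FunY R ι} (hφ : ∀ x, φ.toFun x ≠ 0) :
    ∃ x i, φ.toFun (x * heckeRep i) ≠ -φ.toFun x := by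
  classical
  have : Finite (SetY R ι) := Nat.finite_of_card_ne_zero (by omega)
  let _ : Fintype (SetY R ι) := Fintype.ofFinite _
  have : Countable (Gam R ι) := countable_Gam
  have hfin := finite_stabilizer_quotient isOpen_K2 isCompact_K2 hD
  let rep (z : SetY R ι) : GL2 := Quotient.out z
  have hrep (z : SetY R ι) : DoubleCoset.mk (Gam R ι) K2 (rep z) = z := Quotient.out_eq z
  let w (z : SetY R ι) : ℕ := Nat.card (MulAction.stabilizer (Gam R ι) (rep z : GL2 ⧸ K2))
  obtain ⟨z, z', hzz', hσ⟩ := exists_edge_same_color (w := w)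
    (by rw [← Nat.card_eq_fintype_card, hcard]) (fun z => sum_edgeCount (rep z))
    (fun z z' => by simpa only [hrep] using
      edgeCount_mul_card_stabilizer (R := R) (ι := ι) (rep z) (rep z'))
    (fun z => Nat.card_pos) (fun z => two_dvd_card_stabilizer _)
    (fun z => not_twelve_dvd_card_stabilizer ha hb h23 _)
    (fun z => decide (0 < φ.toFun (rep z)))
  obtain ⟨i, hi⟩ := exists_of_edgeCount_ne_zero hzz'
  refine ⟨rep z, i, fun h => ?_⟩
  rw [φ.eq_of_mk_eq (hi.trans (hrep z').symm)] at h
  rw [decide_eq_decide, h, neg_pos] at hσ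
  rcases lt_or_gt_of_ne (hφ (rep z)) with hneg | hpos
  · exact hneg.asymm (hσ.2 hneg)
  · exact hpos.asymm (hσ.1 hpos)

end Bipartite

/-! ### The Hecke eigenvalue at two -/

section Eigenvalue

theorem eq_of_sum_eq_card_mul {κ : Type*} [Fintype κ] {u : κ → ℝ} {c : ℝ}
    (hu : ∀ i, |u i| ≤ |c|) (h : ∑ i, u i = Fintype.card κ * c) (i : κ) : u i = c := by
  wlog hc : 0 ≤ c generalizing u c
  · refine neg_inj.1 (this (u := fun j => -u j) (c := -c) (fun j => ?_) ?_ (by linarith))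
    · rw [abs_neg, abs_neg]
      exact hu j
    · rw [Finset.sum_neg_distrib, h, mul_neg]
  have hle (j : κ) : u j ≤ c := (le_abs_self _).trans ((hu j).trans_eq (abs_of_nonneg hc))
  refine (Finset.sum_eq_sum_iff_of_le fun j _ => hle j).1 ?_ i (Finset.mem_univ i)
  rw [h, Finset.sum_const, Finset.card_univ, nsmul_eq_mul]

variable {a b : ℚ} {R : Subring ℍ[ℚ,a,b]} {ι : ℍ[ℚ,a,b] →ₐ[ℚ] M2}

theorem FunY.exists_forall_abs_le [Finite (SetY R ι)] (φ : FunY R ι) :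
    ∃ x₀, ∀ x, |φ.toFun x| ≤ |φ.toFun x₀| := by
  have : Nonempty (SetY R ι) := ⟨DoubleCoset.mk _ _ 1⟩
  obtain ⟨y, hy⟩ := Finite.exists_max fun y : SetY R ι => |φ.descend y|
  exact ⟨Quotient.out y, fun x => φ.descend_mk x ▸ hy (DoubleCoset.mk _ _ x)⟩

theorem diagTwoPow_succ (n : ℕ) : diagTwoPow (n + 1) = diagTwoPow n * heckeRep 2 := by
  ext1
  simp [coe_diagTwoPow, coe_heckeRep, pow_succ]

/-- The maximum principle: a mean of numbers of size at most `|c|` equals `±c` only if all of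
them do, so an extremal value propagates along the tree. -/
theorem FunY.eq_pow_mul_of_sum_mul_heckeRep {φ : FunY R ι} {x₀ : GL2} {ε : ℝ} (hε : |ε| = 1)
    (hmax : ∀ x, |φ.toFun x| ≤ |φ.toFun x₀|)
    (hs : ∀ x, ∑ i, φ.toFun (x * heckeRep i) = 3 * (ε * φ.toFun x)) {n : ℕ} {g : GL2}
    (hg : cartanSize g = 2 ^ n) : φ.toFun (x₀ * g) = ε ^ n * φ.toFun x₀ := by
  obtain ⟨z, hz, k₁, hk₁, k₂, hk₂, rfl⟩ := exists_eq_of_cartanSize_eq hg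
  rw [← mul_assoc, φ.right_inv k₂ hk₂, mul_assoc z, ← Subgroup.mem_center_iff.1 hz, ← mul_assoc,
    φ.mul_center z hz]
  clear hg
  induction n with
  | zero => rw [diagTwoPow_zero, mul_one, φ.right_inv k₁ hk₁, pow_zero, one_mul]
  | succ n ih =>
    have h := hs (x₀ * (k₁ * diagTwoPow n))
    rw [ih, ← mul_assoc ε, ← pow_succ'] at h
    rw [diagTwoPow_succ, ← mul_assoc, ← mul_assoc, mul_assoc x₀]
    refine eq_of_sum_eq_card_mul (u := fun i => φ.toFun (x₀ * (k₁ * diagTwoPow n) * heckeRep i))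
      (fun i => ?_) (by rw [h, Fintype.card_fin, Nat.cast_ofNat]) 2
    rw [abs_mul, abs_pow, hε, one_pow, one_mul]
    exact hmax _

variable {μ : Measure GL2} {D : Set GL2} {Ψ : Fin 2 → FunY R ι} {lam : Fin 2 → ℕ → ℝ}

theorem exists_ne_zero_forall_abs_le (hΨ : IsHeckeBasis μ D Ψ lam) (k : Fin 2) :
    ∃ x₀, (Ψ k).toFun x₀ ≠ 0 ∧ ∀ x, |(Ψ k).toFun x| ≤ |(Ψ k).toFun x₀| := by
  have := finite_SetY hΨ
  obtain ⟨x₀, hmax⟩ := (Ψ k).exists_forall_abs_le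
  refine ⟨x₀, fun h0 => ?_, hmax⟩
  have h (x : GL2) : (Ψ k).toFun x = 0 := by simpa [h0] using hmax x
  simpa [innerX, h] using hΨ.orthonormal k k

theorem abs_eigenvalue_le_three (hΨ : IsHeckeBasis μ D Ψ lam) (hR : IsOrder R) (k : Fin 2) :
    |√2 * lam k 2| ≤ 3 := by
  obtain ⟨x₀, h0, hmax⟩ := exists_ne_zero_forall_abs_le hΨ k
  refine le_of_mul_le_mul_right ?_ (abs_pos.2 h0)
  calc |√2 * lam k 2| * |(Ψ k).toFun x₀| = |∑ i, (Ψ k).toFun (x₀ * heckeRep i)| := by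
        rw [sum_mul_heckeRep_eigen hΨ hR, abs_mul _ ((Ψ k).toFun x₀)]
    _ ≤ ∑ i, |(Ψ k).toFun (x₀ * heckeRep i)| := Finset.abs_sum_le_sum_abs _ _
    _ ≤ ∑ _i : Fin 3, |(Ψ k).toFun x₀| := Finset.sum_le_sum fun i _ => hmax _
    _ = 3 * |(Ψ k).toFun x₀| := by simp

theorem eigenvalue_ne_three (hΨ : IsHeckeBasis μ D Ψ lam) (hR : IsOrder R) (k : Fin 2) :
    √2 * lam k 2 ≠ 3 := by
  intro h3
  obtain ⟨x₀, -, hmax⟩ := exists_ne_zero_forall_abs_le hΨ k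
  have hconst (x : GL2) : (Ψ k).toFun x = (Ψ k).toFun x₀ := by
    obtain ⟨n, hn⟩ := exists_cartanSize_eq (x₀⁻¹ * x)
    simpa using FunY.eq_pow_mul_of_sum_mul_heckeRep (ε := 1) abs_one hmax
      (fun x => by rw [sum_mul_heckeRep_eigen hΨ hR, h3, one_mul]) hn
  have h0 := hΨ.mean_zero k
  have h1 := hΨ.orthonormal k k
  rw [if_pos rfl] at h1
  simp only [innerX, hconst, mul_one] at h0 h1
  rw [integral_const_mul, h0, mul_zero] at h1
  exact zero_ne_one h1

theorem eigenvalue_ne_neg_three [μ.IsHaarMeasure] (hΨ : IsHeckeBasis μ D Ψ lam) (hR : IsOrder R)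
    (hD : IsFundamentalDomain (Gam R ι) D μ) (ha : a < 0) (hb : b < 0)
    (h23 : ∀ x : ℍ[ℚ_[23],(a : ℚ_[23]),(b : ℚ_[23])], x ≠ 0 → IsUnit x) (k : Fin 2) :
    √2 * lam k 2 ≠ -3 := by
  intro h3
  obtain ⟨x₀, h0, hmax⟩ := exists_ne_zero_forall_abs_le hΨ k
  have hs (x : GL2) : ∑ i, (Ψ k).toFun (x * heckeRep i) = 3 * (-1 * (Ψ k).toFun x) := by
    rw [sum_mul_heckeRep_eigen hΨ hR, h3, neg_one_mul, neg_mul, mul_neg]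
  have habs (x : GL2) : |(Ψ k).toFun x| = |(Ψ k).toFun x₀| := by
    obtain ⟨n, hn⟩ := exists_cartanSize_eq (x₀⁻¹ * x)
    have h := FunY.eq_pow_mul_of_sum_mul_heckeRep (by rw [abs_neg, abs_one]) hmax hs hn
    rw [mul_inv_cancel_left] at h
    rw [h, abs_mul, abs_neg_one_pow, one_mul]
  obtain ⟨x, i, hne⟩ := (Ψ k).exists_mul_heckeRep_ne_neg hD ha hb h23 (card_SetY hΨ hD)
    fun x => abs_pos.1 (habs x ▸ abs_pos.2 h0)
  refine hne (eq_of_sum_eq_card_mul (u := fun i => (Ψ k).toFun (x * heckeRep i)) (fun j => ?_) ?_ i)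
  · rw [abs_neg, habs, habs x]
  · rw [hs, Fintype.card_fin, neg_one_mul, Nat.cast_ofNat]

theorem abs_eigenvalue_lt_three [μ.IsHaarMeasure] (hΨ : IsHeckeBasis μ D Ψ lam) (hR : IsOrder R)
    (hD : IsFundamentalDomain (Gam R ι) D μ) (ha : a < 0) (hb : b < 0)
    (h23 : ∀ x : ℍ[ℚ_[23],(a : ℚ_[23]),(b : ℚ_[23])], x ≠ 0 → IsUnit x) (k : Fin 2) :
    |√2 * lam k 2| < 3 :=
  (abs_eigenvalue_le_three hΨ hR k).lt_of_ne fun h => ((abs_eq three_pos.le).1 h).elim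
    (eigenvalue_ne_three hΨ hR k) (eigenvalue_ne_neg_three hΨ hR hD ha hb h23 k)

end Eigenvalue

/-! ### A linear recurrence -/

theorem summable_of_le_mul_add {f g : ℕ → ℝ} {r : ℝ} (hf : ∀ n, 0 ≤ f n) (hg : ∀ n, 0 ≤ g n)
    (hgs : Summable g) (hr : 0 ≤ r) (hr1 : r < 1) (h : ∀ n, f (n + 1) ≤ r * f n + g n) :
    Summable f := by
  have h1 : 0 < 1 - r := sub_pos.2 hr1
  refine summable_of_sum_range_le (c := (f 0 + ∑' n, g n) / (1 - r)) hf fun n => ?_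
  induction n with
  | zero =>
    rw [Finset.sum_range_zero]
    exact div_nonneg (add_nonneg (hf 0) (tsum_nonneg hg)) h1.le
  | succ n ih =>
    rw [Finset.sum_range_succ']
    have h2 : ∑ i ∈ Finset.range n, f (i + 1)
        ≤ r * ∑ i ∈ Finset.range n, f i + ∑ i ∈ Finset.range n, g i := by
      rw [Finset.mul_sum, ← Finset.sum_add_distrib]
      exact Finset.sum_le_sum fun i _ => h i
    have h3 : ∑ i ∈ Finset.range n, g i ≤ ∑' n, g n := hgs.sum_le_tsum _ fun i _ => hg i
    have h4 := mul_le_mul_of_nonneg_left ih hr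
    have h5 : r * ((f 0 + ∑' n, g n) / (1 - r)) + (f 0 + ∑' n, g n)
        = (f 0 + ∑' n, g n) / (1 - r) := by
      field_simp
      ring
    linarith

theorem norm_lt_one_of_sq_sub_mul_add_half_eq_zero {s : ℝ} (hs : |s| < 3) {r : ℂ}
    (hr : r ^ 2 - s / 2 * r + 1 / 2 = 0) : ‖r‖ < 1 := by
  have hre : r.re * r.re - r.im * r.im - s / 2 * r.re + 1 / 2 = 0 := by
    simpa [pow_two] using congrArg Complex.re hr
  have him : r.im * (2 * r.re - s / 2) = 0 := by
    have h : r.re * r.im + r.im * r.re - s / 2 * r.im = 0 := by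
      simpa [pow_two] using congrArg Complex.im hr
    linarith
  rw [← sq_lt_one_iff₀ (norm_nonneg r), ← Complex.normSq_eq_norm_sq, Complex.normSq_apply]
  rcases mul_eq_zero.1 him with h | h
  · rw [h] at hre ⊢
    have hsr : s * r.re ≤ |s| * |r.re| := (le_abs_self _).trans_eq (abs_mul _ _)
    rw [← abs_mul_abs_self] at hre ⊢
    nlinarith [abs_nonneg r.re, abs_nonneg s, mul_le_mul_of_nonneg_right hs.le (abs_nonneg r.re)]
  · obtain rfl : s = 4 * r.re := by linarith
    nlinarith

theorem summable_of_recurrence {s : ℝ} (hs : |s| < 3) {ξ : ℕ → ℝ}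
    (h : ∀ n, ξ n + 2 * ξ (n + 2) = s * ξ (n + 1)) : Summable fun n => |ξ n| := by
  obtain ⟨d, hd⟩ := IsAlgClosed.exists_pow_nat_eq ((s / 2 : ℂ) ^ 2 - 2) two_pos
  set r₁ : ℂ := (s / 2 + d) / 2 with hr₁
  set r₂ : ℂ := (s / 2 - d) / 2 with hr₂
  have h₁ : ‖r₁‖ < 1 := norm_lt_one_of_sq_sub_mul_add_half_eq_zero hs (by
    rw [hr₁]
    linear_combination hd / 4)
  have h₂ : ‖r₂‖ < 1 := norm_lt_one_of_sq_sub_mul_add_half_eq_zero hs (by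
    rw [hr₂]
    linear_combination hd / 4)
  have hrec : ∀ n, (ξ (n + 2) : ℂ) - r₁ * ξ (n + 1) = r₂ * (ξ (n + 1) - r₁ * ξ n) := by
    intro n
    have hn : (ξ n : ℂ) + 2 * ξ (n + 2) = s * ξ (n + 1) := by exact_mod_cast h n
    rw [hr₁, hr₂]
    linear_combination hn / 2 - (ξ n : ℂ) * hd / 4
  have hc : ∀ n, (ξ (n + 1) : ℂ) - r₁ * ξ n = r₂ ^ n * (ξ 1 - r₁ * ξ 0) := by
    intro n
    induction n with
    | zero => simp
    | succ n ih => rw [hrec, ih, pow_succ', mul_assoc]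
  refine summable_of_le_mul_add (g := fun n => ‖r₂‖ ^ n * ‖(ξ 1 : ℂ) - r₁ * ξ 0‖) (r := ‖r₁‖)
    (fun n => abs_nonneg _) (fun n => by positivity)
    ((summable_geometric_of_lt_one (norm_nonneg _) h₂).mul_right _) (norm_nonneg _) h₁ fun n => ?_
  have e : (ξ (n + 1) : ℂ) = r₁ * ξ n + r₂ ^ n * (ξ 1 - r₁ * ξ 0) := by
    rw [← hc]
    ring
  have h3 := norm_add_le (r₁ * (ξ n : ℂ)) (r₂ ^ n * (ξ 1 - r₁ * ξ 0))
  rw [← e, norm_mul, norm_mul, norm_pow, Complex.norm_real, Complex.norm_real] at h3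
  exact h3

theorem hasSum_of_recurrence {s : ℝ} (hs : |s| < 3) {ξ : ℕ → ℝ}
    (h : ∀ n, ξ n + 2 * ξ (n + 2) = s * ξ (n + 1)) (h0 : ξ 0 = 1) (h1 : 3 * ξ 1 = s) :
    HasSum (fun n => ξ (n + 1)) ((2 * s - 3) / (3 * (3 - s))) := by
  have hsum : Summable ξ := (summable_of_recurrence hs h).of_abs
  have hsum1 : Summable fun n => ξ (n + 1) := (summable_nat_add_iff 1).2 hsum
  have hsum2 : Summable fun n => ξ (n + 2) := (summable_nat_add_iff 2).2 hsum
  have e0 : ∑' n, ξ n = ξ 0 + ∑' n, ξ (n + 1) := hsum.tsum_eq_zero_add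
  have e1 : ∑' n, ξ (n + 1) = ξ 1 + ∑' n, ξ (n + 2) := hsum1.tsum_eq_zero_add
  have e2 : ∑' n, ξ n + 2 * ∑' n, ξ (n + 2) = s * ∑' n, ξ (n + 1) := by
    rw [← tsum_mul_left, ← tsum_mul_left, ← hsum.tsum_add (hsum2.mul_left 2)]
    exact tsum_congr h
  have hs3 : 3 - s ≠ 0 := by
    have := (abs_lt.1 hs).2
    linarith
  have : ∑' n, ξ (n + 1) = (2 * s - 3) / (3 * (3 - s)) := by
    rw [eq_div_iff (mul_ne_zero three_ne_zero hs3)]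
    linear_combination -3 * e0 + 6 * e1 + 3 * e2 - 3 * h0 + 2 * h1
  rw [← this]
  exact hsum1.hasSum

/-! ### Spheres in `PGL₂(ℚ₂)` -/

section Sphere

theorem cartanSize_inv (g : GL2) : cartanSize g⁻¹ = cartanSize g := by
  have h0 : ‖(g : M2).det‖ ≠ 0 := norm_ne_zero_iff.2 g.det.ne_zero
  have hadj : ‖(g : M2).adjugate‖ = ‖(g : M2)‖ := by
    generalize (g : M2) = A
    nth_rewrite 2 [Matrix.eta_fin_two A]
    rw [Matrix.adjugate_fin_two, norm_of_fin_two, norm_of_fin_two, norm_neg, norm_neg,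
      max_max_max_comm, max_comm (max _ _), max_comm ‖A 0 1‖, max_comm ‖A 1 1‖]
  rw [cartanSize, cartanSize, Matrix.coe_units_inv, Matrix.det_nonsing_inv, Matrix.inv_def,
    norm_smul, Ring.inverse_eq_inv, hadj, norm_inv]
  field_simp

/-- The image in `PGL₂(ℚ₂)` of the double cosets `K diag(1, 2ⁿ) K`: the sphere of radius `n` in
the tree, around the vertex fixed by `K`. -/
def sphere (n : ℕ) : Set PGL2 := (fun g : GL2 => (g : PGL2)) '' {g | cartanSize g = 2 ^ n}

theorem mk_mem_sphere_iff {n : ℕ} {g : GL2} : (g : PGL2) ∈ sphere n ↔ cartanSize g = 2 ^ n := by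
  refine ⟨?_, fun hg => ⟨g, hg, rfl⟩⟩
  rintro ⟨h, hh, e⟩
  have hz := QuotientGroup.eq.1 e
  rw [← mul_inv_cancel_left h g, Subgroup.mem_center_iff.1 hz, cartanSize_center_mul _ hz]
  exact hh

theorem isOpen_sphere (n : ℕ) : IsOpen (sphere n) := by
  refine QuotientGroup.isOpenMap_coe _ (isOpen_iff_mem_nhds.2 fun g hg => ?_)
  refine Filter.mem_of_superset ((isOpen_K2.preimage (continuous_const_mul g⁻¹)).mem_nhds
    (show g⁻¹ * g ∈ K2 from (inv_mul_cancel g).symm ▸ K2.one_mem)) fun h hh => ?_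
  rw [Set.mem_ofPred_eq, ← mul_inv_cancel_left g h, cartanSize_mul_K2 g hh]
  exact hg

theorem sphere_zero : sphere 0 = (PK2 : Set PGL2) := by
  ext x
  induction x using QuotientGroup.induction_on with
  | H g =>
    rw [mk_mem_sphere_iff]
    constructor
    · intro h
      obtain ⟨z, hz, k₁, hk₁, k₂, hk₂, rfl⟩ := exists_eq_of_cartanSize_eq h
      refine ⟨k₁ * k₂, K2.mul_mem hk₁ hk₂, QuotientGroup.eq.2 ?_⟩
      rw [diagTwoPow_zero, mul_one, mul_assoc, ← Subgroup.mem_center_iff.1 hz,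
        inv_mul_cancel_left]
      exact hz
    · rintro ⟨k, hk, e⟩
      refine mk_mem_sphere_iff.1 (e ▸ mk_mem_sphere_iff.2 ?_)
      simpa [diagTwoPow_zero] using cartanSize_mul_diagTwoPow_mul (one_mem _) hk (one_mem _) 0

theorem exists_mem_sphere (x : PGL2) : ∃ n, x ∈ sphere n := by
  induction x using QuotientGroup.induction_on with
  | H g => exact (exists_cartanSize_eq g).imp fun n => mk_mem_sphere_iff.2

theorem eq_of_mem_sphere {m n : ℕ} {x : PGL2} (hm : x ∈ sphere m) (hn : x ∈ sphere n) :
    m = n := by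
  induction x using QuotientGroup.induction_on with
  | H g =>
    have h := (mk_mem_sphere_iff.1 hm).symm.trans (mk_mem_sphere_iff.1 hn)
    exact pow_right_injective₀ two_pos (by norm_num) h

theorem pairwise_disjoint_sphere : Pairwise (Function.onFun Disjoint sphere) :=
  fun _ _ hmn => Set.disjoint_left.2 fun _ hm hn => hmn (eq_of_mem_sphere hm hn)

theorem indicator_sphere_apply {M : Type*} [Zero M] {m : ℕ} {x : PGL2} (hx : x ∈ sphere m) (n : ℕ)
    (f : PGL2 → M) : (sphere n).indicator f x = if m = n then f x else 0 := by
  classical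
  rw [Set.indicator_apply]
  exact if_congr ⟨eq_of_mem_sphere hx, fun h => h ▸ hx⟩ rfl rfl

/-- The number of neighbours at distance `n` from the root, for a vertex at distance `m`. -/
def neighbourCount : ℕ → ℕ → ENNReal
  | 0, n => 3 • if 1 = n then 1 else 0
  | m + 1, n => (if m = n then 1 else 0) + 2 • if m + 2 = n then 1 else 0

theorem sum_indicator_sphere {m : ℕ} {x : PGL2} (hx : x ∈ sphere m) (n : ℕ) :
    ∑ i, (sphere n).indicator (1 : PGL2 → ENNReal) ((heckeRep i : PGL2)⁻¹ * x)
      = neighbourCount m n := by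
  induction x using QuotientGroup.induction_on with
  | H g =>
    let u (h : GL2) : ENNReal := (sphere n).indicator 1 ((h⁻¹ : GL2) : PGL2)
    have hu (l : ℕ) (h : GL2) (hl : cartanSize h = 2 ^ l) : u h = if l = n then 1 else 0 :=
      indicator_sphere_apply (mk_mem_sphere_iff.2 (by rw [cartanSize_inv, hl])) n _
    have hg : cartanSize g⁻¹ = 2 ^ m := by rw [cartanSize_inv, mk_mem_sphere_iff.1 hx]
    have hsum : ∑ i, (sphere n).indicator 1 ((heckeRep i : PGL2)⁻¹ * (g : PGL2))
        = ∑ i, u (g⁻¹ * heckeRep i) := Finset.sum_congr rfl fun i _ => by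
      simp only [u, mul_inv_rev, inv_inv, QuotientGroup.mk_mul, QuotientGroup.mk_inv]
    rw [hsum]
    cases m with
    | zero => exact sum_mul_heckeRep_of_cartanSize_eq_one hu (by simpa using hg)
    | succ m => exact sum_mul_heckeRep_of_cartanSize_eq hu hg

variable {ρ : Measure PGL2} [ρ.IsHaarMeasure]

theorem lintegral_sum_indicator_sphere (n : ℕ) :
    ∫⁻ x, ∑ i, (sphere n).indicator 1 ((heckeRep i : PGL2)⁻¹ * x) ∂ρ = 3 * ρ (sphere n) := by
  have hm := (isOpen_sphere n).measurableSet
  rw [lintegral_finsetSum]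
  · simp only [lintegral_mul_left_eq_self (μ := ρ) (fun x => (sphere n).indicator 1 x),
      lintegral_indicator_one hm, Finset.sum_const, Finset.card_univ, Fintype.card_fin,
      nsmul_eq_mul, Nat.cast_ofNat]
  · exact fun i _ => (measurable_one.indicator hm).comp (measurable_const_mul _)

theorem three_mul_measure_sphere {n l : ℕ} {c : ENNReal}
    (h : ∀ m, neighbourCount m n = (if m = n + 1 then 1 else 0) + c * if m = l then 1 else 0) :
    3 * ρ (sphere n) = ρ (sphere (n + 1)) + c * ρ (sphere l) := by
  have hm (j : ℕ) := (isOpen_sphere j).measurableSet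
  rw [← lintegral_sum_indicator_sphere, ← lintegral_indicator_one (hm (n + 1)),
    ← lintegral_indicator_one (hm l), ← lintegral_const_mul _ (measurable_one.indicator (hm l)),
    ← lintegral_add_left (measurable_one.indicator (hm (n + 1)))]
  refine lintegral_congr fun x => ?_
  obtain ⟨m, hx⟩ := exists_mem_sphere x
  rw [sum_indicator_sphere hx, h, indicator_sphere_apply hx, indicator_sphere_apply hx,
    Pi.one_apply]

theorem measure_sphere_one : ρ (sphere 1) = 3 * ρ (sphere 0) := by
  rw [three_mul_measure_sphere (l := 0) (c := 0), zero_mul, add_zero]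
  rintro (_ | _ | m) <;> simp [neighbourCount]

theorem measure_sphere_succ (hρ : ρ (sphere 0) = 1) (n : ℕ) :
    ρ (sphere (n + 1)) = 3 * 2 ^ n := by
  have h1 : ρ (sphere 1) = 3 := by rw [measure_sphere_one, hρ, mul_one]
  induction n using Nat.twoStepInduction with
  | zero => rw [h1, pow_zero, mul_one]
  | one =>
    have h := three_mul_measure_sphere (ρ := ρ) (n := 1) (l := 0) (c := 3)
      (by rintro (_ | _ | _ | m) <;> simp [neighbourCount])
    rw [h1, hρ, show (3 * 3 : ENNReal) = 3 * 2 ^ 1 + 3 * 1 by norm_num] at h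
    exact ((ENNReal.add_left_inj (by norm_num)).1 h).symm
  | more n ih ih' =>
    have h := three_mul_measure_sphere (ρ := ρ) (n := n + 2) (l := n + 1) (c := 2)
      (by rintro (_ | m) <;> simp [neighbourCount])
    rw [ih, ih', show (3 * (3 * 2 ^ (n + 1)) : ENNReal) = 3 * 2 ^ (n + 2) + 2 * (3 * 2 ^ n) by ring]
      at h
    exact ((ENNReal.add_left_inj (by finiteness)).1 h).symm

end Sphere

section Radial

variable {X E : Type*} [MeasurableSpace X] {ρ : Measure X} [NormedAddCommGroup E] {S : ℕ → Set X}
  {f : X → E} {c : ℕ → E}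

theorem integrable_of_eq_const_of_iUnion_eq (hS : ∀ n, MeasurableSet (S n))
    (hS' : ⋃ n, S n = Set.univ) (hfin : ∀ n, ρ (S n) ≠ ⊤) (hf : ∀ n, ∀ x ∈ S n, f x = c n)
    (hc : Summable fun n => ρ.real (S n) * ‖c n‖) : Integrable f ρ := by
  rw [← integrableOn_univ, ← hS']
  refine integrableOn_iUnion_of_summable_integral_norm
    (fun n => (integrableOn_congr_fun (hf n) (hS n)).2 (integrableOn_const (hfin n))) ?_
  refine hc.congr fun n => ?_
  rw [setIntegral_congr_fun (hS n) fun x hx => congrArg norm (hf n x hx), setIntegral_const,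
    smul_eq_mul]

theorem hasSum_integral_of_eq_const [NormedSpace ℝ E] [CompleteSpace E]
    (hS : ∀ n, MeasurableSet (S n))
    (hS' : ⋃ n, S n = Set.univ) (hdisj : Pairwise (Function.onFun Disjoint S))
    (hf : ∀ n, ∀ x ∈ S n, f x = c n) (hint : Integrable f ρ) :
    HasSum (fun n => ρ.real (S n) • c n) (∫ x, f x ∂ρ) := by
  have h := hasSum_integral_iUnion hS hdisj hint.integrableOn
  rw [hS', setIntegral_univ] at h
  refine h.congr_fun fun n => ?_
  rw [setIntegral_congr_fun (hS n) (hf n), setIntegral_const]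

end Radial

/-! ### Reduction modulo `2` -/

/-- Reduction modulo `2` of a `2`-adic integer. Outside `ℤ₂` the value is `1`, which makes
`x ↦ (-1) ^ residue x` agree with `sgn2` on all of `ℚ₂`. -/
def residue (x : ℚ_[2]) : ZMod 2 := if ‖x‖ < 1 then 0 else 1

theorem residue_eq_zero_iff {x : ℚ_[2]} : residue x = 0 ↔ ‖x‖ < 1 := by
  simp [residue]

theorem residue_coe (z : ℤ_[2]) : residue z = PadicInt.toZMod z := by
  have h : ∀ x y : ZMod 2, (x = 0 ↔ y = 0) → x = y := by decide
  exact h _ _ (residue_eq_zero_iff.trans (norm_lt_one_iff_toZMod_eq_zero z))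

theorem residue_add {x y : ℚ_[2]} (hx : ‖x‖ ≤ 1) (hy : ‖y‖ ≤ 1) :
    residue (x + y) = residue x + residue y := by
  obtain ⟨x, rfl⟩ : ∃ z : ℤ_[2], (z : ℚ_[2]) = x := ⟨⟨x, hx⟩, rfl⟩
  obtain ⟨y, rfl⟩ : ∃ z : ℤ_[2], (z : ℚ_[2]) = y := ⟨⟨y, hy⟩, rfl⟩
  rw [← PadicInt.coe_add, residue_coe, residue_coe, residue_coe, map_add]

theorem residue_two_pow_mul (n : ℕ) {x : ℚ_[2]} (hx : ‖x‖ ≤ 1) :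
    residue (2 ^ n * x) = 0 ^ n * residue x := by
  obtain ⟨x, rfl⟩ : ∃ z : ℤ_[2], (z : ℚ_[2]) = x := ⟨⟨x, hx⟩, rfl⟩
  have h2 : (2 : ZMod 2) = 0 := rfl
  rw [← h2, ← map_ofNat PadicInt.toZMod 2, ← map_pow, residue_coe, ← map_mul, ← residue_coe]
  push_cast
  rfl

theorem residue_natCast (n : ℕ) : residue n = n := by
  rw [← PadicInt.coe_natCast, residue_coe, map_natCast]

theorem eventually_mem_iff_of_isClopen {X : Type*} [TopologicalSpace X] {U : Set X}
    (hU : IsClopen U) (x : X) : ∀ᶠ y in nhds x, (y ∈ U ↔ x ∈ U) := by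
  by_cases hx : x ∈ U
  · exact (hU.isOpen.eventually_mem hx).mono fun y hy => iff_of_true hy hx
  · exact (hU.compl.isOpen.eventually_mem hx).mono fun y hy => iff_of_false hy hx

theorem isLocallyConstant_residue : IsLocallyConstant residue :=
  (IsLocallyConstant.iff_eventually_eq _).2 fun x => by
    filter_upwards [eventually_mem_iff_of_isClopen
      (IsUltrametricDist.isClopen_ball (0 : ℚ_[2]) 1) x] with y hy
    simp only [mem_ball_zero_iff] at hy
    simp only [residue, hy]

/-! ### Integrals over `M₂(ℤ₂)` of functions of the reduction modulo `2` -/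

theorem isClopen_integralM2 : IsClopen integralM2 :=
  ⟨isCompact_integralM2.isClosed, isOpen_integralM2⟩

theorem add_mem_integralM2_iff {α β : M2} (hα : α ∈ integralM2) :
    β + α ∈ integralM2 ↔ β ∈ integralM2 := by
  have key : ∀ α ∈ integralM2, ∀ β ∈ integralM2, β + α ∈ integralM2 := fun α hα β hβ i j =>
    (Padic.nonarchimedean _ _).trans (max_le (hβ i j) (hα i j))
  refine ⟨fun h => ?_, key α hα β⟩
  simpa using key (-α) (fun i j => by simpa using hα i j) _ h

/-- The set of integral matrices with reduction `ε` modulo `2`. -/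
def residueClass (ε : Matrix (Fin 2) (Fin 2) (ZMod 2)) : Set M2 :=
  {β | β ∈ integralM2 ∧ β.map residue = ε}

theorem isOpen_residueClass (ε : Matrix (Fin 2) (Fin 2) (ZMod 2)) : IsOpen (residueClass ε) := by
  have h : residueClass ε =
      integralM2 ∩ ⋂ i, ⋂ j, (fun β : M2 => β i j) ⁻¹' (residue ⁻¹' {ε i j}) := by
    ext β
    simp only [residueClass, ← Matrix.ext_iff, Matrix.map_apply, Set.mem_ofPred_eq,
      Set.mem_inter_iff, Set.mem_iInter, Set.mem_preimage, Set.mem_singleton_iff]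
  rw [h]
  exact isOpen_integralM2.inter <| isOpen_iInter_of_finite fun i => isOpen_iInter_of_finite
    fun j => (isLocallyConstant_residue _).preimage (by fun_prop)

theorem preimage_add_residueClass (ε : Matrix (Fin 2) (Fin 2) (ZMod 2)) :
    (fun β => β + ε.map fun z => ((z.val : ℕ) : ℚ_[2])) ⁻¹' residueClass ε = residueClass 0 := by
  have hε : (ε.map fun z => ((z.val : ℕ) : ℚ_[2])) ∈ integralM2 := fun i j =>
    PadicInt.norm_le_one ((_ : ℕ) : ℤ_[2])
  ext β
  refine (and_congr_left' (add_mem_integralM2_iff hε)).trans (and_congr_right fun hβ => ?_)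
  simp only [← Matrix.ext_iff, Matrix.map_apply, Matrix.add_apply, Matrix.zero_apply]
  refine forall₂_congr fun i j => ?_
  have hij := residue_add (hβ i j) (hε i j)
  rw [Matrix.map_apply, residue_natCast, ZMod.natCast_zmod_val] at hij
  rw [hij, add_eq_right]

section Measure

variable {ν : Measure M2} [ν.IsAddHaarMeasure]

theorem setIntegral_integralM2_eq_sum (F : Matrix (Fin 2) (Fin 2) (ZMod 2) → ℂ) :
    ∫ β in integralM2, F (β.map residue) ∂ν = ∑ ε, ν.real (residueClass ε) • F ε := by
  have hU : integralM2 = ⋃ ε, residueClass ε := by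
    ext β
    simp [residueClass]
  have hF : ∀ ε, Set.EqOn (fun β : M2 => F (β.map residue)) (fun _ => F ε) (residueClass ε) :=
    fun ε β hβ => congrArg F hβ.2
  have hfin : ∀ ε, ν (residueClass ε) ≠ ⊤ := fun ε =>
    (measure_mono fun β hβ => hβ.1).trans_lt isCompact_integralM2.measure_lt_top |>.ne
  rw [hU, integral_iUnion_fintype (fun ε => (isOpen_residueClass ε).measurableSet)
    (fun ε ε' h => Set.disjoint_left.2 fun β hβ hβ' => h (hβ.2.symm.trans hβ'.2))
    (fun ε => (integrableOn_const (hfin ε)).congr_fun (hF ε).symm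
      (isOpen_residueClass ε).measurableSet)]
  refine Finset.sum_congr rfl fun ε _ => ?_
  rw [setIntegral_congr_fun (isOpen_residueClass ε).measurableSet (hF ε), setIntegral_const]

theorem measureReal_residueClass (hν : ν integralM2 = 1)
    (ε : Matrix (Fin 2) (Fin 2) (ZMod 2)) : ν.real (residueClass ε) = 1 / 16 := by
  have heq : ∀ ε, ν.real (residueClass ε) = ν.real (residueClass 0) := fun ε => by
    rw [← preimage_add_residueClass ε, Measure.real, Measure.real, measure_preimage_add_right]
  have hcard : Fintype.card (Matrix (Fin 2) (Fin 2) (ZMod 2)) = 16 := by decide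
  have h := setIntegral_integralM2_eq_sum (ν := ν) fun _ => 1
  rw [Finset.sum_congr rfl fun ε _ => by rw [heq ε], Finset.sum_const, Finset.card_univ, hcard,
    setIntegral_const, Measure.real, hν] at h
  rw [heq, eq_div_iff (by norm_num)]
  apply Complex.ofReal_injective
  simpa [mul_comm] using h.symm

theorem setIntegral_integralM2_comp_residue (hν : ν integralM2 = 1)
    (F : Matrix (Fin 2) (Fin 2) (ZMod 2) → ℂ) :
    ∫ β in integralM2, F (β.map residue) ∂ν = 1 / 16 * ∑ ε, F ε := by
  simp_rw [setIntegral_integralM2_eq_sum, measureReal_residueClass hν, ← Finset.smul_sum,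
    Complex.real_smul]
  push_cast
  rfl

theorem integral_comp_linearEquiv (hν : ν integralM2 = 1) (T : M2 ≃ₗ[ℚ_[2]] M2) (f : M2 → ℂ) :
    ∫ β, f (T β) ∂ν = ν.real (T ⁻¹' integralM2) * ∫ β, f β ∂ν := by
  let e : M2 ≃L[ℚ_[2]] M2 := T.toContinuousLinearEquiv
  have : (ν.map e).IsAddHaarMeasure := e.isAddHaarMeasure_map ν
  have hmap := Measure.isAddLeftInvariant_eq_smul (ν.map e) ν
  have hL : ν (T ⁻¹' integralM2) = Measure.addHaarScalarFactor (ν.map e) ν := by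
    have h := Measure.map_apply (μ := ν) e.continuous.measurable isOpen_integralM2.measurableSet
    rw [hmap, Measure.smul_apply, hν] at h
    exact h.symm.trans (by simp [ENNReal.smul_def])
  have hint : ∫ β, f β ∂(ν.map e) = ∫ β, f (T β) ∂ν :=
    e.toHomeomorph.isClosedEmbedding.measurableEmbedding.integral_map f
  rw [← hint, hmap, integral_smul_nnreal_measure, Measure.real, hL]
  rfl

theorem integral_comp_linearEquiv_of_preimage_eq (hν : ν integralM2 = 1) {T : M2 ≃ₗ[ℚ_[2]] M2}
    (hT : T ⁻¹' integralM2 = integralM2) (f : M2 → ℂ) :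
    ∫ β, f (T β) ∂ν = ∫ β, f β ∂ν := by
  rw [integral_comp_linearEquiv hν, hT, Measure.real, hν]
  simp

theorem integral_comp_transvection (hν : ν integralM2 = 1) {l : Module.Dual ℚ_[2] M2} {v : M2}
    (hlv : l v = 0) (hl : ∀ β ∈ integralM2, ‖l β‖ ≤ 1) (hv : v ∈ integralM2) (f : M2 → ℂ) :
    ∫ β, f (LinearEquiv.transvection hlv β) ∂ν = ∫ β, f β ∂ν := by
  have hsmul : ∀ β ∈ integralM2, l β • v ∈ integralM2 := fun β hβ i j => by
    rw [Matrix.smul_apply, smul_eq_mul, norm_mul]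
    exact mul_le_one₀ (hl β hβ) (norm_nonneg _) (hv i j)
  refine integral_comp_linearEquiv_of_preimage_eq hν (Set.ext fun β => ?_) f
  change β + l β • v ∈ integralM2 ↔ β ∈ integralM2
  refine ⟨fun h => (add_mem_integralM2_iff ?_).1 h, fun h => ?_⟩
  · simpa [hlv] using hsmul _ h
  · exact (add_mem_integralM2_iff (hsmul β h)).2 h

/-- Multiplication of the entry in position `(i, j)` by the unit `x`. -/
def scaleEntry (i j : Fin 2) (x : ℚ_[2]ˣ) : M2 ≃ₗ[ℚ_[2]] M2 :=
  LinearEquiv.piCongrRight fun k => LinearEquiv.piCongrRight fun l =>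
    LinearEquiv.smulOfUnit (if k = i ∧ l = j then x else 1)

theorem scaleEntry_apply (i j : Fin 2) (x : ℚ_[2]ˣ) (β : M2) (k l : Fin 2) :
    scaleEntry i j x β k l = if k = i ∧ l = j then x * β k l else β k l := by
  change (if k = i ∧ l = j then x else 1 : ℚ_[2]ˣ) • β k l = _
  split_ifs
  · rfl
  · exact one_smul _ _

theorem scaleEntry_mul (i j : Fin 2) (x y : ℚ_[2]ˣ) (β : M2) :
    scaleEntry i j (x * y) β = scaleEntry i j x (scaleEntry i j y β) := by
  ext k l
  simp only [scaleEntry_apply]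
  split_ifs
  · rw [Units.val_mul, mul_assoc]
  · rfl

theorem scaleEntry_mem_integralM2_iff {i j : Fin 2} {x : ℚ_[2]ˣ} {β : M2} :
    scaleEntry i j x β ∈ integralM2 ↔
      ‖x * β i j‖ ≤ 1 ∧ ∀ k l, ¬ (k = i ∧ l = j) → ‖β k l‖ ≤ 1 := by
  constructor
  · intro h
    exact ⟨by simpa [scaleEntry_apply] using h i j, fun k l hkl => by
      simpa [scaleEntry_apply, hkl] using h k l⟩
  · rintro ⟨hij, h⟩ k l
    rw [scaleEntry_apply]
    split_ifs with hkl
    · rwa [hkl.1, hkl.2]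
    · exact h k l hkl

theorem integral_comp_scaleEntry_of_norm_eq_one (hν : ν integralM2 = 1) (i j : Fin 2)
    {x : ℚ_[2]ˣ} (hx : ‖(x : ℚ_[2])‖ = 1) (f : M2 → ℂ) :
    ∫ β, f (scaleEntry i j x β) ∂ν = ∫ β, f β ∂ν := by
  refine integral_comp_linearEquiv_of_preimage_eq hν (Set.ext fun β => ?_) f
  refine scaleEntry_mem_integralM2_iff.trans ?_
  rw [norm_mul, hx, one_mul]
  refine ⟨fun h k l => ?_, fun h => ⟨h i j, fun k l _ => h k l⟩⟩
  by_cases hkl : k = i ∧ l = j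
  · rw [hkl.1, hkl.2]
    exact h.1
  · exact h.2 k l hkl

theorem isOpen_residue_entry_eq_zero (i j : Fin 2) : IsOpen {β : M2 | residue (β i j) = 0} :=
  (isLocallyConstant_residue {0}).preimage (by fun_prop : Continuous fun β : M2 => β i j)

theorem measureReal_residue_entry_eq_zero (hν : ν integralM2 = 1) (i j : Fin 2) :
    ν.real (integralM2 ∩ {β | residue (β i j) = 0}) = 1 / 2 := by
  have hcount : ∀ i j, ((Finset.univ : Finset (Matrix (Fin 2) (Fin 2) (ZMod 2))).filter
      fun ε => ε i j = 0).card = 8 := by decide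
  have h : ∫ β in integralM2, {β : M2 | residue (β i j) = 0}.indicator (fun _ => (1 : ℂ)) β ∂ν =
      1 / 2 := by
    classical
    simp only [Set.indicator_apply, Set.mem_ofPred_eq]
    refine (setIntegral_integralM2_comp_residue hν fun ε => if ε i j = 0 then 1 else 0).trans ?_
    rw [Finset.sum_boole, hcount]
    norm_num
  rw [setIntegral_indicator (isOpen_residue_entry_eq_zero i j).measurableSet,
    setIntegral_const] at h
  apply Complex.ofReal_injective
  simpa using h

/- The scaling maps `M₂(ℤ₂)` onto the matrices in `M₂(ℤ₂)` with even `(i, j)` entry, which have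
measure `1 / 2`. -/
theorem integral_comp_scaleEntry_of_norm_eq_half (hν : ν integralM2 = 1) (i j : Fin 2)
    {x : ℚ_[2]ˣ} (hx : ‖(x : ℚ_[2])‖ = 2⁻¹) (f : M2 → ℂ) :
    ∫ β, f (scaleEntry i j x β) ∂ν = 2 * ∫ β, f β ∂ν := by
  set E : Set M2 := integralM2 ∩ {β | residue (β i j) = 0}
  have hpre : scaleEntry i j x ⁻¹' E = integralM2 := by
    ext β
    have hij : residue (scaleEntry i j x β i j) = 0 ↔ ‖β i j‖ ≤ 1 := by
      rw [residue_eq_zero_iff, norm_lt_one_iff_le_half, scaleEntry_apply, if_pos ⟨rfl, rfl⟩,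
        norm_mul, hx, mul_le_iff_le_one_right (by norm_num)]
    refine (and_congr scaleEntry_mem_integralM2_iff hij).trans ?_
    rw [norm_mul, hx]
    refine ⟨fun h k l => ?_, fun h => ⟨⟨by linarith [h i j], fun k l _ => h k l⟩, h i j⟩⟩
    by_cases hkl : k = i ∧ l = j
    · rw [hkl.1, hkl.2]
      exact h.2
    · exact h.1.2 k l hkl
  have hvol := integral_comp_linearEquiv hν (scaleEntry i j x) (E.indicator fun _ => (1 : ℂ))
  have hEmeas : MeasurableSet E :=
    (isOpen_integralM2.inter (isOpen_residue_entry_eq_zero i j)).measurableSet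
  have hcomp : ∀ β, E.indicator (fun _ => (1 : ℂ)) (scaleEntry i j x β) =
      integralM2.indicator (fun _ => 1) β := fun β => by
    rw [← hpre]
    rfl
  rw [integral_congr_ae (.of_forall hcomp),
    integral_indicator_const _ isOpen_integralM2.measurableSet,
    integral_indicator_const _ hEmeas, measureReal_residue_entry_eq_zero hν, Measure.real, hν]
    at hvol
  rw [integral_comp_linearEquiv hν]
  congr 1
  rw [ENNReal.toReal_one, one_smul, Complex.real_smul, mul_one] at hvol
  push_cast at hvol
  linear_combination (-2) * hvol

theorem integral_comp_scaleEntry_of_norm_eq (hν : ν integralM2 = 1) (i j : Fin 2) (k : ℤ) :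
    ∀ (x : ℚ_[2]ˣ) (f : M2 → ℂ), ‖(x : ℚ_[2])‖ = 2 ^ (-k) →
      ∫ β, f (scaleEntry i j x β) ∂ν = 2 ^ k * ∫ β, f β ∂ν := by
  let two : ℚ_[2]ˣ := Units.mk0 2 two_ne_zero
  have htwo : ‖(two : ℚ_[2])‖ = 2⁻¹ := norm_two_padic
  induction k with
  | zero =>
    intro x f hx
    rw [integral_comp_scaleEntry_of_norm_eq_one hν i j (by simpa using hx), zpow_zero, one_mul]
  | succ k ih =>
    intro x f hx
    have hx' : ‖((x * two⁻¹ : ℚ_[2]ˣ) : ℚ_[2])‖ = 2 ^ (-(k : ℤ)) := by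
      rw [Units.val_mul, Units.val_inv_eq_inv_val, norm_mul, norm_inv, hx, htwo, inv_inv, neg_add,
        zpow_add₀ two_ne_zero]
      ring
    rw [← inv_mul_cancel_right x two]
    simp only [scaleEntry_mul i j _ two]
    rw [integral_comp_scaleEntry_of_norm_eq_half hν i j htwo
      fun β => f (scaleEntry i j (x * two⁻¹) β), ih _ _ hx', zpow_add_one₀ two_ne_zero]
    ring
  | pred k ih =>
    intro x f hx
    have h := ih (x * two) f <| by
      rw [Units.val_mul, norm_mul, hx, htwo, neg_sub, sub_eq_add_neg, zpow_add₀ two_ne_zero]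
      ring
    simp only [scaleEntry_mul] at h
    rw [integral_comp_scaleEntry_of_norm_eq_half hν i j htwo
      fun β => f (scaleEntry i j x β)] at h
    rw [zpow_sub_one₀ two_ne_zero]
    linear_combination 2⁻¹ * h

theorem integral_comp_scaleEntry (hν : ν integralM2 = 1) (i j : Fin 2) (x : ℚ_[2]ˣ) (f : M2 → ℂ) :
    ∫ β, f (scaleEntry i j x β) ∂ν = (‖(x : ℚ_[2])‖⁻¹ : ℝ) * ∫ β, f β ∂ν := by
  have hx : ‖(x : ℚ_[2])‖ = 2 ^ (-(x : ℚ_[2]).valuation) :=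
    Padic.norm_eq_zpow_neg_valuation x.ne_zero
  rw [integral_comp_scaleEntry_of_norm_eq hν i j _ x f hx, hx, ← zpow_neg, neg_neg]
  push_cast
  rfl

end Measure

/-! ### The self-dual measure -/

theorem tracePairing_eq (α β : M2) :
    tracePairing α β = α 0 0 * β 1 1 - α 0 1 * β 1 0 - α 1 0 * β 0 1 + α 1 1 * β 0 0 := by
  simp only [tracePairing, Matrix.trace_fin_two, Matrix.adjugate_fin_two, Matrix.mul_apply,
    Fin.sum_univ_two, Matrix.of_apply, Matrix.cons_val', Matrix.cons_val_zero,
    Matrix.cons_val_one, Matrix.cons_val_fin_one]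
  ring

theorem tracePairing_add (α β γ : M2) :
    tracePairing α (β + γ) = tracePairing α β + tracePairing α γ := by
  simp only [tracePairing_eq, Matrix.add_apply]
  ring

theorem norm_tracePairing_le_one {α β : M2} (hα : α ∈ integralM2) (hβ : β ∈ integralM2) :
    ‖tracePairing α β‖ ≤ 1 := by
  let x : ∀ _ _, ℤ_[2] := fun i j => ⟨α i j, hα i j⟩
  let y : ∀ _ _, ℤ_[2] := fun i j => ⟨β i j, hβ i j⟩
  have h : tracePairing α β =
      ((x 0 0 * y 1 1 - x 0 1 * y 1 0 - x 1 0 * y 0 1 + x 1 1 * y 0 0 : ℤ_[2]) : ℚ_[2]) := by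
    rw [tracePairing_eq]
    push_cast
    rfl
  rw [h]
  exact PadicInt.norm_le_one _

theorem exists_tracePairing_eq (α : M2) (i j : Fin 2) {y : ℚ_[2]} (hy : ‖y‖ ≤ 1) :
    ∃ β ∈ integralM2, tracePairing α β = α i j * y := by
  refine ⟨(Matrix.single j i y).adjugate, fun k l => ?_, ?_⟩
  · rw [Matrix.adjugate_fin_two]
    fin_cases i <;> fin_cases j <;> fin_cases k <;> fin_cases l <;> simp [hy]
  · rw [tracePairing_eq, Matrix.adjugate_fin_two]
    fin_cases i <;> fin_cases j <;> simp

theorem isSchwartzBruhat_indicator_integralM2 :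
    IsSchwartzBruhat (integralM2.indicator fun _ => (1 : ℂ)) := by
  refine ⟨(IsLocallyConstant.iff_eventually_eq _).2 fun x => ?_,
    .of_support_subset_isCompact isCompact_integralM2 Set.support_indicator_subset⟩
  classical
  filter_upwards [eventually_mem_iff_of_isClopen isClopen_integralM2 x] with y hy
  simp only [Set.indicator_apply, hy]

section Measure

variable {ν : Measure M2} {ψ : AddChar ℚ_[2] Circle}

theorem fourierM2_indicator_of_mem (hψ : IsUnramifiedChar ψ) {α : M2} (hα : α ∈ integralM2) :
    fourierM2 ψ ν (integralM2.indicator fun _ => 1) α = ν.real integralM2 := by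
  have hψ1 : ∀ x : ℚ_[2], ‖x‖ ≤ 1 → ψ x = 1 := fun x hx => by
    simpa using (hψ.2 x).2 hx 1 norm_one.le
  have h : ∀ β, integralM2.indicator (fun _ => (1 : ℂ)) β * (ψ (tracePairing α β) : ℂ) =
      integralM2.indicator (fun _ => 1) β := fun β => by
    by_cases hβ : β ∈ integralM2
    · rw [hψ1 _ (norm_tracePairing_le_one hα hβ), Circle.coe_one, mul_one]
    · rw [Set.indicator_of_notMem hβ, zero_mul]
  simp only [fourierM2, h]
  rw [integral_indicator_const _ isOpen_integralM2.measurableSet]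
  simp

/- Translation by an integral matrix `β₀` multiplies the Fourier integral by `ψ ⟨α, β₀⟩`, and for
`α` not integral this factor can be made different from `1`. -/
theorem fourierM2_indicator_of_notMem [ν.IsAddHaarMeasure] (hψ : IsUnramifiedChar ψ) {α : M2}
    (hα : α ∉ integralM2) : fourierM2 ψ ν (integralM2.indicator fun _ => 1) α = 0 := by
  obtain ⟨i, j, hij⟩ : ∃ i j, ¬ ‖α i j‖ ≤ 1 := by
    by_contra! h
    exact hα h
  obtain ⟨y, hy, hne⟩ : ∃ y, ‖y‖ ≤ 1 ∧ ψ (α i j * y) ≠ 1 := by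
    by_contra! h
    exact hij ((hψ.2 _).1 h)
  obtain ⟨β₀, hβ₀, e⟩ := exists_tracePairing_eq α i j hy
  set f : M2 → ℂ := fun β =>
    integralM2.indicator (fun _ => (1 : ℂ)) β * (ψ (tracePairing α β) : ℂ)
  have htrans : ∀ β, f (β + β₀) = (ψ (α i j * y) : ℂ) * f β := fun β => by
    have hind : integralM2.indicator (fun _ => (1 : ℂ)) (β + β₀) =
        integralM2.indicator (fun _ => (1 : ℂ)) β := by
      classical
      simp only [Set.indicator_apply, add_mem_integralM2_iff hβ₀]
    simp only [f, hind, tracePairing_add, e, AddChar.map_add_eq_mul, Circle.coe_mul]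
    ring
  have hint := integral_add_right_eq_self (μ := ν) f β₀
  simp only [htrans, integral_const_mul] at hint
  refine (mul_left_eq_self₀.1 hint).resolve_left fun h => hne (Circle.coe_injective ?_)
  simpa using h

theorem measure_integralM2 [ν.IsAddHaarMeasure] (hψ : IsUnramifiedChar ψ)
    (hνψ : IsSelfDual ψ ν) : ν integralM2 = 1 := by
  have h0 : (0 : M2) ∈ integralM2 := fun i j => by simp
  have hF : fourierM2 ψ ν (integralM2.indicator fun _ => 1) =
      (ν.real integralM2 : ℂ) • integralM2.indicator fun _ => 1 := by
    ext α
    by_cases hα : α ∈ integralM2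
    · simp [fourierM2_indicator_of_mem hψ hα, hα]
    · simp [fourierM2_indicator_of_notMem hψ hα, hα]
  have hFF : fourierM2 ψ ν (fourierM2 ψ ν (integralM2.indicator fun _ => 1)) 0 =
      (ν.real integralM2 : ℂ) * ν.real integralM2 := by
    rw [hF, ← fourierM2_indicator_of_mem (ν := ν) hψ h0, fourierM2, fourierM2, ← integral_const_mul]
    simp only [Pi.smul_apply, smul_eq_mul, mul_assoc]
  have hsq : ν.real integralM2 * ν.real integralM2 = 1 := by
    apply Complex.ofReal_injective
    rw [Complex.ofReal_mul, ← hFF, hνψ _ isSchwartzBruhat_indicator_integralM2, neg_zero,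
      Set.indicator_of_mem h0, Complex.ofReal_one]
  have hone : ν.real integralM2 = 1 := by
    have : 0 ≤ ν.real integralM2 := measureReal_nonneg
    nlinarith
  rwa [Measure.real, ENNReal.toReal_eq_one_iff] at hone

end Measure

/-! ### The function `φ` in terms of reductions modulo `2` -/

/-- The sign `(-1) ^ z`. -/
def signZMod (z : ZMod 2) : ℤ := if z = 0 then 1 else -1

/-- The value of `χ₁ + χ₂ + χ₃` at `!![a, 2 * b; 2 * c, -a]`, in terms of the classes of
`a`, `b`, `c` modulo `2`. -/
def signSum (a b c : ZMod 2) : ℤ := signZMod (b + c) + signZMod (a + c) + signZMod (a + b)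

theorem sgn2_eq_signZMod_residue (x : ℚ_[2]) : sgn2 x = signZMod (residue x) := by
  simp only [sgn2, signZMod, residue_eq_zero_iff]
  split_ifs <;> simp

open Classical in
theorem sum_chi (β : M2) : ∑ i : Fin 3, chi i β =
    if β.trace = 0 ∧ ‖β 0 0‖ ≤ 1 ∧ ‖β 0 1 / 2‖ ≤ 1 ∧ ‖β 1 0 / 2‖ ≤ 1 then
      (signSum (residue (β 0 0)) (residue (β 0 1 / 2)) (residue (β 1 0 / 2)) : ℂ) else 0 := by
  simp only [chi, Fin.sum_univ_three, signSum, sgn2_eq_signZMod_residue]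
  split_ifs with h
  · obtain ⟨-, ha, hb, hc⟩ := h
    rw [← residue_add hb hc, ← residue_add ha hc, ← residue_add ha hb]
    simp
  · simp

open Classical in
theorem phi_eq (β : M2) : phi β = phi' (β.trace / 2) * (2 ^ (-3 : ℤ) * (kappa0 : ℂ) *
    if ‖2 * (β 0 0 - β 1 1)‖ ≤ 1 ∧ ‖2 * β 0 1‖ ≤ 1 ∧ ‖2 * β 1 0‖ ≤ 1 then
      (signSum (residue (2 * (β 0 0 - β 1 1))) (residue (2 * β 0 1)) (residue (2 * β 1 0)) : ℂ)
    else 0) := by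
  set γ : M2 := (4 : ℚ_[2]) • (β - Matrix.scalar (Fin 2) (β.trace / 2)) with hγ
  have hij : ∀ i j, γ i j = 4 * (β i j - if i = j then (β 0 0 + β 1 1) / 2 else 0) := fun i j => by
    rw [hγ, Matrix.trace_fin_two, Matrix.smul_apply, Matrix.sub_apply, Matrix.scalar_apply,
      Matrix.diagonal_apply, smul_eq_mul]
  have htr : γ.trace = 0 := by
    rw [Matrix.trace_fin_two, hij, hij, if_pos rfl, if_pos rfl]
    ring
  have h00 : γ 0 0 = 2 * (β 0 0 - β 1 1) := by
    rw [hij, if_pos rfl]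
    ring
  have h01 : γ 0 1 / 2 = 2 * β 0 1 := by
    rw [hij, if_neg (by decide)]
    ring
  have h10 : γ 1 0 / 2 = 2 * β 1 0 := by
    rw [hij, if_neg (by decide)]
    ring
  simp only [phi, phi'', ← hγ, sum_chi, htr, h00, h01, h10, true_and]

theorem norm_bounds_of_phi_ne_zero {β : M2} (hβ : phi β ≠ 0) :
    ‖β.trace / 2‖ = 1 ∧ ‖2 * (β 0 0 - β 1 1)‖ ≤ 1 ∧ ‖2 * β 0 1‖ ≤ 1 ∧ ‖2 * β 1 0‖ ≤ 1 := by
  rw [phi_eq] at hβ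
  constructor
  · by_contra h
    exact hβ (by rw [phi', if_neg h, zero_mul])
  · by_contra h
    exact hβ (by rw [if_neg h, mul_zero, mul_zero])

/-! ### `φ` is a Schwartz–Bruhat function -/

theorem isLocallyConstant_phi : IsLocallyConstant phi := by
  refine (IsLocallyConstant.iff_eventually_eq _).2 fun x => ?_
  have hle : ∀ f : M2 → ℚ_[2], Continuous f → ∀ᶠ y in nhds x, (‖f y‖ ≤ 1 ↔ ‖f x‖ ≤ 1) :=
    fun f hf => by
      simpa only [Set.mem_preimage, mem_closedBall_zero_iff] using eventually_mem_iff_of_isClopen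
        ((IsUltrametricDist.isClopen_closedBall (0 : ℚ_[2]) one_ne_zero).preimage hf) x
  have heq : ∀ f : M2 → ℚ_[2], Continuous f → ∀ᶠ y in nhds x, (‖f y‖ = 1 ↔ ‖f x‖ = 1) :=
    fun f hf => by
      simpa only [Set.mem_preimage, mem_sphere_zero_iff_norm] using eventually_mem_iff_of_isClopen
        ((IsUltrametricDist.isClopen_sphere (0 : ℚ_[2]) one_ne_zero).preimage hf) x
  have hres : ∀ f : M2 → ℚ_[2], Continuous f → ∀ᶠ y in nhds x, residue (f y) = residue (f x) :=
    fun f hf => (isLocallyConstant_residue.comp_continuous hf).eventually_eq x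
  filter_upwards [heq (fun β => β.trace / 2) (by fun_prop),
    hle (fun β => 2 * (β 0 0 - β 1 1)) (by fun_prop), hle (fun β => 2 * β 0 1) (by fun_prop),
    hle (fun β => 2 * β 1 0) (by fun_prop), hres (fun β => 2 * (β 0 0 - β 1 1)) (by fun_prop),
    hres (fun β => 2 * β 0 1) (by fun_prop), hres (fun β => 2 * β 1 0) (by fun_prop)]
    with y htr ha hb hc ha' hb' hc'
  rw [phi_eq, phi_eq]
  simp only [phi', htr, ha, hb, hc, ha', hb', hc']

theorem norm_apply_le_of_phi_ne_zero {β : M2} (hβ : phi β ≠ 0) (i j : Fin 2) : ‖β i j‖ ≤ 4 := by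
  obtain ⟨htr, ha, hb, hc⟩ := norm_bounds_of_phi_ne_zero hβ
  have key : ∀ x y : ℚ_[2], ‖x‖ ≤ 4 → ‖y‖ ≤ 4 → ‖x + y‖ ≤ 4 := fun x y hx hy =>
    (Padic.nonarchimedean x y).trans (max_le hx hy)
  have hm : ‖β.trace / 2‖ ≤ 4 := by rw [htr]; norm_num
  have hd : ‖(β 0 0 - β 1 1) / 2‖ ≤ 4 := by
    rw [norm_mul, norm_two_padic] at ha
    rw [norm_div, norm_two_padic, div_inv_eq_mul]
    linarith
  fin_cases i <;> fin_cases j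
  · convert key _ _ hm hd using 2
    simp only [Matrix.trace_fin_two, Fin.zero_eta]
    ring
  · change ‖β 0 1‖ ≤ 4
    rw [norm_mul, norm_two_padic] at hb
    linarith
  · change ‖β 1 0‖ ≤ 4
    rw [norm_mul, norm_two_padic] at hc
    linarith
  · convert key _ _ hm ((norm_neg _).trans_le hd) using 2
    simp only [Matrix.trace_fin_two, Fin.mk_one]
    ring

theorem isSchwartzBruhat_phi : IsSchwartzBruhat phi := by
  refine ⟨isLocallyConstant_phi, .of_support_subset_isCompact
    (isCompact_univ_pi fun _ => isCompact_univ_pi fun _ => isCompact_closedBall (0 : ℚ_[2]) 4) ?_⟩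
  exact fun β hβ i _ j _ => mem_closedBall_zero_iff.2 (norm_apply_le_of_phi_ne_zero hβ i j)

/-! ### Invariance of `φ` under conjugation by `GL₂(ℤ₂)` -/

theorem map_residue_mul {α β : M2} (hα : α ∈ integralM2) (hβ : β ∈ integralM2) :
    (α * β).map residue = α.map residue * β.map residue := by
  have hmul : ∀ x y : ℚ_[2], ‖x‖ ≤ 1 → ‖y‖ ≤ 1 → residue (x * y) = residue x * residue y := by
    intro x y hx hy
    obtain ⟨x, rfl⟩ : ∃ z : ℤ_[2], (z : ℚ_[2]) = x := ⟨⟨x, hx⟩, rfl⟩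
    obtain ⟨y, rfl⟩ : ∃ z : ℤ_[2], (z : ℚ_[2]) = y := ⟨⟨y, hy⟩, rfl⟩
    rw [← PadicInt.coe_mul, residue_coe, residue_coe, residue_coe, map_mul]
  have hle : ∀ i k j, ‖α i k * β k j‖ ≤ 1 := fun i k j => by
    rw [norm_mul]
    exact mul_le_one₀ (hα i k) (norm_nonneg _) (hβ k j)
  ext i j
  simp only [Matrix.map_apply, Matrix.mul_apply, Fin.sum_univ_two]
  rw [residue_add (hle _ _ _) (hle _ _ _), hmul _ _ (hα _ _) (hβ _ _),
    hmul _ _ (hα _ _) (hβ _ _)]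

theorem map_residue_one : (1 : M2).map residue = 1 := by
  refine Matrix.map_one _ (residue_eq_zero_iff.2 (by simp)) ?_
  simpa using residue_natCast 1

/-- The function on `M₂(𝔽₂)` whose value at the reduction of an integral matrix `y` is the value
of `χ₁ + χ₂ + χ₃` at `2 * y - tr y`. -/
def signMatrix (ε : Matrix (Fin 2) (Fin 2) (ZMod 2)) : ℤ :=
  signSum (ε 0 0 - ε 1 1) (ε 0 1) (ε 1 0)

theorem signMatrix_conj : ∀ P W ε : Matrix (Fin 2) (Fin 2) (ZMod 2), P * W = 1 →
    signMatrix (P * ε * W) = signMatrix ε := by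
  decide +kernel

/-- Twice the trace-zero component of `y`. -/
def traceZeroPart (y : M2) : M2 := (2 : ℚ_[2]) • y - Matrix.scalar (Fin 2) y.trace

theorem traceZeroPart_apply (y : M2) (i j : Fin 2) :
    traceZeroPart y i j = 2 * y i j - if i = j then y 0 0 + y 1 1 else 0 := by
  rw [traceZeroPart, Matrix.sub_apply, Matrix.scalar_apply, Matrix.diagonal_apply,
    Matrix.trace_fin_two, Matrix.smul_apply, smul_eq_mul]

theorem trace_conjM2 (g : GL2) (β : M2) : (conjM2 g β).trace = β.trace := by
  change ((g : M2) * β * ((g⁻¹ : GL2) : M2)).trace = _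
  rw [Matrix.trace_mul_cycle, Units.inv_mul, one_mul]

theorem conjM2_smul (g : GL2) (c : ℚ_[2]) (β : M2) : conjM2 g (c • β) = c • conjM2 g β := by
  change (g : M2) * (c • β) * ((g⁻¹ : GL2) : M2) = c • ((g : M2) * β * ((g⁻¹ : GL2) : M2))
  rw [Matrix.mul_smul, Matrix.smul_mul]

theorem conjM2_sub_scalar (g : GL2) (c : ℚ_[2]) (β : M2) :
    conjM2 g (β - Matrix.scalar (Fin 2) c) = conjM2 g β - Matrix.scalar (Fin 2) c := by
  have hcomm := Matrix.scalar_commute c (fun r => Commute.all _ r) (g : M2)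
  change (g : M2) * (β - Matrix.scalar (Fin 2) c) * ((g⁻¹ : GL2) : M2) =
    (g : M2) * β * ((g⁻¹ : GL2) : M2) - Matrix.scalar (Fin 2) c
  rw [mul_sub, sub_mul, ← hcomm.eq, mul_assoc _ (g : M2), Units.mul_inv, mul_one]

theorem conjM2_traceZeroPart (g : GL2) (y : M2) :
    conjM2 g (traceZeroPart y) = traceZeroPart (conjM2 g y) := by
  rw [traceZeroPart, conjM2_sub_scalar, conjM2_smul, traceZeroPart, trace_conjM2]

theorem conjM2_mem_integralM2 {k : GL2} (hk : k ∈ K2) {y : M2} (hy : y ∈ integralM2) :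
    conjM2 k y ∈ integralM2 := by
  rw [mem_integralM2_iff] at hy ⊢
  change ‖(k : M2) * y * ((k⁻¹ : GL2) : M2)‖ ≤ 1
  rwa [norm_mul_K2 (K2.inv_mem hk), norm_K2_mul hk]

theorem signMatrix_map_residue_conjM2 {k : GL2} (hk : k ∈ K2) {y : M2} (hy : y ∈ integralM2) :
    signMatrix ((conjM2 k y).map residue) = signMatrix (y.map residue) := by
  have hk' : (k : M2) ∈ integralM2 := (mem_K2_iff.1 hk).1
  have hki : ((k⁻¹ : GL2) : M2) ∈ integralM2 := (mem_K2_iff.1 (K2.inv_mem hk)).1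
  have hky : (k : M2) * y ∈ integralM2 := by
    rw [mem_integralM2_iff] at hy ⊢
    rwa [norm_K2_mul hk]
  change signMatrix (((k : M2) * y * ((k⁻¹ : GL2) : M2)).map residue) = _
  rw [map_residue_mul hky hki, map_residue_mul hk' hy]
  exact signMatrix_conj _ _ _ (by rw [← map_residue_mul hk' hki, Units.mul_inv, map_residue_one])

theorem sum_chi_traceZeroPart {y : M2} (hy : y ∈ integralM2) :
    ∑ i : Fin 3, chi i (traceZeroPart y) = signMatrix (y.map residue) := by
  have htr : (traceZeroPart y).trace = 0 := by
    rw [Matrix.trace_fin_two, traceZeroPart_apply, traceZeroPart_apply, if_pos rfl, if_pos rfl]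
    ring
  have h00 : traceZeroPart y 0 0 = y 0 0 + -y 1 1 := by
    rw [traceZeroPart_apply, if_pos rfl]
    ring
  have h01 : traceZeroPart y 0 1 / 2 = y 0 1 := by
    rw [traceZeroPart_apply, if_neg (by decide)]
    ring
  have h10 : traceZeroPart y 1 0 / 2 = y 1 0 := by
    rw [traceZeroPart_apply, if_neg (by decide)]
    ring
  have hneg : ‖-y 1 1‖ ≤ 1 := (norm_neg _).trans_le (hy 1 1)
  have hres : residue (-y 1 1) = -residue (y 1 1) := by
    simp only [residue, norm_neg]
    split_ifs <;> rfl
  rw [sum_chi, htr, h00, h01, h10, if_pos ⟨rfl, (Padic.nonarchimedean _ _).trans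
    (max_le (hy 0 0) hneg), hy 0 1, hy 1 0⟩, residue_add (hy 0 0) hneg, hres, ← sub_eq_add_neg]
  rfl

theorem exists_eq_traceZeroPart {β : M2} (h : ∑ i : Fin 3, chi i β ≠ 0) :
    ∃ y ∈ integralM2, β = traceZeroPart y := by
  rw [sum_chi] at h
  obtain ⟨htr, ha, hb, hc⟩ := of_not_not fun hβ => h (if_neg hβ)
  rw [Matrix.trace_fin_two] at htr
  refine ⟨!![β 0 0, β 0 1 / 2; β 1 0 / 2, 0], fun i j => ?_, ?_⟩
  · fin_cases i <;> fin_cases j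
    exacts [ha, hb, hc, norm_zero.trans_le zero_le_one]
  · ext i j
    rw [traceZeroPart_apply]
    fin_cases i <;> fin_cases j
    · change β 0 0 = 2 * β 0 0 - (β 0 0 + 0)
      ring
    · change β 0 1 = 2 * (β 0 1 / 2) - 0
      ring
    · change β 1 0 = 2 * (β 1 0 / 2) - 0
      ring
    · change β 1 1 = 2 * 0 - (β 0 0 + 0)
      linear_combination htr

theorem sum_chi_conjM2_of_ne_zero {k : GL2} (hk : k ∈ K2) {β : M2}
    (h : ∑ i : Fin 3, chi i β ≠ 0) :
    ∑ i : Fin 3, chi i (conjM2 k β) = ∑ i : Fin 3, chi i β := by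
  obtain ⟨y, hy, rfl⟩ := exists_eq_traceZeroPart h
  rw [conjM2_traceZeroPart, sum_chi_traceZeroPart (conjM2_mem_integralM2 hk hy),
    sum_chi_traceZeroPart hy, signMatrix_map_residue_conjM2 hk hy]

theorem sum_chi_conjM2 {k : GL2} (hk : k ∈ K2) (β : M2) :
    ∑ i : Fin 3, chi i (conjM2 k β) = ∑ i : Fin 3, chi i β := by
  by_cases h : ∑ i : Fin 3, chi i β = 0
  · by_contra hne
    have hinv : conjM2 k⁻¹ (conjM2 k β) = β := by
      change (conjM2 k⁻¹ * conjM2 k) β = β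
      rw [← map_mul, inv_mul_cancel, map_one]
      rfl
    have h' := sum_chi_conjM2_of_ne_zero (K2.inv_mem hk) (h ▸ hne)
    rw [hinv] at h'
    exact hne h'.symm
  · exact sum_chi_conjM2_of_ne_zero hk h

theorem phi_conjM2 {k : GL2} (hk : k ∈ K2) (β : M2) : phi (conjM2 k β) = phi β := by
  simp only [phi, phi'', trace_conjM2, ← conjM2_sub_scalar, ← conjM2_smul, sum_chi_conjM2 hk]

/-! ### The matrix coefficient of `φ` -/

theorem innerM2_mul_of_mem_K2 (ν : Measure M2) {k : GL2} (hk : k ∈ K2) (x : PGL2) :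
    innerM2 ν (AdFun (x * (k : PGL2)) phi) phi = innerM2 ν (AdFun x phi) phi := by
  congr 1
  funext β
  simp only [AdFun, mul_inv_rev, map_mul]
  exact phi_conjM2 (K2.inv_mem hk) _

theorem conjM2_inv_diagTwoPow (n : ℕ) (p q r s : ℚ_[2]) :
    conjM2 (diagTwoPow n)⁻¹ !![p, q; 2 ^ n * r, s] = !![p, 2 ^ n * q; r, s] := by
  change (((diagTwoPow n)⁻¹ : GL2) : M2) * _ * (((diagTwoPow n)⁻¹⁻¹ : GL2) : M2) = _
  rw [inv_inv, mul_assoc, Units.inv_mul_eq_iff_eq_mul, coe_diagTwoPow, Matrix.mul_fin_two,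
    Matrix.mul_fin_two]
  congr! 3 <;> ring_nf

/-- The value of `φ` at `!![m + a / 4, b / 2; c / 2, m - a / 4]`, divided by `2⁻³ κ₀`, in terms of
the classes modulo `2` of the `2`-adic integers `m`, `a`, `b`, `c`. -/
def phiResidue (m a b c : ZMod 2) : ℤ := if m = 0 then 0 else signSum a b c

/-- Coordinates `(m, a, b, c)` on `M₂(ℚ₂)` in which the support of `φ` is integral and `φ` only
depends on residues. -/
def phiCoord (m a b c : ℚ_[2]) : M2 := !![m + a / 4, b / 2; c / 2, m - a / 4]

theorem trace_phiCoord_div_two (m a b c : ℚ_[2]) : (phiCoord m a b c).trace / 2 = m := by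
  rw [phiCoord, Matrix.trace_fin_two_of]
  ring

theorem phiCoord_entries (m a b c : ℚ_[2]) :
    2 * (phiCoord m a b c 0 0 - phiCoord m a b c 1 1) = a ∧ 2 * phiCoord m a b c 0 1 = b ∧
      2 * phiCoord m a b c 1 0 = c := by
  refine ⟨?_, mul_div_cancel₀ b two_ne_zero, mul_div_cancel₀ c two_ne_zero⟩
  change 2 * (m + a / 4 - (m - a / 4)) = a
  ring

theorem phi_phiCoord {m a b c : ℚ_[2]} (hm : ‖m‖ ≤ 1) (ha : ‖a‖ ≤ 1) (hb : ‖b‖ ≤ 1)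
    (hc : ‖c‖ ≤ 1) : phi (phiCoord m a b c) =
      2 ^ (-3 : ℤ) * (kappa0 : ℂ) * phiResidue (residue m) (residue a) (residue b) (residue c) := by
  obtain ⟨h₁, h₂, h₃⟩ := phiCoord_entries m a b c
  rw [phi_eq, trace_phiCoord_div_two, h₁, h₂, h₃, if_pos ⟨ha, hb, hc⟩, phi', phiResidue]
  have hunit : ‖m‖ = 1 ↔ residue m ≠ 0 := by
    rw [Ne, residue_eq_zero_iff, not_lt]
    exact ⟨fun h => h.ge, fun h => hm.antisymm h⟩
  split_ifs with h h' h' <;> simp_all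

theorem norm_le_one_of_phi_phiCoord_ne_zero {m a b c : ℚ_[2]} (h : phi (phiCoord m a b c) ≠ 0) :
    ‖m‖ ≤ 1 ∧ ‖a‖ ≤ 1 ∧ ‖b‖ ≤ 1 ∧ ‖c‖ ≤ 1 := by
  obtain ⟨h₁, h₂, h₃⟩ := phiCoord_entries m a b c
  have hbounds := norm_bounds_of_phi_ne_zero h
  rw [trace_phiCoord_div_two, h₁, h₂, h₃] at hbounds
  exact ⟨hbounds.1.le, hbounds.2⟩

/-- The integrand of `⟨Ad(diag(1, 2ⁿ)) φ, φ⟩`, divided by `(2⁻³ κ₀) ^ 2`, in terms of the classes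
modulo `2` of coordinates arranged in a matrix. -/
def coeffResidue (n : ℕ) (ε : Matrix (Fin 2) (Fin 2) (ZMod 2)) : ℤ :=
  phiResidue (ε 0 0) (ε 1 1) (0 ^ n * ε 0 1) (ε 1 0) *
    phiResidue (ε 0 0) (ε 1 1) (ε 0 1) (0 ^ n * ε 1 0)

theorem phi_mul_star_phi_eq_indicator (n : ℕ) (δ : M2) :
    phi (phiCoord (δ 0 0) (δ 1 1) (2 ^ n * δ 0 1) (δ 1 0)) *
        star (phi (phiCoord (δ 0 0) (δ 1 1) (δ 0 1) (2 ^ n * δ 1 0))) =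
      integralM2.indicator (fun δ => (2 ^ (-3 : ℤ) * (kappa0 : ℂ)) ^ 2 *
        (coeffResidue n (δ.map residue) : ℂ)) δ := by
  by_cases hδ : δ ∈ integralM2
  · have hpow : ∀ i j, ‖2 ^ n * δ i j‖ ≤ 1 := fun i j => by
      rw [norm_mul]
      exact mul_le_one₀ (norm_two_pow_padic_le_one n) (norm_nonneg _) (hδ i j)
    rw [Set.indicator_of_mem hδ, phi_phiCoord (hδ 0 0) (hδ 1 1) (hpow 0 1) (hδ 1 0),
      phi_phiCoord (hδ 0 0) (hδ 1 1) (hδ 0 1) (hpow 1 0), residue_two_pow_mul n (hδ 0 1),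
      residue_two_pow_mul n (hδ 1 0)]
    simp only [coeffResidue, Matrix.map_apply, star_mul', star_zpow₀, star_ofNat, star_intCast,
      RCLike.star_def, Complex.conj_ofReal]
    push_cast
    ring
  · rw [Set.indicator_of_notMem hδ]
    by_contra hne
    obtain ⟨hm, ha, -, hc⟩ := norm_le_one_of_phi_phiCoord_ne_zero (left_ne_zero_of_mul hne)
    obtain ⟨-, -, hb, -⟩ :=
      norm_le_one_of_phi_phiCoord_ne_zero (star_ne_zero.1 (right_ne_zero_of_mul hne))
    refine hδ fun i j => ?_
    fin_cases i <;> fin_cases j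
    exacts [hm, hb, hc, ha]

theorem sum_coeffResidue_zero : ∑ ε, coeffResidue 0 ε = 24 := by
  decide +kernel

theorem sum_coeffResidue_succ (n : ℕ) : ∑ ε, coeffResidue (n + 1) ε = 8 := by
  simp only [coeffResidue, pow_succ, mul_zero, zero_mul]
  decide +kernel

section Measure

variable {ν : Measure M2} [ν.IsAddHaarMeasure]

/-- Conjugation by `g` as a linear automorphism of `M₂(ℚ₂)`. -/
def conjEquiv (g : GL2) : M2 ≃ₗ[ℚ_[2]] M2 where
  toFun := conjM2 g
  map_add' β γ := by
    change (g : M2) * (β + γ) * ((g⁻¹ : GL2) : M2) = _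
    rw [mul_add, add_mul]
    rfl
  map_smul' c β := conjM2_smul g c β
  invFun := conjM2 g⁻¹
  left_inv β := by
    change (conjM2 g⁻¹ * conjM2 g) β = β
    rw [← map_mul, inv_mul_cancel, map_one]
    rfl
  right_inv β := by
    change (conjM2 g * conjM2 g⁻¹) β = β
    rw [← map_mul, mul_inv_cancel, map_one]
    rfl

theorem conjEquiv_preimage_integralM2 {k : GL2} (hk : k ∈ K2) :
    conjEquiv k ⁻¹' integralM2 = integralM2 := by
  refine Set.Subset.antisymm (fun β hβ => ?_) fun β hβ => conjM2_mem_integralM2 hk hβ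
  rw [← (conjEquiv k).symm_apply_apply β]
  exact conjM2_mem_integralM2 (K2.inv_mem hk) hβ

theorem innerM2_K2_mul (hν : ν integralM2 = 1) {k : GL2} (hk : k ∈ K2) (x : PGL2) :
    innerM2 ν (AdFun ((k : PGL2) * x) phi) phi = innerM2 ν (AdFun x phi) phi := by
  have hk' := K2.inv_mem hk
  refine Eq.trans (integral_congr_ae (.of_forall fun β => ?_)) <|
    integral_comp_linearEquiv_of_preimage_eq hν (conjEquiv_preimage_integralM2 hk')
      fun β => AdFun x phi β * star (phi β)
  change phi _ * _ = phi _ * star (phi (conjM2 k⁻¹ β))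
  rw [phi_conjM2 hk']
  simp only [mul_inv_rev, map_mul]
  rfl

theorem innerM2_eq_of_mem_sphere (hν : ν integralM2 = 1) {n : ℕ} {x : PGL2} (hx : x ∈ sphere n) :
    innerM2 ν (AdFun x phi) phi = innerM2 ν (AdFun (diagTwoPow n : PGL2) phi) phi := by
  induction x using QuotientGroup.induction_on with
  | H g =>
    obtain ⟨z, hz, k₁, hk₁, k₂, hk₂, rfl⟩ :=
      exists_eq_of_cartanSize_eq (mk_mem_sphere_iff.1 hx)
    have hz' : (z : PGL2) = 1 := (QuotientGroup.eq_one_iff z).2 hz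
    simp only [QuotientGroup.mk_mul, hz', one_mul]
    rw [innerM2_mul_of_mem_K2 ν hk₂, innerM2_K2_mul hν hk₁]

theorem integral_comp_add_smul_single (hν : ν integralM2 = 1) {i j k l : Fin 2}
    (hne : ¬(k = i ∧ l = j)) (f : M2 → ℂ) :
    ∫ β, f (β + β i j • Matrix.single k l 1) ∂ν = ∫ β, f β ∂ν := by
  refine integral_comp_transvection hν (l := Matrix.entryLinearMap ℚ_[2] ℚ_[2] i j)
    (v := Matrix.single k l 1) (Matrix.single_apply_of_ne _ _ _ _ _ hne) (fun β hβ => hβ i j)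
    (fun i' j' => ?_) f
  rw [Matrix.single_apply]
  split_ifs
  exacts [norm_one.le, norm_zero.trans_le zero_le_one]

theorem integral_comp_phiCoord (hν : ν integralM2 = 1) (n : ℕ) (f : M2 → ℂ) :
    ∫ δ, f (phiCoord (δ 0 0) (δ 1 1) (δ 0 1) (2 ^ n * δ 1 0)) ∂ν = 2 ^ n / 8 * ∫ β, f β ∂ν := by
  let quarter : ℚ_[2]ˣ := Units.mk0 4⁻¹ (by norm_num)
  let negTwo : ℚ_[2]ˣ := Units.mk0 (-2) (by norm_num)
  let half : ℚ_[2]ˣ := Units.mk0 2⁻¹ (by norm_num)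
  let halfPow : ℚ_[2]ˣ := Units.mk0 (2 ^ n * 2⁻¹) (by norm_num)
  -- `m + a / 4` and `m - a / 4` arise from `m` and `a` by two elementary operations.
  let shear₀ : M2 → M2 := fun β => β + β 1 1 • Matrix.single 0 0 1
  let shear₁ : M2 → M2 := fun β => β + β 0 0 • Matrix.single 1 1 1
  have hcoord : ∀ δ : M2, phiCoord (δ 0 0) (δ 1 1) (δ 0 1) (2 ^ n * δ 1 0) =
      scaleEntry 1 0 halfPow (scaleEntry 0 1 half
        (shear₁ (scaleEntry 1 1 negTwo (shear₀ (scaleEntry 1 1 quarter δ))))) := fun δ => by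
    ext i j
    fin_cases i <;> fin_cases j <;>
      simp only [phiCoord, shear₀, shear₁, quarter, negTwo, half, halfPow, scaleEntry_apply,
        Matrix.add_apply, Matrix.smul_apply, Matrix.single_apply, Matrix.of_apply, Matrix.cons_val,
        Units.val_mk0, Fin.zero_eta, Fin.mk_one, one_ne_zero, zero_ne_one, and_true, and_false,
        if_true, if_false, smul_eq_mul] <;>
      ring
  simp only [hcoord]
  rw [integral_comp_scaleEntry hν 1 1 quarter fun β => f (scaleEntry 1 0 halfPow
      (scaleEntry 0 1 half (shear₁ (scaleEntry 1 1 negTwo (shear₀ β))))),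
    integral_comp_add_smul_single hν (by decide) fun β => f (scaleEntry 1 0 halfPow
      (scaleEntry 0 1 half (shear₁ (scaleEntry 1 1 negTwo β)))),
    integral_comp_scaleEntry hν 1 1 negTwo fun β => f (scaleEntry 1 0 halfPow
      (scaleEntry 0 1 half (shear₁ β))),
    integral_comp_add_smul_single hν (by decide) fun β => f (scaleEntry 1 0 halfPow
      (scaleEntry 0 1 half β)),
    integral_comp_scaleEntry hν 0 1 half fun β => f (scaleEntry 1 0 halfPow β),
    integral_comp_scaleEntry hν 1 0 halfPow f]
  have hfour : ‖(4 : ℚ_[2])‖ = 4⁻¹ := by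
    rw [show (4 : ℚ_[2]) = 2 ^ 2 by norm_num, norm_pow, norm_two_padic]
    norm_num
  simp only [quarter, negTwo, half, halfPow, Units.val_mk0, norm_neg, norm_mul, norm_inv, norm_pow,
    norm_two_padic, hfour]
  push_cast
  rw [inv_pow, mul_inv, inv_inv, inv_inv, inv_inv]
  ring

theorem innerM2_diagTwoPow (hν : ν integralM2 = 1) (n : ℕ) :
    innerM2 ν (AdFun (diagTwoPow n : PGL2) phi) phi =
      (2 ^ n)⁻¹ / 2 * (2 ^ (-3 : ℤ) * (kappa0 : ℂ)) ^ 2 * ((∑ ε, coeffResidue n ε : ℤ) : ℂ) := by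
  have hconj : ∀ m a b c, conjM2 (diagTwoPow n)⁻¹ (phiCoord m a b (2 ^ n * c)) =
      phiCoord m a (2 ^ n * b) c := fun m a b c => by
    rw [phiCoord, mul_div_assoc, conjM2_inv_diagTwoPow, ← mul_div_assoc, phiCoord]
  have h := integral_comp_phiCoord hν n
    fun β => phi (conjM2 (diagTwoPow n)⁻¹ β) * star (phi β)
  simp only [hconj, phi_mul_star_phi_eq_indicator] at h
  rw [integral_indicator isOpen_integralM2.measurableSet, integral_const_mul,
    setIntegral_integralM2_comp_residue hν fun ε => (coeffResidue n ε : ℂ), ← Int.cast_sum] at h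
  change _ = 2 ^ n / 8 * innerM2 ν (AdFun (diagTwoPow n : PGL2) phi) phi at h
  field_simp at h ⊢
  linear_combination (-8⁻¹) * h

theorem innerM2_diagTwoPow_zero (hν : ν integralM2 = 1) :
    innerM2 ν (AdFun (diagTwoPow 0 : PGL2) phi) phi =
      ((2 ^ (-4 : ℤ) * kappa0 ^ 2 * 3 : ℝ) : ℂ) := by
  rw [innerM2_diagTwoPow hν, sum_coeffResidue_zero]
  push_cast
  ring

theorem innerM2_diagTwoPow_succ (hν : ν integralM2 = 1) (n : ℕ) :
    innerM2 ν (AdFun (diagTwoPow (n + 1) : PGL2) phi) phi =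
      ((2 ^ (-4 : ℤ) * kappa0 ^ 2 * (2 ^ (n + 1))⁻¹ : ℝ) : ℂ) := by
  rw [innerM2_diagTwoPow hν, sum_coeffResidue_succ]
  push_cast
  ring

end Measure

/-! ### Integrals over `PGL₂(ℚ₂)` of bi-invariant functions against the coefficient of `φ` -/

theorem iUnion_sphere : ⋃ n, sphere n = Set.univ :=
  Set.eq_univ_of_forall fun x => Set.mem_iUnion.2 (exists_mem_sphere x)

section Integral

variable {ν : Measure M2} [ν.IsAddHaarMeasure]

theorem innerM2_mul_eq_of_mem_sphere (hν : ν integralM2 = 1) {f : PGL2 → ℝ} {ξ : ℕ → ℝ}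
    (hf : ∀ n, ∀ x ∈ sphere n, f x = ξ n) (n : ℕ) (x : PGL2) (hx : x ∈ sphere n) :
    innerM2 ν (AdFun x phi) phi * (f x : ℂ) =
      innerM2 ν (AdFun (diagTwoPow n : PGL2) phi) phi * (ξ n : ℂ) := by
  rw [innerM2_eq_of_mem_sphere hν hx, hf n x hx]

variable {ρ : Measure PGL2} [ρ.IsHaarMeasure]

theorem measureReal_sphere_mul_innerM2_succ (hν : ν integralM2 = 1)
    (hρ : ρ (sphere 0) = 1) (n : ℕ) :
    (ρ.real (sphere (n + 1)) : ℂ) * innerM2 ν (AdFun (diagTwoPow (n + 1) : PGL2) phi) phi =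
      ((2 ^ (-4 : ℤ) * kappa0 ^ 2 * (3 / 2) : ℝ) : ℂ) := by
  have hreal : ρ.real (sphere (n + 1)) = 3 * 2 ^ n := by
    rw [Measure.real, measure_sphere_succ hρ]
    simp
  rw [hreal, innerM2_diagTwoPow_succ hν, ← Complex.ofReal_mul]
  congr 1
  field_simp
  ring

theorem integrable_innerM2_mul (hν : ν integralM2 = 1) (hρ : ρ (sphere 0) = 1) {f : PGL2 → ℝ}
    {ξ : ℕ → ℝ} (hf : ∀ n, ∀ x ∈ sphere n, f x = ξ n) (hξ : Summable fun n => |ξ n|) :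
    Integrable (fun g => innerM2 ν (AdFun g phi) phi * (f g : ℂ)) ρ := by
  have hfin : ∀ n, ρ (sphere n) ≠ ⊤
    | 0 => hρ ▸ ENNReal.one_ne_top
    | n + 1 => by
      rw [measure_sphere_succ hρ]
      finiteness
  refine integrable_of_eq_const_of_iUnion_eq (fun n => (isOpen_sphere n).measurableSet)
    iUnion_sphere hfin (innerM2_mul_eq_of_mem_sphere hν hf) ((summable_nat_add_iff 1).1 ?_)
  refine (((summable_nat_add_iff 1).2 hξ).mul_left
    ‖((2 ^ (-4 : ℤ) * kappa0 ^ 2 * (3 / 2) : ℝ) : ℂ)‖).congr fun n => ?_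
  rw [← measureReal_sphere_mul_innerM2_succ hν hρ n, norm_mul, norm_mul, Complex.norm_real,
    Complex.norm_real, Real.norm_of_nonneg measureReal_nonneg, Real.norm_eq_abs, mul_assoc]

theorem integral_innerM2_mul (hν : ν integralM2 = 1) (hρ : ρ (sphere 0) = 1) {f : PGL2 → ℝ}
    {ξ : ℕ → ℝ} (hf : ∀ n, ∀ x ∈ sphere n, f x = ξ n) (hξ : Summable fun n => |ξ n|) {t : ℝ}
    (ht : HasSum (fun n => ξ (n + 1)) t) :
    ∫ g, innerM2 ν (AdFun g phi) phi * (f g : ℂ) ∂ρ =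
      ((2 ^ (-4 : ℤ) * kappa0 ^ 2 * (3 * ξ 0 + 3 / 2 * t) : ℝ) : ℂ) := by
  have hsum := hasSum_integral_of_eq_const (fun n => (isOpen_sphere n).measurableSet)
    iUnion_sphere pairwise_disjoint_sphere (innerM2_mul_eq_of_mem_sphere hν hf)
    (integrable_innerM2_mul hν hρ hf hξ)
  have htail := (Complex.hasSum_ofReal.2 ht).mul_left
    ((2 ^ (-4 : ℤ) * kappa0 ^ 2 * (3 / 2) : ℝ) : ℂ)
  have htail' : HasSum (fun n => ρ.real (sphere (n + 1)) •
      (innerM2 ν (AdFun (diagTwoPow (n + 1) : PGL2) phi) phi * (ξ (n + 1) : ℂ)))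
      (((2 ^ (-4 : ℤ) * kappa0 ^ 2 * (3 / 2) : ℝ) : ℂ) * (t : ℂ)) :=
    htail.congr_fun fun n => by
      rw [Complex.real_smul, ← mul_assoc, measureReal_sphere_mul_innerM2_succ hν hρ]
  rw [hsum.unique ((hasSum_nat_add_iff 1).1 htail'), Finset.sum_range_one, Measure.real, hρ,
    innerM2_diagTwoPow_zero hν, ENNReal.toReal_one, one_smul]
  push_cast
  ring

end Integral

section Spherical

variable {a b : ℚ} {R : Subring ℍ[ℚ,a,b]} {ι : ℍ[ℚ,a,b] →ₐ[ℚ] M2} {μ : Measure GL2} {D : Set GL2}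

theorem Xi_eq_of_mem_sphere [μ.IsHaarMeasure] (hD : IsFundamentalDomain (Gam R ι) D μ)
    (Φ : FunY R ι) (n : ℕ) (x : PGL2) (hx : x ∈ sphere n) :
    Xi μ D Φ x = matCoeff μ D Φ (diagTwoPow n) := by
  induction x using QuotientGroup.induction_on with
  | H g => exact matCoeff_eq_of_cartanSize_eq hD Φ n g (mk_mem_sphere_iff.1 hx)

end Spherical

theorem eulerFactorTwo_half_div_zetaLocal (lam : ℕ → ℝ) :
    eulerFactorTwo lam (1 / 2) / zetaLocal 2 2 = 3 / (2 * (3 - √2 * lam 2)) := by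
  have hrpow : (2 : ℝ) ^ (-(1 / 2) : ℝ) = √2 / 2 := by
    rw [Real.rpow_neg zero_le_two, ← Real.sqrt_eq_rpow, inv_eq_iff_eq_inv, inv_div,
      Real.div_sqrt]
  have hrpow' : (2 : ℝ) ^ (-(2 * (1 / 2)) : ℝ) = 1 / 2 := by
    norm_num [Real.rpow_neg]
  have hzeta : zetaLocal 2 2 = 4 / 3 := by
    norm_num [zetaLocal, Real.rpow_neg]
  have hden : 1 - lam 2 * (√2 / 2) + 1 / 2 = (3 - √2 * lam 2) / 2 := by ring
  rw [eulerFactorTwo, hrpow, hrpow', hzeta, hden, inv_div, div_div, mul_comm _ (4 / 3 : ℝ),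
    ← div_div, ← div_div]
  norm_num

end

theorem mainTheorem7_general {a b : ℚ} (ha : a < 0) (hb : b < 0)
    (h23 : ∀ x : ℍ[ℚ_[23],(a : ℚ_[23]),(b : ℚ_[23])], x ≠ 0 → IsUnit x)
    {R : Subring ℍ[ℚ,a,b]} (hR : IsOrder R) {ι : ℍ[ℚ,a,b] →ₐ[ℚ] M2}
    {μ : Measure GL2} [μ.IsHaarMeasure] {D : Set GL2} (hD : IsFundamentalDomain (Gam R ι) D μ)
    {Ψ : Fin 2 → FunY R ι} {lam : Fin 2 → ℕ → ℝ} (hΨ : IsHeckeBasis μ D Ψ lam)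
    {ψ : AddChar ℚ_[2] Circle} (hψ : IsUnramifiedChar ψ)
    {ν : Measure M2} [ν.IsAddHaarMeasure] (hνψ : IsSelfDual ψ ν)
    {ρ : Measure PGL2} [ρ.IsHaarMeasure] (hρ : ρ (PK2 : Set PGL2) = 1) (k : Fin 2) :
    IsSchwartzBruhat phi ∧
    Integrable (fun g : PGL2 => innerM2 ν (AdFun g phi) phi * (Xi μ D (Ψ k) g : ℂ)) ρ ∧
    ∫ g : PGL2, innerM2 ν (AdFun g phi) phi * (Xi μ D (Ψ k) g : ℂ) ∂ρ =
      ((2 ^ (-4 : ℤ) * kappa0 ^ 2 *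
        (2 + eulerFactorTwo (lam k) (1 / 2) / zetaLocal 2 2) : ℝ) : ℂ) := by
  have hν := measure_integralM2 hψ hνψ
  have hρ' : ρ (sphere 0) = 1 := by rwa [sphere_zero]
  have hs := abs_eigenvalue_lt_three hΨ hR hD ha hb h23 k
  have hrec := matCoeff_diagTwoPow_add_two hΨ hR hD k
  have hzero := matCoeff_diagTwoPow_zero hΨ k
  have hXi := Xi_eq_of_mem_sphere hD (Ψ k)
  have hsummable := summable_of_recurrence hs hrec
  have hsum := hasSum_of_recurrence hs hrec hzero (three_mul_matCoeff_diagTwoPow_one hΨ hR hD k)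
  refine ⟨isSchwartzBruhat_phi, integrable_innerM2_mul hν hρ' hXi hsummable,
    (integral_innerM2_mul hν hρ' hXi hsummable hsum).trans (congrArg _ ?_)⟩
  have hne : 3 - √2 * lam k 2 ≠ 0 := (sub_pos.2 (abs_lt.1 hs).2).ne'
  rw [eulerFactorTwo_half_div_zetaLocal, hzero]
  field_simp
  ring

theorem mainTheorem7
    -- the quaternion algebra, a maximal order in it, and the embedding in `M₂(ℚ₂)`
    (a b : ℚ) (hB : IsRamifiedAtInftyAnd23 a b)
    (R : Subring ℍ[ℚ, a, b]) (hR : Maximal IsOrder R)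
    (ι : ℍ[ℚ, a, b] →ₐ[ℚ] M2) (hι : ∀ x ∈ R, ι x ∈ integralM2)
    -- the Haar measure on `GL₂(ℚ₂)`, a fundamental domain for `Γ`, the eigenfunctions
    (μ : Measure GL2) (hμ : μ.IsHaarMeasure) (hμK : μ (K2 : Set GL2) = 2)
    (D : Set GL2) (hD : IsFundamentalDomain (Gam R ι) D μ)
    (Ψ : Fin 2 → FunY R ι) (lam : Fin 2 → ℕ → ℝ) (hΨ : IsHeckeBasis μ D Ψ lam)
    -- the self-dual measure on `M₂(ℚ₂)`
    (ψ : AddChar ℚ_[2] Circle) (hψ : IsUnramifiedChar ψ)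
    (ν : Measure M2) (hν : ν.IsAddHaarMeasure) (hνψ : IsSelfDual ψ ν)
    -- the Haar measure on `PGL₂(ℚ₂)`
    (ρ : Measure PGL2) (hρ : ρ.IsHaarMeasure) (hρK : ρ (PK2 : Set PGL2) = 1)
    (k : Fin 2) :
    IsSchwartzBruhat phi ∧
    Integrable (fun g : PGL2 => innerM2 ν (AdFun g phi) phi * (Xi μ D (Ψ k) g : ℂ)) ρ ∧
    ∫ g : PGL2, innerM2 ν (AdFun g phi) phi * (Xi μ D (Ψ k) g : ℂ) ∂ρ =
      ((2 ^ (-4 : ℤ) * kappa0 ^ 2 *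
        (2 + eulerFactorTwo (lam k) (1 / 2) / zetaLocal 2 2) : ℝ) : ℂ) := by
  obtain ⟨ha, hb⟩ := neg_of_forall_isUnit hB.1
  exact mainTheorem7_general (Rat.cast_lt_zero.1 ha) (Rat.cast_lt_zero.1 hb) ((hB.2 23).1 rfl)
    hR.prop hD hΨ hψ hνψ hρK k
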